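/- **Theorem 1 (Appearance of blocking events).** Let $G=(V,E)$ be a finite simple graph of maximal degree at most $K$. A link configuration is a finite sequence $c=(e_i,s_i)_{i\le n}$, $n\ge 0$, of edges $e_i\in E$ together with types $s_i\in\{\text{cross},\text{double bar}\}$. Let $\beta>0$, $\theta>0$ and $0<u\le 1$. The random loop model is the probability measure $\mathbb P$ on link configurations with $$\mathbb P(\{c\})=\frac1Z\,\frac{\beta^n}{n!}\,u^{\#\text{crosses of }c}\,(1-u)^{\#\text{double bars of }c}\,\theta^{|\mathcal L(c)|},$$ where $Z$ is the normalising constant and $|\mathcal L(c)|$ is the number of loops of $c$: place the links of $c$ in their order along a periodic time axis above each vertex and follow the axes; at a link on $\{x,y\}$ one moves from $x$ to $y$ (or from $y$ to $x$), keeping the time direction at a cross and reversing it at a double bar; all other points of the axes are traversed straight. (For $\theta=1$ this means: independent $\mathrm{Poisson}(\beta)$ numbers of links on the edges, put in uniformly random order, each link independently being a cross with probability $u$.) An edge $e$ is blocking for $c$ if it carries exactly two links, both are crosses, and no link placed between these two in the sequence is on an edge that shares a vertex with $e$. Then for every set $\tilde E\subseteq E$, conditionally on the event that each edge of $\tilde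 E$ carries at least one link and no edge of $E\setminus\tilde E$ carries a link, the field of indicators $(\mathbf 1_{\{e\text{ is blocking}\}})_{e\in\tilde E}$ stochastically dominates Bernoulli edge percolation on $\tilde E$ with parameter $$\delta(\beta,u,\theta)=\frac12\left(\frac{u\check\theta}{K}\right)^2\frac{\beta\check\theta^3}{\beta\check\theta^3+3\cdot 4^{K+1}}\left(\frac{\beta\hat\theta}{e^{\beta\hat\theta}-1}\right)^{2K-1},\qquad \check\theta=\min\{\theta,1/\theta\},\ \hat\theta=\max\{\theta,1/\theta\}$$ (if $K=0$ there are no edges and nothing to prove). -/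

import Mathlib

open MeasureTheory ProbabilityTheory

/-- The two types of links. -/
inductive LinkType
  | cross
  | doubleBar
  deriving DecidableEq

/-- A link configuration on `G`: a finite (possibly empty) sequence of links; each link is an edge
of `G` together with a type. -/
abbrev LinkConfig {V : Type*} (G : SimpleGraph V) : Type _ := List (G.edgeSet × LinkType)

/-- The countable set of link configurations carries the discrete sigma-algebra. -/
instance LinkConfig.instMeasurableSpace {V : Type*} (G : SimpleGraph V) :
    MeasurableSpace (LinkConfig G) := ⊤

/-- The links of `c` (of length `n`) cut the time circle above each vertex `v` into segments
`(v, t)` with `t = 0, …, n`: for `0 < t < n`, the segment `(v, t)` lies between the consecutive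
links `t - 1` and `t` (links are counted from `0`), `(v, 0)` lies before the first link, `(v, n)`
after the last one. The relation `SegmentGlued c` tells which segments are glued together:
time is periodic; a vertex not met by link `i` is traversed straight; along a cross one changes the
vertex and keeps the direction; along a double bar one changes the vertex and the direction. -/
inductive SegmentGlued {V : Type*} {G : SimpleGraph V} (c : LinkConfig G) :
    V × Fin (c.length + 1) → V × Fin (c.length + 1) → Prop
  | period (v : V) : SegmentGlued c (v, 0) (v, Fin.last c.length)
  | straight (i : Fin c.length) (v : V) (hv : v ∉ ((c.get i).1 : Sym2 V)) :
      SegmentGlued c (v, i.castSucc) (v, i.succ)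
  | cross (i : Fin c.length) (x y : V) (he : ((c.get i).1 : Sym2 V) = s(x, y))
      (hs : (c.get i).2 = LinkType.cross) : SegmentGlued c (x, i.castSucc) (y, i.succ)
  | barBelow (i : Fin c.length) (x y : V) (he : ((c.get i).1 : Sym2 V) = s(x, y))
      (hs : (c.get i).2 = LinkType.doubleBar) : SegmentGlued c (x, i.castSucc) (y, i.castSucc)
  | barAbove (i : Fin c.length) (x y : V) (he : ((c.get i).1 : Sym2 V) = s(x, y))
      (hs : (c.get i).2 = LinkType.doubleBar) : SegmentGlued c (x, i.succ) (y, i.succ)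

/-- The number of loops of `c`: the number of classes of the equivalence relation generated by
`SegmentGlued c`. -/
noncomputable def numLoops {V : Type*} {G : SimpleGraph V} (c : LinkConfig G) : ℕ :=
  Nat.card (Quot (SegmentGlued c))

/-- The unnormalised weight of a link configuration `c` of length `n`,
`β ^ n / n! * u ^ #crosses * (1 - u) ^ #doubleBars * θ ^ #loops`. Up to the constant
`exp (-β |E|)`, the factor `β ^ n / n!` is the probability that the edge sequence of `c` arises when
each edge independently gets a Poisson(`β`) number of links and all links are put in
uniformly random order (a Poisson(`β |E|`) number of links, each on a uniform edge). -/
noncomputable def loopWeight {V : Type*} {G : SimpleGraph V} (β u θ : ℝ) (c : LinkConfig G) : ℝ :=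
  β ^ c.length / (c.length.factorial : ℝ)
    * u ^ (c.countP fun l => l.2 = LinkType.cross)
    * (1 - u) ^ (c.countP fun l => l.2 = LinkType.doubleBar)
    * θ ^ numLoops c

/-- The random loop model with parameters `β, u, θ` on `G`: the probability measure on link
configurations proportional to `loopWeight β u θ`. -/
noncomputable def loopMeasure {V : Type*} (G : SimpleGraph V) (β u θ : ℝ) :
    Measure (LinkConfig G) :=
  (∑' c : LinkConfig G, ENNReal.ofReal (loopWeight β u θ c))⁻¹ •
    Measure.sum fun c : LinkConfig G => ENNReal.ofReal (loopWeight β u θ c) • Measure.dirac c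

/-- The event that exactly the edges in `F` carry at least one link. -/
def openEdgesEq {V : Type*} {G : SimpleGraph V} (F : Finset G.edgeSet) : Set (LinkConfig G) :=
  {c | ∀ e : G.edgeSet, (∃ l ∈ c, l.1 = e) ↔ e ∈ F}

/-- The edge `e` is blocking for `c`: it carries exactly two links, both are crosses, and no link
placed between them is on an edge that shares a vertex with `e`. -/
def IsBlocking {V : Type*} {G : SimpleGraph V} (c : LinkConfig G) (e : G.edgeSet) : Prop :=
  ∃ i j : Fin c.length, i < j ∧
    (∀ k : Fin c.length, (c.get k).1 = e ↔ k = i ∨ k = j) ∧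
    (c.get i).2 = LinkType.cross ∧ (c.get j).2 = LinkType.cross ∧
    ∀ k : Fin c.length, i < k → k < j → ∀ v : V, v ∈ ((c.get k).1 : Sym2 V) → v ∉ (e : Sym2 V)

open Classical in
/-- The field of blocking indicators on the edges in `F`. -/
noncomputable def blockingField {V : Type*} {G : SimpleGraph V} (F : Finset G.edgeSet)
    (c : LinkConfig G) : F → Bool :=
  fun e => decide (IsBlocking c (e : G.edgeSet))

/-- Bernoulli percolation on a finite index set: the coordinates are independent, each of them is
`true` with probability `p`. -/
noncomputable def bernoulliPercolation (ι : Type*) [Fintype ι] (p : unitInterval) :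
    Measure (ι → Bool) :=
  Measure.pi fun _ => bernoulliMeasure true false p

/-- `μ` stochastically dominates `ν`: every increasing event is at least as likely under `μ`. -/
def StochasticallyDominates {Ω : Type*} [Preorder Ω] [MeasurableSpace Ω] (μ ν : Measure Ω) : Prop :=
  ∀ A : Set Ω, IsUpperSet A → MeasurableSet A → ν A ≤ μ A

/-- The percolation parameter `δ(β, u, θ)` for graphs of maximal degree `K`. -/
noncomputable def blockingDelta (K : ℕ) (β u θ : ℝ) : ℝ :=
  let θmin := min θ θ⁻¹
  let θmax := max θ θ⁻¹
  1 / 2 * (u * θmin / K) ^ 2 * (β * θmin ^ 3 / (β * θmin ^ 3 + 3 * 4 ^ (K + 1)))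
    * (β * θmax / (Real.exp (β * θmax) - 1)) ^ (2 * K - 1)

/-- `δ(β, u, θ)` is a probability. -/
theorem blockingDelta_mem (K : ℕ) {β u θ : ℝ} (hβ : 0 < β) (hu : 0 < u) (hu1 : u ≤ 1)
    (hθ : 0 < θ) : blockingDelta K β u θ ∈ unitInterval := by
  have hθ' : 0 < θ⁻¹ := inv_pos.mpr hθ
  have hm : 0 < min θ θ⁻¹ := lt_min hθ hθ'
  have hM : 0 < max θ θ⁻¹ := lt_max_of_lt_left hθ
  have hm1 : min θ θ⁻¹ ≤ 1 := by
    rcases le_total θ 1 with h | h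
    · exact (min_le_left _ _).trans h
    · exact (min_le_right _ _).trans (inv_le_one_of_one_le₀ h)
  have h1 : 0 ≤ u * min θ θ⁻¹ / K := by positivity
  have h1' : u * min θ θ⁻¹ / K ≤ 1 := by
    rcases Nat.eq_zero_or_pos K with rfl | hK
    · simp
    · have hK1 : (1 : ℝ) ≤ K := by exact_mod_cast hK
      rw [div_le_one (by linarith)]
      exact (mul_le_one₀ hu1 hm.le hm1).trans hK1
  have h2 : 0 ≤ β * min θ θ⁻¹ ^ 3 / (β * min θ θ⁻¹ ^ 3 + 3 * 4 ^ (K + 1)) := by positivity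
  have h2' : β * min θ θ⁻¹ ^ 3 / (β * min θ θ⁻¹ ^ 3 + 3 * 4 ^ (K + 1)) ≤ 1 := by
    rw [div_le_one (by positivity)]
    have : (0 : ℝ) ≤ 3 * 4 ^ (K + 1) := by positivity
    linarith
  have hx : 0 < β * max θ θ⁻¹ := by positivity
  have hexp := Real.add_one_le_exp (β * max θ θ⁻¹)
  have h3 : 0 ≤ β * max θ θ⁻¹ / (Real.exp (β * max θ θ⁻¹) - 1) :=
    div_nonneg hx.le (by linarith)
  have h3' : β * max θ θ⁻¹ / (Real.exp (β * max θ θ⁻¹) - 1) ≤ 1 := by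
    rw [div_le_one (by linarith)]
    linarith
  have h4 := pow_nonneg h1 2
  have h4' := pow_le_one₀ (n := 2) h1 h1'
  have h5 := pow_nonneg h3 (2 * K - 1)
  have h5' := pow_le_one₀ (n := 2 * K - 1) h3 h3'
  refine ⟨?_, ?_⟩
  · simp only [blockingDelta]
    positivity
  · simp only [blockingDelta]
    refine mul_le_one₀ (mul_le_one₀ ?_ h2 h2') h5 h5'
    linarith

/-! It suffices to bound one edge at a time: if, given the open edges `F` and the blocking status of
all other edges of `F`, the edge `e` is blocking with conditional probability at least δ, then
resampling the coordinates one after the other yields the domination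
(`stochasticallyDominates_bernoulliPercolation`). Write x = β max(θ, 1/θ), and let B be the
prescribed set of other blocking edges. The pattern with and without the requirement that `e` is
blocking is compared with the same reference mass Y, that of `loosePatternSet F e B ∅`: no link on
`e`, the other edges of `F` open, and exactly those of B blocking among them.

Two facts on loops enter. Adding or removing one link changes the number of loops by at most one
(`numLoops_insertIdx`), so a link costs at most a factor max(θ, 1/θ). Two consecutive crosses on an
edge with no adjacent link between them can be erased without changing the number of loops
(`numLoops_append_cross_pair`), so a blocking pair has an exact price. The first fact gives the
double counting bound `tsum_card_removable_le`: the total weight of pairs (configuration, link on f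
whose removal leads into T) is at most x times the mass of T.

Upper bound (`mass_patternSet_le`): erasing all links on `e` costs at most e^x - 1. This may turn
edges adjacent to `e` into blocking ones. Each such surplus edge is spoiled by removing either of
its two crosses, which costs a factor 1 + x/2 per adjacent edge, and there are at most 2K - 2 of
them.

Lower bound: insert two crosses on `e` into a reference configuration of length n. The weight is
multiplied by (βu)²/((n+1)(n+2)), so it remains to count good pairs of positions. A position is
allowed if a cross there leaves all of B blocking, and two allowed positions form a good pair if no
link adjacent to `e` lies between them. The adjacent links, M in number, cut the sequence into at
most M + 1 blocks, and Cauchy–Schwarz bounds the number of good pairs from below in terms of the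
number of allowed positions and M + 1. The mean of M + 1 is at most 1 + (2K-2)(2K+x)
(`tsum_numAdjacent_le`). The mean proportion of allowed positions is at least 1/(4K-3)
(`sum_markedSet_le`): if a cross on `e` falls between the two crosses of an edge f of B, exchange it
with the second cross of f. This preserves the weight without `e`, is injective once the shared
vertex is fixed, and strictly lowers the number of adjacent edges of B that still have links after
the cross, so it can be iterated, alternating between the end points of `e`, until no edge of B is
disturbed.

Together, with K = k + 1, the blocking mass is at least (βu)² Y / (2 (4k+1)² (1 + 2k(2k+2+x))). The
inequality `blockingDelta_mul_le` shows that δ is below the resulting ratio. -/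

open scoped ENNReal

/-! ### Loops: effect of inserting, removing or changing links -/

section Loops

variable {V : Type*}

/-- The gluing relation of a sequence of `n` slices: slice `i` is empty if `s i = none`, carries
a link of type `t` on `e` if `s i = some (e, some t)`, and is cut open at the end points of `e` if
`s i = some (e, none)`. -/
inductive Glue (s : ℕ → Option (Sym2 V × Option LinkType)) (n : ℕ) :
    V × Fin (n + 1) → V × Fin (n + 1) → Prop
  | period (v : V) : Glue s n (v, 0) (v, Fin.last n)
  | straight (i : Fin n) (v : V) (hv : ∀ q, s i = some q → v ∉ q.1) :
      Glue s n (v, i.castSucc) (v, i.succ)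
  | cross (i : Fin n) (x y : V) (h : s i = some (s(x, y), some LinkType.cross)) :
      Glue s n (x, i.castSucc) (y, i.succ)
  | barBelow (i : Fin n) (x y : V) (h : s i = some (s(x, y), some LinkType.doubleBar)) :
      Glue s n (x, i.castSucc) (y, i.castSucc)
  | barAbove (i : Fin n) (x y : V) (h : s i = some (s(x, y), some LinkType.doubleBar)) :
      Glue s n (x, i.succ) (y, i.succ)

/-- The number of loops of a sequence of slices. -/
noncomputable def loops (s : ℕ → Option (Sym2 V × Option LinkType)) (n : ℕ) : ℕ :=
  Nat.card (Quot (Glue s n))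

/-- The slices of a link configuration. -/
def slices {G : SimpleGraph V} (c : LinkConfig G) (k : ℕ) : Option (Sym2 V × Option LinkType) :=
  (getElem? c k).map fun l => ((l.1 : Sym2 V), some l.2)

/-- Slices are more flexible than links: a link can be blanked or cut open in place, without
shifting the positions of the others. -/
theorem numLoops_eq_loops {G : SimpleGraph V} (c : LinkConfig G) :
    numLoops c = loops (slices c) c.length := by
  have key : ∀ i : Fin c.length, slices c i = some (((c.get i).1 : Sym2 V), some (c.get i).2) := by
    intro i
    simp [slices]
  have : SegmentGlued c = Glue (slices c) c.length := by
    ext a b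
    constructor
    · rintro (v | ⟨i, v, hv⟩ | ⟨i, x, y, he, hs⟩ | ⟨i, x, y, he, hs⟩ | ⟨i, x, y, he, hs⟩)
      · exact .period v
      · refine .straight i v fun q hq => ?_
        rw [key] at hq
        cases hq
        exact hv
      · exact .cross i x y (by rw [key, he, hs])
      · exact .barBelow i x y (by rw [key, he, hs])
      · exact .barAbove i x y (by rw [key, he, hs])
    · rintro (v | ⟨i, v, hv⟩ | ⟨i, x, y, h⟩ | ⟨i, x, y, h⟩ | ⟨i, x, y, h⟩)
      · exact .period v
      · exact .straight i v (hv _ (key i))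
      all_goals
        rw [key] at h
        simp only [Option.some.injEq, Prod.mk.injEq] at h
      · exact .cross i x y h.1 h.2
      · exact .barBelow i x y h.1 h.2
      · exact .barAbove i x y h.1 h.2
  rw [numLoops, loops, this]

/-- A surjection induces a bijection of the classes if it respects the relations, every generating
pair downstairs lifts, and its fibres lie in single classes. -/
theorem card_quot_eq_of_surjective {A B : Type*} {r : A → A → Prop} {r' : B → B → Prop}
    (φ : A → B) (hφ : Function.Surjective φ)
    (h1 : ∀ a a', r a a' → Relation.EqvGen r' (φ a) (φ a'))
    (h2 : ∀ b b', r' b b' → ∃ a a', φ a = b ∧ φ a' = b' ∧ Relation.EqvGen r a a')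
    (h3 : ∀ a a', φ a = φ a' → Relation.EqvGen r a a') :
    Nat.card (Quot r) = Nat.card (Quot r') := by
  refine Nat.card_eq_of_bijective
    (Quot.lift (fun a => Quot.mk r' (φ a)) fun a a' h => Quot.eqvGen_sound (h1 a a' h)) ⟨?_, ?_⟩
  · have : ∀ b b', Relation.EqvGen r' b b' → ∀ a a', φ a = b → φ a' = b' →
        Relation.EqvGen r a a' := by
      intro b b' h
      induction h with
      | rel b b' h =>
        rintro a a' rfl rfl
        obtain ⟨a1, a2, e1, e2, h⟩ := h2 _ _ h
        exact ((h3 _ _ e1.symm).trans _ _ _ h).trans _ _ _ (h3 _ _ e2)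
      | refl b => rintro a a' rfl h; exact h3 _ _ h.symm
      | symm b b' _ ih => exact fun a a' ha ha' => (ih a' a ha' ha).symm
      | trans b1 b2 b3 _ _ ih1 ih2 =>
        intro a a' ha ha'
        obtain ⟨a2, rfl⟩ := hφ b2
        exact (ih1 a a2 ha rfl).trans _ _ _ (ih2 a2 a' rfl ha')
    rintro ⟨a⟩ ⟨a'⟩ h
    exact Quot.eqvGen_sound (this _ _ (Quot.eqvGen_exact h) a a' rfl rfl)
  · rintro ⟨b⟩
    obtain ⟨a, rfl⟩ := hφ b
    exact ⟨Quot.mk _ a, rfl⟩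

/-- Inserting an empty slice does not change the number of loops. -/
theorem loops_insert_none {s s' : ℕ → Option (Sym2 V × Option LinkType)} {n p : ℕ} (hp : p ≤ n)
    (hlt : ∀ k < p, s' k = s k) (hpp : s' p = none) (hge : ∀ k, p ≤ k → s' (k + 1) = s k) :
    loops s' (n + 1) = loops s n := by
  -- Collapses the segments `p` and `p + 1`, which the empty slice `p` glues together at every
  -- vertex.
  let f : Fin (n + 2) → Fin (n + 1) :=
    fun t => ⟨if t.1 ≤ p then t.1 else t.1 - 1, by split_ifs <;> omega⟩
  have hmid : ∀ v : V, Glue s' (n + 1) (v, ⟨p, by omega⟩) (v, ⟨p + 1, by omega⟩) := fun v =>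
    .straight ⟨p, by omega⟩ v (by simp [hpp])
  refine card_quot_eq_of_surjective (fun a => (a.1, f a.2)) ?_ ?_ ?_ ?_
  · rintro ⟨v, t⟩
    refine ⟨(v, ⟨if t.1 ≤ p then t.1 else t.1 + 1, by split_ifs <;> omega⟩), ?_⟩
    by_cases h : t.1 ≤ p
    · simp [f, h]
    · have : ¬ (t.1 + 1 ≤ p) := by omega
      simp [f, h, this]
  · have hcase : ∀ i : Fin (n + 1), i.1 = p ∨ ∃ j : Fin n, s' i = s j ∧ f i.castSucc = j.castSucc ∧
        f i.succ = j.succ := by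
      intro i
      rcases lt_trichotomy i.1 p with h | h | h
      · refine Or.inr ⟨⟨i.1, by omega⟩, hlt _ h, ?_, ?_⟩ <;> ext <;> simp [f] <;> omega
      · exact Or.inl h
      · refine Or.inr ⟨⟨i.1 - 1, by omega⟩, ?_, ?_, ?_⟩
        · have := hge (i.1 - 1) (by omega)
          rwa [Nat.sub_add_cancel (by omega)] at this
        all_goals ext; simp only [f, Fin.val_castSucc, Fin.val_succ]; split_ifs <;> omega
    rintro a a' (v | ⟨i, v, hv⟩ | ⟨i, x, y, h⟩ | ⟨i, x, y, h⟩ | ⟨i, x, y, h⟩)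
    · have h0 : f 0 = 0 := by ext; simp [f]
      have h1 : f (Fin.last (n + 1)) = Fin.last n := by ext; simp [f]; omega
      simp only [h0, h1]
      exact .rel _ _ (.period v)
    · rcases hcase i with hi | ⟨j, e, e1, e2⟩
      · have : f i.castSucc = f i.succ := by
          ext; simp only [f, Fin.val_castSucc, Fin.val_succ]; split_ifs <;> omega
        simp only [this]
        exact .refl _
      · simp only [e1, e2]
        exact .rel _ _ (.straight j v (e ▸ hv))
    all_goals
      rcases hcase i with hi | ⟨j, e, e1, e2⟩
      · simp [hi, hpp] at h
      rw [e] at h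
      simp only [e1, e2]
    · exact .rel _ _ (.cross j x y h)
    · exact .rel _ _ (.barBelow j x y h)
    · exact .rel _ _ (.barAbove j x y h)
  · have hcase : ∀ i : Fin n, ∃ j : Fin (n + 1), s' j = s i ∧ f j.castSucc = i.castSucc ∧
        f j.succ = i.succ := by
      intro i
      by_cases h : i.1 < p
      · refine ⟨⟨i.1, by omega⟩, hlt _ h, ?_, ?_⟩ <;> ext <;> simp [f] <;> omega
      · refine ⟨⟨i.1 + 1, by omega⟩, hge _ (by omega), ?_, ?_⟩ <;> ext <;> simp [f] <;> omega
    rintro a a' (v | ⟨i, v, hv⟩ | ⟨i, x, y, h⟩ | ⟨i, x, y, h⟩ | ⟨i, x, y, h⟩)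
    · refine ⟨(v, 0), (v, Fin.last _), ?_, ?_, .rel _ _ (.period v)⟩ <;> simp [f]
      ext; simp; omega
    all_goals obtain ⟨j, e, e1, e2⟩ := hcase i
    · exact ⟨(v, j.castSucc), (v, j.succ), by simp [e1], by simp [e2],
        .rel _ _ (.straight j v (e ▸ hv))⟩
    · exact ⟨(x, j.castSucc), (y, j.succ), by simp [e1], by simp [e2],
        .rel _ _ (.cross j x y (e ▸ h))⟩
    · exact ⟨(x, j.castSucc), (y, j.castSucc), by simp [e1], by simp [e1],
        .rel _ _ (.barBelow j x y (e ▸ h))⟩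
    · exact ⟨(x, j.succ), (y, j.succ), by simp [e2], by simp [e2],
        .rel _ _ (.barAbove j x y (e ▸ h))⟩
  · rintro ⟨v, t⟩ ⟨v', t'⟩ h
    simp only [Prod.mk.injEq, f, Fin.mk.injEq] at h
    obtain ⟨rfl, h⟩ := h
    by_cases hp1 : t.1 = p ∧ t'.1 = p + 1
    · obtain ⟨h1, h2⟩ := hp1
      convert Relation.EqvGen.rel _ _ (hmid v)
    by_cases hp2 : t'.1 = p ∧ t.1 = p + 1
    · obtain ⟨h1, h2⟩ := hp2
      convert (Relation.EqvGen.rel _ _ (hmid v)).symm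
    have : t = t' := by ext; split_ifs at h <;> omega
    rw [this]
    exact .refl _

/-- Two crosses on the edge `xy` without a link at `x` or `y` between them can be removed. -/
theorem loops_erase_cross_pair {s s' : ℕ → Option (Sym2 V × Option LinkType)} {n i j : ℕ} {x y : V}
    (hxy : x ≠ y) (hij : i < j) (hj : j < n)
    (hi : s i = some (s(x, y), some LinkType.cross))
    (hj' : s j = some (s(x, y), some LinkType.cross))
    (hbtw : ∀ k q, i < k → k < j → s k = some q → x ∉ q.1 ∧ y ∉ q.1)
    (hi0 : s' i = none) (hj0 : s' j = none) (hs : ∀ k, k ≠ i → k ≠ j → s' k = s k) :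
    loops s n = loops s' n := by
  classical
  -- Exchange the names of the strands at `x` and `y` on the segments between the two crosses: this
  -- turns the crosses into straight passages and affects nothing else, as no link in between meets
  -- `x` or `y`.
  let g : Fin (n + 1) → V → V := fun t v =>
    if i < t.1 ∧ t.1 ≤ j then Equiv.swap x y v else v
  have hgg : ∀ t v, g t (g t v) = v := by
    intro t v
    simp only [g]
    split_ifs <;> simp
  let Φ : V × Fin (n + 1) → V × Fin (n + 1) := fun a => (g a.2 a.1, a.2)
  have hΦ : Function.Involutive Φ := by
    rintro ⟨v, t⟩
    simp [Φ, hgg]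
  have g0 : ∀ v, g 0 v = v := fun v => by simp [g]
  have gl : ∀ v, g (Fin.last n) v = v := fun v => by simp [g]; omega
  have gfix : ∀ t v, v ≠ x → v ≠ y → g t v = v := by
    intro t v h1 h2
    simp only [g]
    split_ifs
    · exact Equiv.swap_apply_of_ne_of_ne h1 h2
    · rfl
  have gout : ∀ (t : Fin (n + 1)) v, ¬ (i < t.1 ∧ t.1 ≤ j) → g t v = v := by
    intro t v h
    simp only [g, if_neg h]
  have gin : ∀ (t : Fin (n + 1)) v, (i < t.1 ∧ t.1 ≤ j) → g t v = Equiv.swap x y v := by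
    intro t v h
    simp only [g, if_pos h]
  have hfwd : ∀ a b, Glue s n a b → Glue s' n (Φ a) (Φ b) := by
    rintro a a' (v | ⟨k, v, hv⟩ | ⟨k, z, w, h⟩ | ⟨k, z, w, h⟩ | ⟨k, z, w, h⟩)
    · simp only [Φ, g0, gl]
      exact .period v
    · simp only [Φ]
      by_cases hki : k.1 = i
      · have := hv _ (hki ▸ hi)
        simp only [Sym2.mem_iff, not_or] at this
        rw [gfix _ v this.1 this.2, gfix _ v this.1 this.2]
        exact .straight k v (by simp [hki, hi0])
      by_cases hkj : k.1 = j
      · have := hv _ (hkj ▸ hj')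
        simp only [Sym2.mem_iff, not_or] at this
        rw [gfix _ v this.1 this.2, gfix _ v this.1 this.2]
        exact .straight k v (by simp [hkj, hj0])
      have e : g k.castSucc v = g k.succ v := by
        simp only [g, Fin.val_castSucc, Fin.val_succ]
        congr 1
        simp only [eq_iff_iff]
        omega
      rw [e]
      refine .straight k _ fun q hq => ?_
      rw [hs _ hki hkj] at hq
      by_cases hb : i < k.1 ∧ k.1 < j
      · have h2 := hbtw _ _ hb.1 hb.2 hq
        rw [gin _ _ (by simp; omega)]
        by_cases hvx : v = x
        · subst hvx; simpa using h2.2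
        by_cases hvy : v = y
        · subst hvy; simpa using h2.1
        rw [Equiv.swap_apply_of_ne_of_ne hvx hvy]
        exact hv _ hq
      · rw [gout _ _ (by simp; omega)]
        exact hv _ hq
    · simp only [Φ]
      by_cases hki : k.1 = i
      · rw [hki, hi] at h
        simp only [Option.some.injEq, Prod.mk.injEq, and_true] at h
        rw [gout _ z (by simp; omega), gin _ w (by simp; omega)]
        have : Equiv.swap x y w = z := by
          rcases Sym2.eq_iff.1 h with ⟨rfl, rfl⟩ | ⟨rfl, rfl⟩ <;> simp
        rw [this]
        exact .straight k _ (by simp [hki, hi0])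
      by_cases hkj : k.1 = j
      · rw [hkj, hj'] at h
        simp only [Option.some.injEq, Prod.mk.injEq, and_true] at h
        rw [gin _ z (by simp; omega), gout _ w (by simp; omega)]
        have : Equiv.swap x y z = w := by
          rcases Sym2.eq_iff.1 h with ⟨rfl, rfl⟩ | ⟨rfl, rfl⟩ <;> simp
        rw [this]
        exact .straight k _ (by simp [hkj, hj0])
      have h' := h
      rw [← hs _ hki hkj] at h'
      by_cases hb : i < k.1 ∧ k.1 < j
      · have h2 := hbtw _ _ hb.1 hb.2 h
        simp only [Sym2.mem_iff, not_or] at h2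
        rw [gfix _ z (Ne.symm h2.1.1) (Ne.symm h2.2.1), gfix _ w (Ne.symm h2.1.2) (Ne.symm h2.2.2)]
        exact .cross k z w h'
      · rw [gout _ z (by simp; omega), gout _ w (by simp; omega)]
        exact .cross k z w h'
    · have hki : k.1 ≠ i := fun hki => by rw [hki, hi] at h; simp at h
      have hkj : k.1 ≠ j := fun hki => by rw [hki, hj'] at h; simp at h
      have h' := h
      rw [← hs _ hki hkj] at h'
      simp only [Φ]
      by_cases hb : i < k.1 ∧ k.1 < j
      · have h2 := hbtw _ _ hb.1 hb.2 h
        simp only [Sym2.mem_iff, not_or] at h2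
        rw [gfix _ z (Ne.symm h2.1.1) (Ne.symm h2.2.1), gfix _ w (Ne.symm h2.1.2) (Ne.symm h2.2.2)]
        exact .barBelow k z w h'
      · rw [gout _ z (by simp; omega), gout _ w (by simp; omega)]
        exact .barBelow k z w h'
    · have hki : k.1 ≠ i := fun hki => by rw [hki, hi] at h; simp at h
      have hkj : k.1 ≠ j := fun hki => by rw [hki, hj'] at h; simp at h
      have h' := h
      rw [← hs _ hki hkj] at h'
      simp only [Φ]
      by_cases hb : i < k.1 ∧ k.1 < j
      · have h2 := hbtw _ _ hb.1 hb.2 h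
        simp only [Sym2.mem_iff, not_or] at h2
        rw [gfix _ z (Ne.symm h2.1.1) (Ne.symm h2.2.1), gfix _ w (Ne.symm h2.1.2) (Ne.symm h2.2.2)]
        exact .barAbove k z w h'
      · rw [gout _ z (by simp; omega), gout _ w (by simp; omega)]
        exact .barAbove k z w h'
  have hbwd : ∀ a b, Glue s' n a b → Glue s n (Φ a) (Φ b) := by
    rintro a a' (v | ⟨k, v, hv⟩ | ⟨k, z, w, h⟩ | ⟨k, z, w, h⟩ | ⟨k, z, w, h⟩)
    · simp only [Φ, g0, gl]
      exact .period v
    · simp only [Φ]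
      by_cases hki : k.1 = i
      · rw [gout _ v (by simp; omega), gin _ v (by simp; omega)]
        by_cases hvx : v = x
        · subst hvx
          rw [Equiv.swap_apply_left]
          exact .cross k _ _ (hki ▸ hi)
        by_cases hvy : v = y
        · subst hvy
          rw [Equiv.swap_apply_right]
          exact .cross k _ _ (by rw [hki, hi, Sym2.eq_swap])
        rw [Equiv.swap_apply_of_ne_of_ne hvx hvy]
        refine .straight k v fun q hq => ?_
        rw [hki, hi] at hq
        cases hq
        simp [hvx, hvy]
      by_cases hkj : k.1 = j
      · rw [gin _ v (by simp; omega), gout _ v (by simp; omega)]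
        by_cases hvx : v = x
        · subst hvx
          rw [Equiv.swap_apply_left]
          exact .cross k _ _ (by rw [hkj, hj', Sym2.eq_swap])
        by_cases hvy : v = y
        · subst hvy
          rw [Equiv.swap_apply_right]
          exact .cross k _ _ (hkj ▸ hj')
        rw [Equiv.swap_apply_of_ne_of_ne hvx hvy]
        refine .straight k v fun q hq => ?_
        rw [hkj, hj'] at hq
        cases hq
        simp [hvx, hvy]
      have e : g k.castSucc v = g k.succ v := by
        simp only [g, Fin.val_castSucc, Fin.val_succ]
        congr 1
        simp only [eq_iff_iff]
        omega
      rw [e]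
      refine .straight k _ fun q hq => ?_
      have hq' := hq
      rw [← hs _ hki hkj] at hq'
      by_cases hb : i < k.1 ∧ k.1 < j
      · have h2 := hbtw _ _ hb.1 hb.2 hq
        rw [gin _ _ (by simp; omega)]
        by_cases hvx : v = x
        · subst hvx; simpa using h2.2
        by_cases hvy : v = y
        · subst hvy; simpa using h2.1
        rw [Equiv.swap_apply_of_ne_of_ne hvx hvy]
        exact hv _ hq'
      · rw [gout _ _ (by simp; omega)]
        exact hv _ hq'
    all_goals
      have hki : k.1 ≠ i := fun hki => by rw [hki, hi0] at h; simp at h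
      have hkj : k.1 ≠ j := fun hki => by rw [hki, hj0] at h; simp at h
      rw [hs _ hki hkj] at h
      have hz : ∀ t : Fin (n + 1), t = k.castSucc ∨ t = k.succ → g t z = z ∧ g t w = w := by
        intro t ht
        by_cases hb : i < k.1 ∧ k.1 < j
        · have h2 := hbtw _ _ hb.1 hb.2 h
          simp only [Sym2.mem_iff, not_or] at h2
          exact ⟨gfix _ z (Ne.symm h2.1.1) (Ne.symm h2.2.1),
            gfix _ w (Ne.symm h2.1.2) (Ne.symm h2.2.2)⟩
        · rcases ht with rfl | rfl <;>
          exact ⟨gout _ z (by simp; omega), gout _ w (by simp; omega)⟩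
      simp only [Φ, hz _ (Or.inl rfl), hz _ (Or.inr rfl)]
    · exact .cross k z w h
    · exact .barBelow k z w h
    · exact .barAbove k z w h
  refine card_quot_eq_of_surjective Φ hΦ.surjective (fun a b h => .rel _ _ (hfwd a b h)) ?_ ?_
  · intro b b' h
    exact ⟨Φ b, Φ b', hΦ b, hΦ b', .rel _ _ (hbwd _ _ h)⟩
  · intro a a' h
    rw [hΦ.injective h]
    exact .refl _

/-- A sequence of slices whose slice `p` is cut open at two different vertices: each of the four
end points at the cut is connected to another one. -/
theorem exists_two_classes {s : ℕ → Option (Sym2 V × Option LinkType)} {n : ℕ} [Fintype V]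
    {p : Fin n} {x y : V} (hxy : x ≠ y) (hs : ∀ i q, s i = some q → ¬ q.1.IsDiag)
    (hcut : ∀ i, i ≠ p.1 → ∀ e, s i ≠ some (e, none)) (hp : s p = some (s(x, y), none)) :
    ∃ A B : Quot (Glue s n), ∀ v : V, v = x ∨ v = y →
      (Quot.mk _ (v, p.castSucc) = A ∨ Quot.mk _ (v, p.castSucc) = B) ∧
      (Quot.mk _ (v, p.succ) = A ∨ Quot.mk _ (v, p.succ) = B) := by
  classical
  have hsplit : ∀ (f : V → ZMod 2) (z w : V), z ≠ w →
      ∑ v, f v = f z + f w + ∑ v ∈ (Finset.univ.erase z).erase w, f v := by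
    intro f z w hzw
    rw [add_assoc, Finset.add_sum_erase _ _ (Finset.mem_erase.2 ⟨hzw.symm, Finset.mem_univ w⟩),
      Finset.add_sum_erase _ _ (Finset.mem_univ z)]
  -- Parity argument: the number mod 2 of vertices whose segment at height `t` lies in the class `q`
  -- is the same on both sides of every uncut slice, since a cross permutes strands and a double bar
  -- joins them in pairs. Going around the periodic time axis, the parities just below and just
  -- above the cut agree, and away from `x` and `y` the terms cancel.
  have hpar : ∀ q : Quot (Glue s n), ∀ χ : V → Fin (n + 1) → ZMod 2,
      χ = (fun v t => if Quot.mk (Glue s n) (v, t) = q then 1 else 0) →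
      χ x p.castSucc + χ y p.castSucc = χ x p.succ + χ y p.succ := by
    rintro q χ rfl
    set χ : V → Fin (n + 1) → ZMod 2 :=
      fun v t => if Quot.mk (Glue s n) (v, t) = q then 1 else 0 with hχ
    have hrel : ∀ v t w t', Glue s n (v, t) (w, t') → χ v t = χ w t' := by
      intro v t w t' h
      simp only [hχ, Quot.sound h]
    have hstep : ∀ i : Fin n, i ≠ p → ∑ v, χ v i.castSucc = ∑ v, χ v i.succ := by
      intro i hi
      rcases h : s i with _ | ⟨e, _ | _ | _⟩
      · exact Finset.sum_congr rfl fun v _ => hrel _ _ _ _ (.straight i v (by simp [h]))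
      · exact absurd h (hcut i (fun h' => hi (Fin.ext h')) e)
      · induction e using Sym2.ind with
        | _ z w =>
        refine Fintype.sum_equiv (Equiv.swap z w) _ _ fun v => ?_
        by_cases hvz : v = z
        · subst hvz
          rw [Equiv.swap_apply_left]
          exact hrel _ _ _ _ (.cross i _ _ h)
        by_cases hvw : v = w
        · subst hvw
          rw [Equiv.swap_apply_right]
          exact hrel _ _ _ _ (.cross i _ _ (by rw [h, Sym2.eq_swap]))
        rw [Equiv.swap_apply_of_ne_of_ne hvz hvw]
        refine hrel _ _ _ _ (.straight i v fun q hq => ?_)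
        rw [h] at hq
        cases hq
        simp [hvz, hvw]
      · induction e using Sym2.ind with
        | _ z w =>
        have hzw : z ≠ w := by simpa using hs _ _ h
        rw [hsplit _ z w hzw, hsplit _ z w hzw, hrel _ _ _ _ (.barBelow i z w h),
          hrel _ _ _ _ (.barAbove i z w h), CharTwo.add_self_eq_zero, CharTwo.add_self_eq_zero]
        congr 1
        refine Finset.sum_congr rfl fun v hv => hrel _ _ _ _ (.straight i v fun q hq => ?_)
        rw [h] at hq
        cases hq
        simp only [Finset.mem_erase] at hv
        simp [hv]
    have hlow : ∀ k : ℕ, ∀ hk : k ≤ p.1, ∑ v, χ v ⟨k, by omega⟩ = ∑ v, χ v 0 := by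
      intro k
      induction k with
      | zero => intro _; rfl
      | succ k ih =>
        intro hk
        rw [← ih (by omega)]
        exact (hstep ⟨k, by omega⟩ (by intro h; rw [← h] at hk; simp at hk)).symm
    have hhigh : ∀ k : ℕ, k + p.1 + 1 ≤ n →
        ∑ v, χ v ⟨n - k, by omega⟩ = ∑ v, χ v (Fin.last n) := by
      intro k
      induction k with
      | zero => intro _; rfl
      | succ k ih =>
        intro hk
        rw [← ih (by omega)]
        have := hstep ⟨n - (k + 1), by omega⟩ (by intro h; rw [← h] at hk; simp at hk; omega)
        have e : (⟨n - (k + 1), by omega⟩ : Fin n).succ = ⟨n - k, by omega⟩ := by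
          ext
          simp only [Fin.val_succ]
          omega
        rw [e] at this
        exact this
    have h1 := hlow p.1 le_rfl
    have h2 := hhigh (n - p.1 - 1) (by omega)
    have h3 : (⟨n - (n - p.1 - 1), by omega⟩ : Fin (n + 1)) = p.succ := by ext; simp; omega
    rw [h3, ← Finset.sum_congr rfl fun v _ => hrel v 0 v (Fin.last n) (.period v), ← h1] at h2
    change ∑ v, χ v p.succ = ∑ v, χ v p.castSucc at h2
    rw [hsplit _ x y hxy, hsplit _ x y hxy] at h2
    have h4 : ∑ v ∈ (Finset.univ.erase x).erase y, χ v p.succ =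
        ∑ v ∈ (Finset.univ.erase x).erase y, χ v p.castSucc := by
      refine Finset.sum_congr rfl fun v hv => (hrel _ _ _ _ (.straight p v fun q hq => ?_)).symm
      rw [hp] at hq
      cases hq
      simp only [Finset.mem_erase] at hv
      simp [hv]
    rw [h4] at h2
    exact (add_right_cancel h2).symm
  generalize ha : Quot.mk (Glue s n) (x, p.castSucc) = a
  generalize hb : Quot.mk (Glue s n) (y, p.castSucc) = b
  generalize ha' : Quot.mk (Glue s n) (x, p.succ) = a'
  generalize hb' : Quot.mk (Glue s n) (y, p.succ) = b'
  have key : ∀ q, ((if a = q then 1 else 0) + (if b = q then 1 else 0) : ZMod 2) =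
      (if a' = q then 1 else 0) + (if b' = q then 1 else 0) := by
    intro q
    have := hpar q _ rfl
    simpa only [ha, hb, ha', hb'] using this
  -- Every class contains an even number of the four ends, so they lie in at most two classes.
  have : ∃ A B, (a = A ∨ a = B) ∧ (b = A ∨ b = B) ∧ (a' = A ∨ a' = B) ∧ (b' = A ∨ b' = B) := by
    by_cases h : a' = b'
    · have k := key a
      refine ⟨a, a', Or.inl rfl, Or.inl ?_, Or.inr rfl, Or.inr h.symm⟩
      by_contra hba
      rw [h, if_neg hba, if_pos rfl, CharTwo.add_self_eq_zero, add_zero] at k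
      exact one_ne_zero k
    · have k1 := key a'
      have k2 := key b'
      rw [if_pos rfl, if_neg (Ne.symm h), add_zero] at k1
      rw [if_pos rfl, if_neg h, zero_add] at k2
      refine ⟨a, b, Or.inl rfl, Or.inr rfl, ?_, ?_⟩
      · by_contra hc
        rw [not_or] at hc
        rw [if_neg (Ne.symm hc.1), if_neg (Ne.symm hc.2), add_zero] at k1
        exact one_ne_zero k1.symm
      · by_contra hc
        rw [not_or] at hc
        rw [if_neg (Ne.symm hc.1), if_neg (Ne.symm hc.2), add_zero] at k2
        exact one_ne_zero k2.symm
  obtain ⟨A, B, h1, h2, h3, h4⟩ := this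
  refine ⟨A, B, ?_⟩
  rintro v (rfl | rfl)
  · exact ⟨ha ▸ h1, ha' ▸ h3⟩
  · exact ⟨hb ▸ h2, hb' ▸ h4⟩

/-- Changing the type of a link, inserting or removing it changes the number of loops by at most
one. -/
theorem loops_le_loops_add_one [Fintype V] {s s' : ℕ → Option (Sym2 V × Option LinkType)}
    {n p : ℕ} {x y : V} (hp : p < n) (hxy : x ≠ y) (hs : ∀ i q, s i = some q → ¬ q.1.IsDiag)
    (hcut : ∀ i e, s i ≠ some (e, none)) (heq : ∀ i, i ≠ p → s' i = s i)
    (hsp : s p = none ∨ ∃ t, s p = some (s(x, y), some t))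
    (hsp' : s' p = none ∨ ∃ t, s' p = some (s(x, y), some t)) :
    loops s n ≤ loops s' n + 1 := by
  classical
  -- Both `s` and `s'` arise from the cut sequence by further gluing at slice `p`: `s` has at most
  -- as many classes as `s0`, while `s'` can merge at most the two classes that meet the cut.
  set s0 := Function.update s p (some (s(x, y), none)) with hs0
  have hs0p : s0 p = some (s(x, y), none) := by simp [hs0]
  have hs0ne : ∀ i, i ≠ p → s0 i = s i := fun i hi => by simp [hs0, hi]
  have hsub : ∀ r : ℕ → Option (Sym2 V × Option LinkType), (∀ i, i ≠ p → r i = s i) →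
      (r p = none ∨ ∃ t, r p = some (s(x, y), some t)) →
      ∀ a b, Glue s0 n a b → Glue r n a b := by
    rintro r hr hrp a b (v | ⟨i, v, hv⟩ | ⟨i, z, w, h⟩ | ⟨i, z, w, h⟩ | ⟨i, z, w, h⟩)
    · exact .period v
    · refine .straight i v fun q hq => ?_
      by_cases hi : i.1 = p
      · have h1 := hv _ (hi ▸ hs0p)
        rw [hi] at hq
        rcases hrp with h | ⟨t, h⟩ <;> rw [h] at hq <;> cases hq
        exact h1
      · exact hv q (by rw [hs0ne _ hi, ← hr _ hi, hq])
    all_goals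
      have hi : i.1 ≠ p := fun hi => by rw [hi, hs0p] at h; simp at h
      rw [hs0ne _ hi, ← hr _ hi] at h
    · exact .cross i z w h
    · exact .barBelow i z w h
    · exact .barAbove i z w h
  have h1 : loops s n ≤ loops s0 n := by
    refine Nat.card_le_card_of_surjective
      (Quot.map id (hsub s (fun _ _ => rfl) hsp)) ?_
    rintro ⟨a⟩
    exact ⟨Quot.mk _ a, rfl⟩
  refine h1.trans ?_
  obtain ⟨A, B, hAB⟩ := exists_two_classes (s := s0) (n := n) (p := ⟨p, hp⟩) hxy
    (fun i q hq => by
      by_cases hi : i = p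
      · rw [hi, hs0p] at hq
        cases hq
        simpa using hxy
      · exact hs i q (by rw [← hs0ne i hi, hq]))
    (fun i hi e => by rw [hs0ne i hi]; exact hcut i e) hs0p
  -- Merging `B` into `A` makes the class map compatible with the gluing of `s'`, and its image
  -- misses at most `B`.
  let g : Quot (Glue s0 n) → Quot (Glue s0 n) := fun q => if q = B then A else q
  have hgA : ∀ q, q = A ∨ q = B → g q = A := by
    rintro q (rfl | rfl)
    · simp only [g]; split_ifs <;> rfl
    · simp [g]
  have hx := hAB x (Or.inl rfl)
  have hy := hAB y (Or.inr rfl)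
  have hresp : ∀ a b, Glue s' n a b → g (Quot.mk _ a) = g (Quot.mk _ b) := by
    rintro a b (v | ⟨i, v, hv⟩ | ⟨i, z, w, h⟩ | ⟨i, z, w, h⟩ | ⟨i, z, w, h⟩)
    · rw [Quot.sound (Glue.period v)]
    · by_cases hi : i.1 = p
      · obtain rfl : i = ⟨p, hp⟩ := Fin.ext hi
        by_cases hvx : v = x
        · subst hvx
          rw [hgA _ hx.1, hgA _ hx.2]
        by_cases hvy : v = y
        · subst hvy
          rw [hgA _ hy.1, hgA _ hy.2]
        rw [Quot.sound (Glue.straight (s := s0) ⟨p, hp⟩ v fun q hq => ?_)]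
        rw [hs0p] at hq
        cases hq
        simp [hvx, hvy]
      · rw [Quot.sound (Glue.straight (s := s0) i v fun q hq => hv q ?_)]
        rw [heq _ hi, ← hs0ne _ hi, hq]
    all_goals
      by_cases hi : i.1 = p
      · obtain rfl : i = ⟨p, hp⟩ := Fin.ext hi
        rcases hsp' with h' | ⟨t, h'⟩ <;> rw [h'] at h <;>
          simp only [reduceCtorEq, Option.some.injEq, Prod.mk.injEq] at h
        rcases Sym2.eq_iff.1 h.1 with ⟨rfl, rfl⟩ | ⟨rfl, rfl⟩ <;>
          simp only [hgA _ hx.1, hgA _ hx.2, hgA _ hy.1, hgA _ hy.2]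
      rw [heq _ hi, ← hs0ne _ hi] at h
    · rw [Quot.sound (Glue.cross i z w h)]
    · rw [Quot.sound (Glue.barBelow i z w h)]
    · rw [Quot.sound (Glue.barAbove i z w h)]
  have hfin : Finite (Quot (Glue s0 n)) := inferInstance
  have : Fintype (Quot (Glue s0 n)) := Fintype.ofFinite _
  have h2 : (Finset.univ.image g).card ≤ loops s' n := by
    have hr : (Finset.univ.image g : Set (Quot (Glue s0 n))) =
        Set.range (Quot.lift (fun a => g (Quot.mk _ a)) hresp) := by
      ext q
      simp only [Finset.coe_image, Finset.coe_univ, Set.image_univ, Set.mem_range]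
      constructor
      · rintro ⟨⟨a⟩, rfl⟩
        exact ⟨Quot.mk _ a, rfl⟩
      · rintro ⟨⟨a⟩, rfl⟩
        exact ⟨Quot.mk _ a, rfl⟩
    rw [← Set.ncard_coe_finset, hr, loops, ← Set.image_univ, ← Set.ncard_univ]
    exact Set.ncard_image_le (Set.toFinite _)
  have h3 : Finset.univ.erase B ⊆ Finset.univ.image g := by
    intro q hq
    refine Finset.mem_image.2 ⟨q, Finset.mem_univ _, ?_⟩
    simp only [Finset.mem_erase] at hq
    simp [g, hq.1]
  have h4 := Finset.card_le_card h3
  rw [Finset.card_erase_of_mem (Finset.mem_univ _), Finset.card_univ] at h4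
  rw [loops, Nat.card_eq_fintype_card]
  omega

variable {G : SimpleGraph V}

theorem slices_not_isDiag (c : LinkConfig G) (i : ℕ) (q : Sym2 V × Option LinkType)
    (h : slices c i = some q) : ¬ q.1.IsDiag := by
  simp only [slices, Option.map_eq_some_iff] at h
  obtain ⟨l, _, rfl⟩ := h
  exact G.not_isDiag_of_mem_edgeSet l.1.2

theorem slices_ne_cut (c : LinkConfig G) (i : ℕ) (e : Sym2 V) : slices c i ≠ some (e, none) := by
  simp [slices]

/-- Blanking the slice of the new link gives the loops of `c`, so this is a change of a single slice
between a link and nothing, in both directions. -/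
theorem numLoops_insertIdx [Fintype V] (c : LinkConfig G) (p : ℕ) (hp : p ≤ c.length)
    (l : G.edgeSet × LinkType) :
    numLoops (c.insertIdx p l) ≤ numLoops c + 1 ∧ numLoops c ≤ numLoops (c.insertIdx p l) + 1 := by
  obtain ⟨x, y, hl⟩ : ∃ x y, (l.1 : Sym2 V) = s(x, y) := by
    induction h : (l.1 : Sym2 V) using Sym2.ind with | _ x y => exact ⟨x, y, rfl⟩
  have hxy : x ≠ y := by
    have := G.not_isDiag_of_mem_edgeSet l.1.2
    rw [hl] at this
    simpa using this
  set s := slices (c.insertIdx p l) with hs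
  have hsp : s p = some (s(x, y), some l.2) := by
    simp [hs, slices, List.getElem?_insertIdx, hp, hl]
  have h0 : loops (Function.update s p none) (c.length + 1) = loops (slices c) c.length := by
    refine loops_insert_none hp ?_ (by simp) ?_
    · intro k hk
      simp [hk.ne, hs, slices, List.getElem?_insertIdx, hk]
    · intro k hk
      simp [show k + 1 ≠ p by omega, hs, slices, List.getElem?_insertIdx,
        show ¬ k + 1 < p by omega]
  have hlen : (c.insertIdx p l).length = c.length + 1 := List.length_insertIdx_of_le_length hp l
  rw [numLoops_eq_loops, numLoops_eq_loops c, hlen, ← h0]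
  constructor
  · exact loops_le_loops_add_one (p := p) (by omega) hxy (slices_not_isDiag _) (slices_ne_cut _)
      (fun i hi => by simp [hi, hs]) (Or.inr ⟨_, hsp⟩) (Or.inl (by simp))
  · refine loops_le_loops_add_one (p := p) (by omega) hxy (fun i q hq => ?_) (fun i e => ?_)
      (fun i hi => by simp [hi, hs]) (Or.inl (by simp)) (Or.inr ⟨_, hsp⟩)
    · by_cases hi : i = p
      · simp [hi] at hq
      · rw [Function.update_of_ne hi] at hq
        exact slices_not_isDiag _ _ _ hq
    · by_cases hi : i = p
      · simp [hi]
      · rw [Function.update_of_ne hi]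
        exact slices_ne_cut _ _ _

/-- Two consecutive crosses on an edge without a link at its end points between them can be
removed without changing the number of loops. -/
theorem numLoops_append_cross_pair (a b d : LinkConfig G) (e : G.edgeSet)
    (hb : ∀ l ∈ b, ∀ v, v ∈ (l.1 : Sym2 V) → v ∉ (e : Sym2 V)) :
    numLoops (a ++ (e, LinkType.cross) :: b ++ (e, LinkType.cross) :: d) =
      numLoops (a ++ b ++ d) := by
  obtain ⟨x, y, hl⟩ : ∃ x y, (e : Sym2 V) = s(x, y) := by
    induction h : (e : Sym2 V) using Sym2.ind with | _ x y => exact ⟨x, y, rfl⟩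
  have hxy : x ≠ y := by
    have := G.not_isDiag_of_mem_edgeSet e.2
    rw [hl] at this
    simpa using this
  set c := a ++ (e, LinkType.cross) :: b ++ (e, LinkType.cross) :: d with hc
  set i := a.length
  set j := a.length + 1 + b.length
  have hlen : c.length = a.length + b.length + d.length + 2 := by simp [hc]; omega
  have hi : slices c i = some (s(x, y), some LinkType.cross) := by
    simp [slices, hc, i, hl]
  have hj : slices c j = some (s(x, y), some LinkType.cross) := by
    have h1 : j = (a ++ (e, LinkType.cross) :: b).length := by simp [j]; omega
    have h2 : getElem? c j = some (e, LinkType.cross) := by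
      rw [hc, h1, List.getElem?_append_right le_rfl, Nat.sub_self]
      rfl
    rw [slices, h2, Option.map_some, hl]
  have hget : ∀ k, i < k → k < j → getElem? c k = getElem? b (k - i - 1) := by
    intro k h1 h2
    have h3 : k - i ≠ 0 := by omega
    have h4 : ¬ k < i := by omega
    have h5 : k - i - 1 < b.length := by omega
    rw [hc, List.append_assoc, List.getElem?_append, if_neg h4, List.cons_append,
      List.getElem?_cons, if_neg h3, List.getElem?_append, if_pos h5]
  rw [numLoops_eq_loops, numLoops_eq_loops (a ++ b ++ d),
    loops_erase_cross_pair (s' := Function.update (Function.update (slices c) i none) j none)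
      (i := i) (j := j) hxy (by omega) (by omega) hi hj]
  · set s := Function.update (Function.update (slices c) i none) j none with hs
    have hl1 : c.length = (a ++ b ++ d).length + 1 + 1 := by simp [hlen]; omega
    have hlt : ∀ k < i, getElem? c k = getElem? (a ++ b ++ d) k := by
      intro k hk
      rw [hc, List.append_assoc, List.getElem?_append, if_pos hk, List.append_assoc,
        List.getElem?_append, if_pos hk]
    have hmid : ∀ k, i ≤ k → k + 1 < j → getElem? c (k + 1) = getElem? (a ++ b ++ d) k := by
      intro k hk hk'
      rw [hget _ (by omega) hk', List.append_assoc, List.getElem?_append, if_neg (by omega),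
        List.getElem?_append, if_pos (by omega)]
      congr 1
      omega
    have hgt : ∀ k, j ≤ k + 1 → getElem? c (k + 2) = getElem? (a ++ b ++ d) k := by
      intro k hk
      have h1 : k + 2 - (a.length + (b.length + 1)) = (k - (a.length + b.length)) + 1 := by omega
      rw [hc, List.getElem?_append, if_neg (by simp; omega), List.getElem?_append,
        if_neg (by simp; omega)]
      simp [h1]
    -- The two blanked slices are deleted one by one, the later one first so that position `i` is
    -- not shifted.
    rw [hl1, loops_insert_none (s := fun k => if k < j then s k else s (k + 1)) (p := j)
      (by simp; omega) (fun k hk => by simp [hk]) (by simp [hs])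
      (fun k hk => by simp [show ¬ k < j by omega])]
    refine loops_insert_none (p := i) (by simp; omega) ?_ ?_ ?_
    · intro k hk
      simp [hs, show k < j by omega, show k ≠ j by omega, hk.ne, slices, hlt k hk]
    · simp [hs, show i < j by omega, show i ≠ j by omega]
    · intro k hk
      by_cases h : k + 1 < j
      · simp [hs, h, h.ne, show k + 1 ≠ i by omega, slices, hmid k hk h]
      · simp [hs, h, show k + 1 + 1 ≠ j by omega, show k + 1 + 1 ≠ i by omega, slices,
          hgt k (by omega)]
  · intro k q h1 h2 h3
    rw [slices, hget k h1 h2, Option.map_eq_some_iff] at h3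
    obtain ⟨l, h3, rfl⟩ := h3
    have hlb := List.mem_of_getElem? h3
    have hb' := hb l hlb
    rw [hl] at hb'
    exact ⟨fun h => hb' x h (by simp), fun h => hb' y h (by simp)⟩
  · simp [show i ≠ j by omega]
  · simp
  · intro k h1 h2
    simp [h1, h2]

end Loops

/-! ### Blocking edges under removal of links -/

section Blocking

variable {V : Type*} {G : SimpleGraph V}

theorem exists_append_of_getElem? {α : Type*} {c : List α} {i j : ℕ} {x y : α} (hij : i < j)
    (hi : getElem? c i = some x) (hj : getElem? c j = some y) :
    ∃ a b d, c = a ++ x :: b ++ y :: d ∧ a.length = i ∧ a.length + 1 + b.length = j := by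
  obtain ⟨hj1, hj2⟩ := List.getElem?_eq_some_iff.1 hj
  obtain ⟨hi1, hi2⟩ := List.getElem?_eq_some_iff.1 hi
  refine ⟨c.take i, (c.take j).drop (i + 1), c.drop (j + 1), ?_, ?_, ?_⟩
  · rw [← hi2, ← hj2, ← List.drop_eq_getElem_cons hj1]
    have h1 : (c.take j).length > i := by simp; omega
    have h2 : getElem (c.take j) i h1 = getElem c i hi1 := by simp
    have h3 : c.take i = (c.take j).take i := by rw [List.take_take]; congr 1; omega
    rw [← h2, ← List.drop_eq_getElem_cons h1, h3, List.take_append_drop, List.take_append_drop]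
  · simp; omega
  · simp; omega

theorem getElem?_append_pair {α : Type*} {a b d : List α} {x y l : α} {k : ℕ}
    (h : getElem? (a ++ x :: b ++ y :: d) k = some l) :
    (k < a.length ∧ l ∈ a) ∨ (k = a.length ∧ l = x) ∨
      (a.length < k ∧ k < a.length + 1 + b.length ∧ l ∈ b) ∨
      (k = a.length + 1 + b.length ∧ l = y) ∨ (a.length + 1 + b.length < k ∧ l ∈ d) := by
  rw [List.append_assoc, List.getElem?_append] at h
  split_ifs at h with h1
  · exact Or.inl ⟨h1, List.mem_of_getElem? h⟩
  rw [List.cons_append, List.getElem?_cons] at h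
  split_ifs at h with h2
  · exact Or.inr (Or.inl ⟨by omega, by simpa using h.symm⟩)
  rw [List.getElem?_append] at h
  split_ifs at h with h3
  · exact Or.inr (Or.inr (Or.inl ⟨by omega, by omega, List.mem_of_getElem? h⟩))
  rw [List.getElem?_cons] at h
  split_ifs at h with h4
  · exact Or.inr (Or.inr (Or.inr (Or.inl ⟨by omega, by simpa using h.symm⟩)))
  · exact Or.inr (Or.inr (Or.inr (Or.inr ⟨by omega, List.mem_of_getElem? h⟩)))

theorem getElem?_append_pair_left {α : Type*} (a b d : List α) (x y : α) :
    getElem? (a ++ x :: b ++ y :: d) a.length = some x := by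
  rw [List.append_assoc, List.getElem?_append_right le_rfl, Nat.sub_self]
  rfl

theorem getElem?_append_pair_right {α : Type*} (a b d : List α) (x y : α) :
    getElem? (a ++ x :: b ++ y :: d) (a.length + 1 + b.length) = some y := by
  have h1 : a.length + 1 + b.length = (a ++ x :: b).length := by simp; omega
  rw [h1, List.getElem?_append_right le_rfl, Nat.sub_self]
  rfl

/-- Two edges share a vertex. -/
def Near (e f : G.edgeSet) : Prop := ∃ v : V, v ∈ (e : Sym2 V) ∧ v ∈ (f : Sym2 V)

theorem Near.symm {e f : G.edgeSet} (h : Near e f) : Near f e := by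
  obtain ⟨v, h1, h2⟩ := h
  exact ⟨v, h2, h1⟩

theorem near_self (e : G.edgeSet) : Near e e := ⟨_, Sym2.out_fst_mem _, Sym2.out_fst_mem _⟩

/-- The edge `f` carries exactly two links, both crosses, at the positions `i < j`. -/
structure IsCrossPair (c : LinkConfig G) (f : G.edgeSet) (i j : ℕ) : Prop where
  lt : i < j
  left : getElem? c i = some (f, LinkType.cross)
  right : getElem? c j = some (f, LinkType.cross)
  eq_or : ∀ k l, getElem? c k = some l → l.1 = f → k = i ∨ k = j

/-- The edge `f` is blocking if the links on the edges in `X` are ignored. -/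
def IsBlockingIgnoring (X : Set G.edgeSet) (c : LinkConfig G) (f : G.edgeSet) : Prop :=
  ∃ i j, IsCrossPair c f i j ∧
    ∀ k l, i < k → k < j → getElem? c k = some l → l.1 ∉ X → ¬ Near l.1 f

/-- Positions as natural numbers with optional lookup avoid casts between the index types of
configurations of different lengths. -/
theorem isBlocking_iff {c : LinkConfig G} {f : G.edgeSet} :
    IsBlocking c f ↔ ∃ i j, IsCrossPair c f i j ∧
      ∀ k l, i < k → k < j → getElem? c k = some l → ¬ Near l.1 f := by
  constructor
  · rintro ⟨i, j, hij, h1, h2, h3, h4⟩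
    have hi := (h1 i).2 (Or.inl rfl)
    have hj := (h1 j).2 (Or.inr rfl)
    refine ⟨i, j, ⟨hij, ?_, ?_, ?_⟩, ?_⟩
    · rw [List.getElem?_eq_getElem i.2, Option.some.injEq]
      exact Prod.ext hi h2
    · rw [List.getElem?_eq_getElem j.2, Option.some.injEq]
      exact Prod.ext hj h3
    · intro k l hk hl
      obtain ⟨hk1, rfl⟩ := List.getElem?_eq_some_iff.1 hk
      simpa [Fin.ext_iff] using (h1 ⟨k, hk1⟩).1 hl
    · rintro k l hik hkj hk ⟨v, hv1, hv2⟩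
      obtain ⟨hk1, rfl⟩ := List.getElem?_eq_some_iff.1 hk
      exact h4 ⟨k, hk1⟩ hik hkj v hv1 hv2
  · rintro ⟨i, j, ⟨hij, h1, h2, h3⟩, h4⟩
    obtain ⟨hi1, hi2⟩ := List.getElem?_eq_some_iff.1 h1
    obtain ⟨hj1, hj2⟩ := List.getElem?_eq_some_iff.1 h2
    refine ⟨⟨i, hi1⟩, ⟨j, hj1⟩, hij, fun k => ⟨fun hk => ?_, ?_⟩, ?_, ?_, fun k hik hkj v hv1 hv2 => ?_⟩
    · have := h3 k _ (List.getElem?_eq_getElem k.2) hk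
      simpa [Fin.ext_iff] using this
    · rintro (rfl | rfl)
      · exact congrArg Prod.fst hi2
      · exact congrArg Prod.fst hj2
    · exact congrArg Prod.snd hi2
    · exact congrArg Prod.snd hj2
    · exact h4 k _ hik hkj (List.getElem?_eq_getElem k.2) ⟨v, hv1, hv2⟩

theorem isBlockingIgnoring_empty {c : LinkConfig G} {f : G.edgeSet} :
    IsBlockingIgnoring ∅ c f ↔ IsBlocking c f := by
  simp [isBlocking_iff, IsBlockingIgnoring]

theorem IsBlocking.ignoring {c : LinkConfig G} {f : G.edgeSet} (h : IsBlocking c f)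
    (X : Set G.edgeSet) : IsBlockingIgnoring X c f := by
  obtain ⟨i, j, hp, h⟩ := isBlocking_iff.1 h
  exact ⟨i, j, hp, fun k l h1 h2 h3 _ => h k l h1 h2 h3⟩

theorem isBlockingIgnoring_iff_append {X : Set G.edgeSet} {c : LinkConfig G} {f : G.edgeSet} :
    IsBlockingIgnoring X c f ↔ ∃ a b d, c = a ++ (f, LinkType.cross) :: b ++ (f, LinkType.cross) :: d ∧
      (∀ l ∈ a, l.1 ≠ f) ∧ (∀ l ∈ b, l.1 ≠ f ∧ (l.1 ∉ X → ¬ Near l.1 f)) ∧ (∀ l ∈ d, l.1 ≠ f) := by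
  constructor
  · rintro ⟨i, j, ⟨hij, h1, h2, h3⟩, h4⟩
    obtain ⟨a, b, d, rfl, rfl, rfl⟩ := exists_append_of_getElem? hij h1 h2
    refine ⟨a, b, d, rfl, fun l hl hlf => ?_, fun l hl => ?_, fun l hl hlf => ?_⟩
    · obtain ⟨k, hk⟩ := List.mem_iff_getElem?.1 hl
      have hk' := (List.getElem?_eq_some_iff.1 hk).1
      have := h3 k l (by
        rw [List.append_assoc, List.getElem?_append_left hk', hk]) hlf
      omega
    · obtain ⟨k, hk⟩ := List.mem_iff_getElem?.1 hl
      have hk' := (List.getElem?_eq_some_iff.1 hk).1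
      have hk2 : getElem? (a ++ (f, LinkType.cross) :: b ++ (f, LinkType.cross) :: d)
          (a.length + 1 + k) = some l := by
        rw [List.append_assoc, List.getElem?_append_right (by omega), List.cons_append,
          show a.length + 1 + k - a.length = k + 1 by omega, List.getElem?_cons_succ,
          List.getElem?_append_left hk', hk]
      refine ⟨fun hlf => ?_, h4 _ l (by omega) (by omega) hk2⟩
      have := h3 _ l hk2 hlf
      omega
    · obtain ⟨k, hk⟩ := List.mem_iff_getElem?.1 hl
      have hk2 : getElem? (a ++ (f, LinkType.cross) :: b ++ (f, LinkType.cross) :: d)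
          (a.length + 1 + b.length + 1 + k) = some l := by
        rw [List.getElem?_append_right (by simp; omega)]
        have : a.length + 1 + b.length + 1 + k - (a ++ (f, LinkType.cross) :: b).length = k + 1 := by
          simp; omega
        rw [this, List.getElem?_cons_succ, hk]
      have := h3 _ l hk2 hlf
      omega
  · rintro ⟨a, b, d, rfl, ha, hb, hd⟩
    refine ⟨_, _, ⟨by omega, getElem?_append_pair_left _ _ _ _ _,
      getElem?_append_pair_right _ _ _ _ _, fun k l hk hl => ?_⟩, fun k l h1 h2 hk hX => ?_⟩
    · rcases getElem?_append_pair hk with h | h | h | h | h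
      · exact absurd hl (ha _ h.2)
      · exact Or.inl h.1
      · exact absurd hl (hb _ h.2.2).1
      · exact Or.inr h.1
      · exact absurd hl (hd _ h.2)
    · rcases getElem?_append_pair hk with h | h | h | h | h
      · omega
      · omega
      · exact (hb _ h.2.2).2 hX
      · omega
      · omega

open Classical in
/-- The configuration without its links on `e`. -/
noncomputable def offEdge (e : G.edgeSet) (c : LinkConfig G) : LinkConfig G :=
  c.filter fun l => l.1 ≠ e

theorem mem_offEdge {e : G.edgeSet} {c : LinkConfig G} {l : G.edgeSet × LinkType} :
    l ∈ offEdge e c ↔ l ∈ c ∧ l.1 ≠ e := by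
  simp [offEdge]

theorem offEdge_append (e : G.edgeSet) (a b : LinkConfig G) :
    offEdge e (a ++ b) = offEdge e a ++ offEdge e b := by
  simp [offEdge]

theorem offEdge_cons_self (e : G.edgeSet) (t : LinkType) (a : LinkConfig G) :
    offEdge e ((e, t) :: a) = offEdge e a := by
  simp [offEdge]

theorem offEdge_cons_of_ne {e : G.edgeSet} {l : G.edgeSet × LinkType} (h : l.1 ≠ e)
    (a : LinkConfig G) : offEdge e (l :: a) = l :: offEdge e a := by
  simp [offEdge, h]

theorem offEdge_eq_self {e : G.edgeSet} {c : LinkConfig G} (h : ∀ l ∈ c, l.1 ≠ e) :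
    offEdge e c = c := by
  simpa [offEdge] using h

theorem offEdge_eq_cons {e : G.edgeSet} {c r : LinkConfig G} {l : G.edgeSet × LinkType}
    (h : offEdge e c = l :: r) :
    ∃ a b, c = a ++ l :: b ∧ (∀ k ∈ a, k.1 = e) ∧ l.1 ≠ e ∧ offEdge e b = r := by
  simpa [offEdge, List.filter_eq_cons_iff] using h

theorem offEdge_eq_append {e : G.edgeSet} {c r s : LinkConfig G} (h : offEdge e c = r ++ s) :
    ∃ a b, c = a ++ b ∧ offEdge e a = r ∧ offEdge e b = s := by
  simpa [offEdge, List.filter_eq_append_iff] using h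

/-- Blocking after the links on `e` are erased is thus expressed in `c` itself, which allows a
comparison of configurations that differ in where the links on `e` are. -/
theorem isBlocking_offEdge {e f : G.edgeSet} (hf : f ≠ e) {c : LinkConfig G} :
    IsBlocking (offEdge e c) f ↔ IsBlockingIgnoring {e} c f := by
  rw [← isBlockingIgnoring_empty, isBlockingIgnoring_iff_append, isBlockingIgnoring_iff_append]
  constructor
  · rintro ⟨a, b, d, h, ha, hb, hd⟩
    obtain ⟨c1, c2, rfl, h1, h2⟩ := offEdge_eq_append h
    obtain ⟨a1, c3, rfl, rfl, h3⟩ := offEdge_eq_append h1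
    obtain ⟨a2, b2, rfl, ha2, -, rfl⟩ := offEdge_eq_cons h3
    obtain ⟨b3, d3, rfl, hb3, -, rfl⟩ := offEdge_eq_cons h2
    refine ⟨a1 ++ a2, b2 ++ b3, d3, by simp, ?_, ?_, ?_⟩
    · intro l hl
      rcases List.mem_append.1 hl with hl | hl
      · by_cases he : l.1 = e
        · exact he ▸ hf.symm
        · exact ha l (mem_offEdge.2 ⟨hl, he⟩)
      · exact ha2 l hl ▸ hf.symm
    · intro l hl
      rcases List.mem_append.1 hl with hl | hl
      · by_cases he : l.1 = e
        · exact ⟨he ▸ hf.symm, fun h => absurd he h⟩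
        · have := hb l (mem_offEdge.2 ⟨hl, he⟩)
          exact ⟨this.1, fun _ => this.2 (by simp)⟩
      · exact ⟨hb3 l hl ▸ hf.symm, fun h => absurd (hb3 l hl) h⟩
    · intro l hl
      by_cases he : l.1 = e
      · exact he ▸ hf.symm
      · exact hd l (mem_offEdge.2 ⟨hl, he⟩)
  · rintro ⟨a, b, d, rfl, ha, hb, hd⟩
    refine ⟨offEdge e a, offEdge e b, offEdge e d, ?_, ?_, ?_, ?_⟩
    · rw [offEdge_append, offEdge_append, offEdge_cons_of_ne hf, offEdge_cons_of_ne hf]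
    · exact fun l hl => ha l (mem_offEdge.1 hl).1
    · intro l hl
      rw [mem_offEdge] at hl
      exact ⟨(hb l hl.1).1, fun _ => (hb l hl.1).2 hl.2⟩
    · exact fun l hl => hd l (mem_offEdge.1 hl).1

theorem isBlocking_offEdge_of_isBlocking {e f : G.edgeSet} (hf : f ≠ e) {c : LinkConfig G} (h : IsBlocking c f) :
    IsBlocking (offEdge e c) f :=
  (isBlocking_offEdge hf).2 (h.ignoring _)

theorem isBlocking_offEdge_of_not_near {e f : G.edgeSet} (hf : ¬ Near f e) {c : LinkConfig G} :
    IsBlocking (offEdge e c) f ↔ IsBlocking c f := by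
  have hne : f ≠ e := fun h => hf (h ▸ near_self _)
  refine ⟨fun h => ?_, fun h => isBlocking_offEdge_of_isBlocking hne h⟩
  obtain ⟨i, j, hp, h⟩ := (isBlocking_offEdge hne).1 h
  refine isBlocking_iff.2 ⟨i, j, hp, fun k l h1 h2 h3 h4 => ?_⟩
  by_cases hl : l.1 = e
  · exact hf (hl ▸ h4.symm)
  · exact h k l h1 h2 h3 hl h4

/-- Removing a link of another edge keeps an edge blocking. -/
theorem IsBlocking.eraseIdx {c : LinkConfig G} {g : G.edgeSet} {m : ℕ} {l : G.edgeSet × LinkType}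
    (hm : getElem? c m = some l) (hl : l.1 ≠ g) (h : IsBlocking c g) :
    IsBlocking (c.eraseIdx m) g := by
  obtain ⟨i, j, ⟨hij, h1, h2, h3⟩, h4⟩ := isBlocking_iff.1 h
  have hi : i ≠ m := by
    rintro rfl
    rw [hm] at h1
    cases h1
    exact hl rfl
  have hj : j ≠ m := by
    rintro rfl
    rw [hm] at h2
    cases h2
    exact hl rfl
  have key : ∀ k, k ≠ m → getElem? (c.eraseIdx m) (if k < m then k else k - 1) = getElem? c k := by
    intro k hk
    rw [List.getElem?_eraseIdx]
    by_cases hkm : k < m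
    · simp [hkm]
    · simp only [hkm, if_false]
      rw [if_neg (by omega), Nat.sub_add_cancel (by omega)]
  refine isBlocking_iff.2 ⟨if i < m then i else i - 1, if j < m then j else j - 1,
    ⟨by split_ifs <;> omega, by rw [key i hi, h1], by rw [key j hj, h2], ?_⟩, ?_⟩
  · intro k l' hk hl'
    rw [List.getElem?_eraseIdx] at hk
    split_ifs at hk with hkm
    · have := h3 _ _ hk hl'
      split_ifs <;> omega
    · have := h3 _ _ hk hl'
      split_ifs <;> omega
  · intro k l' hik hkj hk
    rw [List.getElem?_eraseIdx] at hk
    split_ifs at hk with hkm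
    · exact h4 _ _ (by split_ifs at hik <;> omega) (by split_ifs at hkj <;> omega) hk
    · exact h4 _ _ (by split_ifs at hik <;> omega) (by split_ifs at hkj <;> omega) hk

/-- If the removal of a link on another edge makes an edge blocking, then this link is the only one
that separates the two crosses. -/
theorem IsBlocking.of_eraseIdx {c : LinkConfig G} {g : G.edgeSet} {m : ℕ}
    {l : G.edgeSet × LinkType} (hm : getElem? c m = some l) (hl : l.1 ≠ g)
    (h : IsBlocking (c.eraseIdx m) g) :
    ∃ i j, IsCrossPair c g i j ∧ (IsBlocking c g ∨ (i < m ∧ m < j ∧ Near l.1 g)) ∧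
      ∀ k l', i < k → k < j → k ≠ m → getElem? c k = some l' → ¬ Near l'.1 g := by
  obtain ⟨i, j, ⟨hij, h1, h2, h3⟩, h4⟩ := isBlocking_iff.1 h
  have key : ∀ k, k ≠ m → getElem? (c.eraseIdx m) (if k < m then k else k - 1) = getElem? c k := by
    intro k hk
    rw [List.getElem?_eraseIdx]
    by_cases hkm : k < m
    · simp [hkm]
    · simp only [hkm, if_false]
      rw [if_neg (by omega), Nat.sub_add_cancel (by omega)]
  rw [List.getElem?_eraseIdx] at h1 h2
  have hp : IsCrossPair c g (if i < m then i else i + 1) (if j < m then j else j + 1) := by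
    refine ⟨by split_ifs <;> omega, ?_, ?_, ?_⟩
    · split_ifs at h1 ⊢ <;> exact h1
    · split_ifs at h2 ⊢ <;> exact h2
    · intro k l' hk hl'
      have hkm : k ≠ m := by
        rintro rfl
        rw [hm] at hk
        cases hk
        exact hl hl'
      have := h3 _ _ ((key k hkm).trans hk) hl'
      split_ifs at this ⊢ <;> omega
  have hb : ∀ k l', (if i < m then i else i + 1) < k → k < (if j < m then j else j + 1) → k ≠ m →
      getElem? c k = some l' → ¬ Near l'.1 g := by
    intro k l' hik hkj hkm hk
    refine h4 _ _ ?_ ?_ ((key k hkm).trans hk)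
    · split_ifs at hik ⊢ <;> omega
    · split_ifs at hkj ⊢ <;> omega
  refine ⟨_, _, hp, ?_, hb⟩
  by_cases hc : (if i < m then i else i + 1) < m ∧ m < (if j < m then j else j + 1) ∧ Near l.1 g
  · exact Or.inr hc
  · refine Or.inl (isBlocking_iff.2 ⟨_, _, hp, fun k l' hik hkj hk => ?_⟩)
    by_cases hkm : k = m
    · subst hkm
      rw [hm] at hk
      cases hk
      exact fun hn => hc ⟨hik, hkj, hn⟩
    · exact hb k l' hik hkj hkm hk

/-- Removing one of the two crosses on a blocking edge does not change which other edges are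
blocking. -/
theorem isBlocking_eraseIdx_of_isBlocking {c : LinkConfig G} {f g : G.edgeSet} {m : ℕ}
    {l : G.edgeSet × LinkType} (hf : IsBlocking c f) (hm : getElem? c m = some l) (hl : l.1 = f)
    (hg : g ≠ f) : IsBlocking (c.eraseIdx m) g ↔ IsBlocking c g := by
  refine ⟨fun h => ?_, fun h => h.eraseIdx hm (hl.trans_ne hg.symm)⟩
  obtain ⟨i, j, hp, h | ⟨him, hmj, hn⟩, hb⟩ := h.of_eraseIdx hm (hl.trans_ne hg.symm)
  · exact h
  obtain ⟨i', j', hp', hb'⟩ := isBlocking_iff.1 hf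
  have hgf : Near g f := by rw [← hl]; exact hn.symm
  have e1 : i ≠ i' := fun h => by have := hp.left; rw [h, hp'.left] at this; cases this; exact hg rfl
  have e2 : i ≠ j' := fun h => by have := hp.left; rw [h, hp'.right] at this; cases this; exact hg rfl
  have e3 : j ≠ i' := fun h => by have := hp.right; rw [h, hp'.left] at this; cases this; exact hg rfl
  have e4 : j ≠ j' := fun h => by have := hp.right; rw [h, hp'.right] at this; cases this; exact hg rfl
  -- As `f` is blocking, neither cross of the adjacent edge `g` lies between those of `f`. So if one
  -- cross of `f` lies between the crosses of `g`, the other does too and still separates them after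
  -- the removal.
  have h5 : ¬ (i' < i ∧ i < j') := fun h => hb' i _ h.1 h.2 hp.left hgf
  have h6 : ¬ (i' < j ∧ j < j') := fun h => hb' j _ h.1 h.2 hp.right hgf
  have hlt := hp'.lt
  rcases hp'.eq_or m l hm hl with h | h
  · exact absurd hgf.symm (hb j' _ (by omega) (by omega) (by omega) hp'.right)
  · exact absurd hgf.symm (hb i' _ (by omega) (by omega) (by omega) hp'.left)

theorem IsCrossPair.not_isBlocking_eraseIdx {c : LinkConfig G} {f : G.edgeSet} {i j m : ℕ}
    (hp : IsCrossPair c f i j) (hm : m = i ∨ m = j) : ¬ IsBlocking (c.eraseIdx m) f := by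
  intro h
  obtain ⟨i', j', ⟨hij, h1, h2, h3⟩, -⟩ := isBlocking_iff.1 h
  have hlt := hp.lt
  rw [List.getElem?_eraseIdx] at h1 h2
  have a1 : (if i' < m then i' else i' + 1) = i ∨ (if i' < m then i' else i' + 1) = j := by
    refine hp.eq_or _ (f, LinkType.cross) ?_ rfl
    split_ifs at h1 ⊢ <;> exact h1
  have a2 : (if j' < m then j' else j' + 1) = i ∨ (if j' < m then j' else j' + 1) = j := by
    refine hp.eq_or _ (f, LinkType.cross) ?_ rfl
    split_ifs at h2 ⊢ <;> exact h2
  split_ifs at a1 a2 <;> omega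

end Blocking

/-! ### Total weights and double counting of link removals -/

section Mass

/-- The basic tool for comparing masses: an injection that does not decrease weights. -/
theorem tsum_indicator_le_of_injOn {α γ : Type*} {S : Set α} {T : Set γ} {w : α → ℝ≥0∞}
    {v : γ → ℝ≥0∞} (φ : α → γ) (hmaps : ∀ a ∈ S, φ a ∈ T) (hinj : Set.InjOn φ S)
    (hle : ∀ a ∈ S, w a ≤ v (φ a)) : ∑' a, S.indicator w a ≤ ∑' b, T.indicator v b := by
  rw [← tsum_subtype]
  calc ∑' a : S, w a ≤ ∑' a : S, T.indicator v (φ a) :=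
        ENNReal.tsum_le_tsum fun a => by
          rw [Set.indicator_of_mem (hmaps a a.2)]
          exact hle a a.2
    _ ≤ ∑' b, T.indicator v b :=
        ENNReal.tsum_comp_le_tsum_of_injective (f := fun a : S => φ a)
          (fun a b h => Subtype.ext (hinj a.2 b.2 h)) _

theorem tsum_prod_indicator {α γ : Type*} (s : α → Finset γ) (w : α → ℝ≥0∞) :
    ∑' a : α × γ, Set.indicator {a | a.2 ∈ s a.1} (fun a => w a.1) a =
      ∑' a, w a * (s a).card := by
  classical
  rw [ENNReal.tsum_prod']
  refine tsum_congr fun a => ?_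
  rw [tsum_eq_sum (s := s a) fun b hb => Set.indicator_of_notMem (by simpa using hb) _]
  rw [Finset.sum_congr rfl fun b hb => Set.indicator_of_mem (by simpa using hb) _]
  simp [mul_comm]

variable {V : Type*} {G : SimpleGraph V}

/-- The probability of a link type. -/
def typeProb (u : ℝ) : LinkType → ℝ
  | .cross => u
  | .doubleBar => 1 - u

/-- The weight of a configuration as an extended nonnegative real. -/
noncomputable def wt (β u θ : ℝ) (c : LinkConfig G) : ℝ≥0∞ := ENNReal.ofReal (loopWeight β u θ c)

/-- The total weight of a set of configurations. -/
noncomputable def mass (β u θ : ℝ) (S : Set (LinkConfig G)) : ℝ≥0∞ :=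
  ∑' c, S.indicator (wt β u θ) c

variable {β u θ : ℝ}

theorem mass_mono {S T : Set (LinkConfig G)} (h : S ⊆ T) : mass β u θ S ≤ mass β u θ T :=
  ENNReal.tsum_le_tsum fun c => Set.indicator_le_indicator_of_subset h (fun _ => zero_le) c

theorem mass_union_le (S T : Set (LinkConfig G)) :
    mass β u θ (S ∪ T) ≤ mass β u θ S + mass β u θ T := by
  rw [mass, mass, mass, ← ENNReal.tsum_add]
  refine ENNReal.tsum_le_tsum fun c => ?_
  by_cases h1 : c ∈ S <;> by_cases h2 : c ∈ T <;> simp [h1, h2]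

theorem mass_iUnion_le (S : ℕ → Set (LinkConfig G)) :
    mass β u θ (⋃ k, S k) ≤ ∑' k, mass β u θ (S k) := by
  simp only [mass]
  rw [ENNReal.tsum_comm]
  refine ENNReal.tsum_le_tsum fun c => ?_
  by_cases h : c ∈ ⋃ k, S k
  · obtain ⟨k, hk⟩ := Set.mem_iUnion.1 h
    rw [Set.indicator_of_mem h, ← Set.indicator_of_mem hk (wt β u θ)]
    exact ENNReal.le_tsum k
  · rw [Set.indicator_of_notMem h]
    exact zero_le

theorem loopWeight_nonneg (hβ : 0 ≤ β) (hu : 0 ≤ u) (hu1 : u ≤ 1) (hθ : 0 ≤ θ) (c : LinkConfig G) :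
    0 ≤ loopWeight β u θ c := by
  have : 0 ≤ 1 - u := by linarith
  unfold loopWeight
  positivity

theorem pow_le_max_mul_pow (hθ : 0 < θ) {m n : ℕ} (h1 : m ≤ n + 1) (h2 : n ≤ m + 1) :
    θ ^ m ≤ max θ θ⁻¹ * θ ^ n := by
  have hθ' : 0 < θ⁻¹ := inv_pos.2 hθ
  have h1' : 1 ≤ max θ θ⁻¹ := by
    rcases le_total 1 θ with h | h
    · exact h.trans (le_max_left _ _)
    · exact (one_le_inv₀ hθ |>.2 h).trans (le_max_right _ _)
  have hn : 0 < θ ^ n := by positivity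
  rcases (by omega : m = n ∨ m = n + 1 ∨ n = m + 1) with rfl | rfl | rfl
  · exact le_mul_of_one_le_left hn.le h1'
  · rw [pow_succ, mul_comm]
    exact mul_le_mul_of_nonneg_right (le_max_left _ _) hn.le
  · calc θ ^ m = θ⁻¹ * θ ^ (m + 1) := by rw [pow_succ]; field_simp
      _ ≤ _ := mul_le_mul_of_nonneg_right (le_max_right _ _) hn.le

theorem typeWeight_cons (u : ℝ) (l : G.edgeSet × LinkType) (c : LinkConfig G) :
    u ^ ((l :: c).countP fun l => l.2 = LinkType.cross)
      * (1 - u) ^ ((l :: c).countP fun l => l.2 = LinkType.doubleBar) =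
    typeProb u l.2 * (u ^ (c.countP fun l => l.2 = LinkType.cross)
      * (1 - u) ^ (c.countP fun l => l.2 = LinkType.doubleBar)) := by
  rcases l with ⟨e, _ | _⟩
  · simp [typeProb, pow_succ]; ring
  · simp [typeProb, pow_succ]; ring

/-- The factor β/(n+1) comes from β^n/n!, and the change of at most one loop costs at most max(θ,
1/θ). -/
theorem loopWeight_insertIdx_le [Fintype V] (hβ : 0 ≤ β) (hu : 0 ≤ u) (hu1 : u ≤ 1) (hθ : 0 < θ)
    (c : LinkConfig G) {p : ℕ} (hp : p ≤ c.length) (l : G.edgeSet × LinkType) :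
    loopWeight β u θ (c.insertIdx p l) ≤
      β / (c.length + 1) * typeProb u l.2 * max θ θ⁻¹ * loopWeight β u θ c := by
  have hperm := List.perm_insertIdx l c hp
  have hu' : 0 ≤ 1 - u := by linarith
  have ht : 0 ≤ typeProb u l.2 := by rcases l with ⟨e, _ | _⟩ <;> assumption
  rw [loopWeight, hperm.countP_eq, hperm.countP_eq,
    List.length_insertIdx_of_le_length hp l, mul_assoc (β ^ _ / _), typeWeight_cons]
  obtain ⟨h1, h2⟩ := numLoops_insertIdx c p hp l
  have h3 := pow_le_max_mul_pow hθ h1 h2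
  rw [loopWeight]
  calc _ ≤ β ^ (c.length + 1) / ((c.length + 1).factorial : ℝ) *
        (typeProb u l.2 * (u ^ (c.countP fun l => l.2 = LinkType.cross)
      * (1 - u) ^ (c.countP fun l => l.2 = LinkType.doubleBar))) *
        (max θ θ⁻¹ * θ ^ numLoops c) :=
      mul_le_mul_of_nonneg_left h3 (by positivity)
    _ = _ := by
      rw [Nat.factorial_succ, pow_succ]
      push_cast
      field_simp

theorem wt_insertIdx_le [Fintype V] (hβ : 0 ≤ β) (hu : 0 ≤ u) (hu1 : u ≤ 1) (hθ : 0 < θ)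
    (c : LinkConfig G) {p : ℕ} (hp : p ≤ c.length) (l : G.edgeSet × LinkType) :
    wt β u θ (c.insertIdx p l) ≤
      wt β u θ c * ENNReal.ofReal (β * max θ θ⁻¹ / (c.length + 1) * typeProb u l.2) := by
  rw [wt, wt, ← ENNReal.ofReal_mul (loopWeight_nonneg hβ hu hu1 hθ.le c)]
  refine ENNReal.ofReal_le_ofReal ((loopWeight_insertIdx_le hβ hu hu1 hθ c hp l).trans_eq ?_)
  ring

open Classical in
/-- The positions of the links on `f` whose removal leads to a configuration in `T`. -/
noncomputable def removable (T : Set (LinkConfig G)) (f : G.edgeSet) (c : LinkConfig G) :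
    Finset ℕ :=
  (Finset.range c.length).filter fun i =>
    (∃ t, getElem? c i = some (f, t)) ∧ c.eraseIdx i ∈ T

theorem mem_removable {T : Set (LinkConfig G)} {f : G.edgeSet} {c : LinkConfig G} {i : ℕ} :
    i ∈ removable T f c ↔ (∃ t, getElem? c i = some (f, t)) ∧ c.eraseIdx i ∈ T := by
  simp only [removable, Finset.mem_filter, Finset.mem_range, and_iff_right_iff_imp, and_imp,
    forall_exists_index]
  intro t h _
  exact (List.getElem?_eq_some_iff.1 h).1

theorem insertIdx_eraseIdx_of_getElem? {α : Type*} {c : List α} {i : ℕ} {l : α}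
    (h : getElem? c i = some l) : (c.eraseIdx i).insertIdx i l = c := by
  obtain ⟨h1, rfl⟩ := List.getElem?_eq_some_iff.1 h
  exact List.insertIdx_eraseIdx_getElem h1

theorem length_eraseIdx_of_getElem? {α : Type*} {c : List α} {i : ℕ} {l : α}
    (h : getElem? c i = some l) : (c.eraseIdx i).length + 1 = c.length := by
  have h1 := (List.getElem?_eq_some_iff.1 h).1
  rw [List.length_eraseIdx, if_pos h1]
  omega

/-- Double counting of the removals of a link on `f`. -/
theorem tsum_card_removable_le [Fintype V] (hβ : 0 ≤ β) (hu : 0 ≤ u) (hu1 : u ≤ 1) (hθ : 0 < θ)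
    (T : Set (LinkConfig G)) (f : G.edgeSet) :
    ∑' c, wt β u θ c * (removable T f c).card ≤
      ENNReal.ofReal (β * max θ θ⁻¹) * mass β u θ T := by
  classical
  have hu' : 0 ≤ 1 - u := by linarith
  have ht : ∀ t, 0 ≤ typeProb u t := by rintro (_ | _) <;> assumption
  have hm : 0 ≤ max θ θ⁻¹ := le_max_of_le_left hθ.le
  rw [← tsum_prod_indicator]
  let v : LinkConfig G × (ℕ × Bool) → ℝ≥0∞ := fun a =>
    wt β u θ a.1 * ENNReal.ofReal (β * max θ θ⁻¹ / (a.1.length + 1) *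
      typeProb u (if a.2.2 then .cross else .doubleBar))
  calc _ ≤ ∑' a : LinkConfig G × (ℕ × Bool),
        Set.indicator {a | a.1 ∈ T ∧ a.2.1 ∈ Finset.range (a.1.length + 1)} v a := by
        -- A removal is undone from the shorter configuration, the position and the type, recorded
        -- as a Boolean. Conversely there are n + 1 positions, which cancel the factor 1/(n+1), and
        -- the two type probabilities sum to 1.
        refine tsum_indicator_le_of_injOn (fun a => (a.1.eraseIdx a.2, a.2,
          (getElem? a.1 a.2).any fun l => l.2 = LinkType.cross)) ?_ ?_ ?_
        · rintro ⟨c, i⟩ h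
          obtain ⟨⟨t, (h1 : getElem? c i = _)⟩, h2⟩ := mem_removable.1 h
          refine ⟨h2, ?_⟩
          have := length_eraseIdx_of_getElem? h1
          have := (List.getElem?_eq_some_iff.1 h1).1
          simp only [Finset.mem_range]
          omega
        · rintro ⟨c, i⟩ h ⟨c', i'⟩ h' heq
          simp only [Prod.mk.injEq] at heq
          obtain ⟨e1, rfl, e2⟩ := heq
          obtain ⟨⟨t, (h1 : getElem? c i = _)⟩, -⟩ := mem_removable.1 h
          obtain ⟨⟨t', (h1' : getElem? c' i = _)⟩, -⟩ := mem_removable.1 h'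
          simp only [h1, h1', Option.any_some] at e2
          have : t = t' := by rcases t with _ | _ <;> rcases t' with _ | _ <;> simp_all
          subst this
          rw [Prod.mk.injEq, and_iff_left rfl, ← insertIdx_eraseIdx_of_getElem? h1, e1,
            insertIdx_eraseIdx_of_getElem? h1']
        · rintro ⟨c, i⟩ h
          obtain ⟨⟨t, (h1 : getElem? c i = _)⟩, -⟩ := mem_removable.1 h
          have h2 := length_eraseIdx_of_getElem? h1
          have h3 := (List.getElem?_eq_some_iff.1 h1).1
          have h4 := wt_insertIdx_le hβ hu hu1 hθ (c.eraseIdx i) (p := i) (by omega) (f, t)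
          rw [insertIdx_eraseIdx_of_getElem? h1] at h4
          refine h4.trans_eq ?_
          simp only [v, h1, Option.any_some]
          rcases t with _ | _ <;> simp
    _ = ∑' c, T.indicator (fun c => ENNReal.ofReal (β * max θ θ⁻¹) * wt β u θ c) c := by
        rw [ENNReal.tsum_prod']
        refine tsum_congr fun c => ?_
        by_cases hc : c ∈ T
        · rw [Set.indicator_of_mem hc, ENNReal.tsum_prod',
            tsum_eq_sum (s := Finset.range (c.length + 1))]
          · rw [Finset.sum_congr rfl fun i hi => tsum_congr fun b =>
              Set.indicator_of_mem (by exact ⟨hc, hi⟩) v]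
            simp only [v, tsum_bool, Bool.false_eq_true, if_false, if_true, Finset.sum_const,
              Finset.card_range, nsmul_eq_mul]
            rw [← mul_add, ← ENNReal.ofReal_add (mul_nonneg (by positivity) (ht _))
              (mul_nonneg (by positivity) (ht _)), mul_left_comm, mul_comm, ← ENNReal.ofReal_natCast,
              ← ENNReal.ofReal_mul (by positivity)]
            congr 2
            simp only [typeProb]
            push_cast
            field_simp
            ring
          · intro i hi
            simp only [ENNReal.tsum_eq_zero]
            exact fun b => Set.indicator_of_notMem (fun h => hi h.2) _
        · rw [Set.indicator_of_notMem hc]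
          simp only [ENNReal.tsum_eq_zero]
          exact fun b => Set.indicator_of_notMem (fun h => hc h.1) _
    _ = _ := by
        rw [mass, ← ENNReal.tsum_mul_left]
        refine tsum_congr fun c => ?_
        by_cases hc : c ∈ T <;> simp [hc]

/-- Form used in applications: a configuration with `k` ways into `T` is counted `k` times. -/
theorem mul_mass_le [Fintype V] (hβ : 0 ≤ β) (hu : 0 ≤ u) (hu1 : u ≤ 1) (hθ : 0 < θ)
    {S T : Set (LinkConfig G)} (f : G.edgeSet) (k : ℕ) (h : ∀ c ∈ S, k ≤ (removable T f c).card) :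
    k * mass β u θ S ≤ ENNReal.ofReal (β * max θ θ⁻¹) * mass β u θ T := by
  refine le_trans ?_ (tsum_card_removable_le hβ hu hu1 hθ T f)
  rw [mass, ← ENNReal.tsum_mul_left]
  refine ENNReal.tsum_le_tsum fun c => ?_
  by_cases hc : c ∈ S
  · rw [Set.indicator_of_mem hc, mul_comm]
    gcongr
    exact_mod_cast h c hc
  · simp [hc]

end Mass

/-! ### Comparison with configurations without links on `e` -/

section Comparison

variable {V : Type*} {G : SimpleGraph V} {β u θ : ℝ}

theorem eq_take_append_cons_drop {α : Type*} {c : List α} {i : ℕ} {l : α}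
    (h : getElem? c i = some l) : c = c.take i ++ l :: c.drop (i + 1) := by
  obtain ⟨h1, rfl⟩ := List.getElem?_eq_some_iff.1 h
  rw [← List.drop_eq_getElem_cons h1, List.take_append_drop]

theorem offEdge_eraseIdx {e : G.edgeSet} {c : LinkConfig G} {i : ℕ} {t : LinkType}
    (h : getElem? c i = some (e, t)) : offEdge e (c.eraseIdx i) = offEdge e c := by
  conv_rhs => rw [eq_take_append_cons_drop h]
  rw [List.eraseIdx_eq_take_drop_succ, offEdge_append, offEdge_append, offEdge_cons_self]

open Classical in
/-- The number of links on an edge. -/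
noncomputable def numOn (e : G.edgeSet) (c : LinkConfig G) : ℕ := c.countP fun l => l.1 = e

theorem numOn_eraseIdx {e : G.edgeSet} {c : LinkConfig G} {i : ℕ} {t : LinkType}
    (h : getElem? c i = some (e, t)) : numOn e (c.eraseIdx i) + 1 = numOn e c := by
  conv_rhs => rw [eq_take_append_cons_drop h]
  rw [List.eraseIdx_eq_take_drop_succ, numOn, numOn, List.countP_append, List.countP_append,
    List.countP_cons]
  simp
  omega

theorem numOn_pos {e : G.edgeSet} {c : LinkConfig G} : 0 < numOn e c ↔ ∃ l ∈ c, l.1 = e := by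
  simp [numOn, List.countP_pos_iff]

theorem numOn_eq_zero {e : G.edgeSet} {c : LinkConfig G} : numOn e c = 0 ↔ ∀ l ∈ c, l.1 ≠ e := by
  simp [numOn]

open Classical in
/-- The positions of the links on an edge. -/
noncomputable def positionsOn (e : G.edgeSet) (c : LinkConfig G) : Finset ℕ :=
  (Finset.range c.length).filter fun i => ∃ t, getElem? c i = some (e, t)

theorem mem_positionsOn {e : G.edgeSet} {c : LinkConfig G} {i : ℕ} :
    i ∈ positionsOn e c ↔ ∃ t, getElem? c i = some (e, t) := by
  simp only [positionsOn, Finset.mem_filter, Finset.mem_range, and_iff_right_iff_imp,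
    forall_exists_index]
  intro t h
  exact (List.getElem?_eq_some_iff.1 h).1

theorem card_positionsOn (e : G.edgeSet) (c : LinkConfig G) :
    (positionsOn e c).card = numOn e c := by
  classical
  induction c using List.reverseRecOn with
  | nil => simp [positionsOn, numOn]
  | append_singleton c l ih =>
    have h1 : numOn e (c ++ [l]) = numOn e c + if l.1 = e then 1 else 0 := by
      rw [numOn, numOn, List.countP_append, List.countP_cons]
      simp
    have h2 : positionsOn e (c ++ [l]) =
        positionsOn e c ∪ (if l.1 = e then {c.length} else ∅) := by
      ext i
      rw [Finset.mem_union, mem_positionsOn, mem_positionsOn, List.getElem?_append]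
      split_ifs with hi hl hl
      · simp only [Finset.mem_singleton, hi.ne, or_false]
      · simp
      · have : getElem? c i = none := List.getElem?_eq_none (by omega)
        rw [this]
        simp only [List.getElem?_singleton, Finset.mem_singleton]
        constructor
        · rintro ⟨t, ht⟩
          split_ifs at ht with h0
          right; omega
        · rintro (⟨t, ht⟩ | rfl)
          · cases ht
          · exact ⟨l.2, by simp [← hl]⟩
      · have : getElem? c i = none := List.getElem?_eq_none (by omega)
        rw [this]
        simp only [List.getElem?_singleton, Finset.notMem_empty, or_false]
        constructor
        · rintro ⟨t, ht⟩
          split_ifs at ht with h0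
          cases ht
          exact absurd rfl hl
        · rintro ⟨t, ht⟩
          cases ht
    rw [h1, h2, Finset.card_union_of_disjoint, ih]
    · split_ifs <;> simp
    · rw [Finset.disjoint_left]
      intro i hi hi'
      obtain ⟨t, ht⟩ := mem_positionsOn.1 hi
      have := (List.getElem?_eq_some_iff.1 ht).1
      split_ifs at hi'
      · simp only [Finset.mem_singleton] at hi'
        omega
      · simp at hi'

theorem IsBlocking.numOn_eq {c : LinkConfig G} {e : G.edgeSet} (h : IsBlocking c e) :
    numOn e c = 2 := by
  classical
  obtain ⟨i, j, hp, -⟩ := isBlocking_iff.1 h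
  rw [← card_positionsOn]
  have : positionsOn e c = {i, j} := by
    ext k
    rw [mem_positionsOn]
    simp only [Finset.mem_insert, Finset.mem_singleton]
    constructor
    · rintro ⟨t, ht⟩
      exact hp.eq_or _ _ ht rfl
    · rintro (rfl | rfl)
      · exact ⟨_, hp.left⟩
      · exact ⟨_, hp.right⟩
  rw [this, Finset.card_pair hp.lt.ne]

/-- With k + 1 links on `e` there are k + 1 ways to remove one, so each link gives a factor x/(k+1):
a Poisson bound with x = β max(θ, 1/θ). -/
theorem mass_numOn_le [Fintype V] (hβ : 0 ≤ β) (hu : 0 ≤ u) (hu1 : u ≤ 1) (hθ : 0 < θ)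
    (e : G.edgeSet) (T : Set (LinkConfig G)) (k : ℕ) :
    mass β u θ {c | offEdge e c ∈ T ∧ numOn e c = k} ≤
      ENNReal.ofReal ((β * max θ θ⁻¹) ^ k / k.factorial) * mass β u θ T := by
  have hm : 0 ≤ max θ θ⁻¹ := le_max_of_le_left hθ.le
  induction k with
  | zero =>
    simp only [pow_zero, Nat.factorial_zero, Nat.cast_one, div_one, ENNReal.ofReal_one, one_mul]
    refine mass_mono fun c hc => ?_
    rw [← offEdge_eq_self (numOn_eq_zero.1 hc.2)]
    exact hc.1
  | succ k ih =>
    have h := mul_mass_le (β := β) (u := u) (θ := θ) hβ hu hu1 hθ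
      (S := {c | offEdge e c ∈ T ∧ numOn e c = k + 1})
      (T := {c | offEdge e c ∈ T ∧ numOn e c = k}) e (k + 1) (by
        rintro c ⟨h1, h2⟩
        rw [← h2, ← card_positionsOn]
        refine Finset.card_le_card fun i hi => ?_
        obtain ⟨t, ht⟩ := mem_positionsOn.1 hi
        refine mem_removable.2 ⟨⟨t, ht⟩, ?_, ?_⟩
        · rwa [offEdge_eraseIdx ht]
        · have := numOn_eraseIdx ht
          omega)
    have h0 : ((k + 1 : ℕ) : ℝ≥0∞) ≠ 0 := by simp
    rw [← ENNReal.mul_le_mul_iff_right h0 (ENNReal.natCast_ne_top _)]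
    refine h.trans ((mul_le_mul_right ih _).trans_eq ?_)
    rw [← mul_assoc, ← mul_assoc, ← ENNReal.ofReal_mul (by positivity), ← ENNReal.ofReal_natCast,
      ← ENNReal.ofReal_mul (by positivity)]
    congr 2
    rw [Nat.factorial_succ, pow_succ]
    push_cast
    field_simp

theorem mass_offEdge_le [Fintype V] (hβ : 0 ≤ β) (hu : 0 ≤ u) (hu1 : u ≤ 1) (hθ : 0 < θ)
    (e : G.edgeSet) (T : Set (LinkConfig G)) :
    mass β u θ {c | offEdge e c ∈ T} ≤
      ENNReal.ofReal (Real.exp (β * max θ θ⁻¹)) * mass β u θ T := by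
  have hm : 0 ≤ max θ θ⁻¹ := le_max_of_le_left hθ.le
  have h1 : {c | offEdge e c ∈ T} ⊆ ⋃ k, {c | offEdge e c ∈ T ∧ numOn e c = k} := fun c hc =>
    Set.mem_iUnion.2 ⟨_, hc, rfl⟩
  refine (mass_mono h1).trans ((mass_iUnion_le _).trans ?_)
  refine (ENNReal.tsum_le_tsum fun k => mass_numOn_le hβ hu hu1 hθ e T k).trans_eq ?_
  rw [ENNReal.tsum_mul_right, ← ENNReal.ofReal_tsum_of_nonneg (fun k => by positivity)
    (Real.summable_pow_div_factorial _), Real.exp_eq_exp_ℝ, NormedSpace.exp_eq_tsum_div]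

/-- The exponential series without its term of order zero, because `e` is required to be open. -/
theorem mass_offEdge_pos_le [Fintype V] (hβ : 0 ≤ β) (hu : 0 ≤ u) (hu1 : u ≤ 1) (hθ : 0 < θ)
    (e : G.edgeSet) (T : Set (LinkConfig G)) :
    mass β u θ {c | offEdge e c ∈ T ∧ 0 < numOn e c} ≤
      ENNReal.ofReal (Real.exp (β * max θ θ⁻¹) - 1) * mass β u θ T := by
  have hm : 0 ≤ max θ θ⁻¹ := le_max_of_le_left hθ.le
  have h1 : {c | offEdge e c ∈ T ∧ 0 < numOn e c} ⊆
      ⋃ k, {c | offEdge e c ∈ T ∧ numOn e c = k + 1} := fun c hc =>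
    Set.mem_iUnion.2 ⟨numOn e c - 1, hc.1, by have := hc.2; omega⟩
  refine (mass_mono h1).trans ((mass_iUnion_le _).trans ?_)
  refine (ENNReal.tsum_le_tsum fun k => mass_numOn_le hβ hu hu1 hθ e T (k + 1)).trans_eq ?_
  have hs := Real.summable_pow_div_factorial (β * max θ θ⁻¹)
  rw [ENNReal.tsum_mul_right, ← ENNReal.ofReal_tsum_of_nonneg (fun k => by positivity)
    ((summable_nat_add_iff 1).2 hs), Real.exp_eq_exp_ℝ, NormedSpace.exp_eq_tsum_div]
  beta_reduce
  rw [hs.tsum_eq_zero_add]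
  simp

/-- The configurations whose set of open edges is `F` and whose set of blocking edges other than `e`
is `B`. -/
def patternSet (F : Finset G.edgeSet) (e : G.edgeSet) (B : Set G.edgeSet) : Set (LinkConfig G) :=
  {c | c ∈ openEdgesEq F ∧ ∀ f ∈ F, f ≠ e → (IsBlocking c f ↔ f ∈ B)}

/-- The configurations without links on `e` whose other open edges are those of `F`, and whose
blocking edges are those in `B` and possibly some more in `S`. -/
def loosePatternSet (F : Finset G.edgeSet) (e : G.edgeSet) (B S : Set G.edgeSet) :
    Set (LinkConfig G) :=
  {c | (∀ f, (∃ l ∈ c, l.1 = f) ↔ f ∈ F ∧ f ≠ e) ∧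
    ∀ f ∈ F, f ≠ e → (f ∈ B → IsBlocking c f) ∧ (IsBlocking c f → f ∈ B ∨ f ∈ S)}

theorem open_eraseIdx {c : LinkConfig G} {f : G.edgeSet} {m : ℕ} {t : LinkType}
    (hm : getElem? c m = some (f, t)) (h2 : 2 ≤ numOn f c) (g : G.edgeSet) :
    (∃ l ∈ c.eraseIdx m, l.1 = g) ↔ ∃ l ∈ c, l.1 = g := by
  by_cases hg : g = f
  · subst hg
    have := numOn_eraseIdx hm
    rw [← numOn_pos, ← numOn_pos]
    omega
  · constructor
    · rintro ⟨l, hl, hlg⟩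
      exact ⟨l, List.mem_of_mem_eraseIdx hl, hlg⟩
    · rintro ⟨l, hl, hlg⟩
      refine ⟨l, ?_, hlg⟩
      rw [eq_take_append_cons_drop hm] at hl
      rw [List.eraseIdx_eq_take_drop_succ]
      simp only [List.mem_append, List.mem_cons] at hl ⊢
      rcases hl with hl | rfl | hl
      · exact Or.inl hl
      · exact absurd hlg.symm hg
      · exact Or.inr hl

/-- A configuration lost by forbidding `f` has `f` blocking and outside `B`. Removing either of the
two crosses on `f` spoils `f`, leaves it open, and changes the status of no other edge; two ways out
bound the lost mass by x/2 times the mass kept. -/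
theorem mass_loosePatternSet_insert_le [Fintype V] (hβ : 0 ≤ β) (hu : 0 ≤ u) (hu1 : u ≤ 1)
    (hθ : 0 < θ) (F : Finset G.edgeSet) (e f : G.edgeSet) (B S : Set G.edgeSet) :
    mass β u θ (loosePatternSet F e B (insert f S)) ≤
      ENNReal.ofReal (1 + β * max θ θ⁻¹ / 2) * mass β u θ (loosePatternSet F e B S) := by
  classical
  have hm : 0 ≤ max θ θ⁻¹ := le_max_of_le_left hθ.le
  set T := loosePatternSet F e B S
  set D := loosePatternSet F e B (insert f S) \ T with hD
  have h1 : ((2 : ℕ) : ℝ≥0∞) * mass β u θ D ≤ ENNReal.ofReal (β * max θ θ⁻¹) * mass β u θ T := by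
    refine mul_mass_le hβ hu hu1 hθ f 2 ?_
    rintro c ⟨⟨hc1, hc2⟩, hc3⟩
    have hf : IsBlocking c f ∧ f ∈ F ∧ f ≠ e ∧ f ∉ B := by
      by_contra hcon
      refine hc3 ⟨hc1, fun g hg hge => ⟨(hc2 g hg hge).1, fun hb => ?_⟩⟩
      rcases (hc2 g hg hge).2 hb with h | rfl | h
      · exact Or.inl h
      · left
        by_contra hB
        exact hcon ⟨hb, hg, hge, hB⟩
      · exact Or.inr h
    obtain ⟨hfb, hfF, hfe, hfB⟩ := hf
    obtain ⟨i, j, hp, -⟩ := isBlocking_iff.1 hfb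
    have hmem : ∀ m, m = i ∨ m = j → m ∈ removable T f c := by
      intro m hm
      have hm' : getElem? c m = some (f, LinkType.cross) := by
        rcases hm with rfl | rfl
        · exact hp.left
        · exact hp.right
      refine mem_removable.2 ⟨⟨_, hm'⟩, fun g => ?_, fun g hg hge => ?_⟩
      · rw [open_eraseIdx hm' hfb.numOn_eq.ge, hc1]
      · by_cases hgf : g = f
        · subst hgf
          exact ⟨fun h => absurd h hfB, fun h => absurd h (hp.not_isBlocking_eraseIdx hm)⟩
        · rw [isBlocking_eraseIdx_of_isBlocking hfb hm' rfl hgf]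
          refine ⟨(hc2 g hg hge).1, fun hb => ?_⟩
          rcases (hc2 g hg hge).2 hb with h | h | h
          · exact Or.inl h
          · exact absurd h hgf
          · exact Or.inr h
    rw [← Finset.card_pair hp.lt.ne]
    refine Finset.card_le_card fun m hm => hmem m ?_
    simpa using hm
  have h2 : mass β u θ D ≤ ENNReal.ofReal (β * max θ θ⁻¹ / 2) * mass β u θ T := by
    rw [← ENNReal.mul_le_mul_iff_right (a := ((2 : ℕ) : ℝ≥0∞)) (by simp) (by simp)]
    refine h1.trans_eq ?_
    rw [← mul_assoc, ← ENNReal.ofReal_natCast, ← ENNReal.ofReal_mul (by positivity)]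
    congr 2
    push_cast
    ring
  calc _ ≤ mass β u θ (T ∪ D) := mass_mono fun c hc => by
        by_cases h : c ∈ T
        · exact Or.inl h
        · exact Or.inr ⟨hc, h⟩
    _ ≤ mass β u θ T + ENNReal.ofReal (β * max θ θ⁻¹ / 2) * mass β u θ T :=
        (mass_union_le _ _).trans (by gcongr)
    _ = _ := by
        rw [ENNReal.ofReal_add zero_le_one (by positivity), ENNReal.ofReal_one, add_mul, one_mul]

theorem mass_loosePatternSet_le [Fintype V] (hβ : 0 ≤ β) (hu : 0 ≤ u) (hu1 : u ≤ 1)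
    (hθ : 0 < θ) (F : Finset G.edgeSet) (e : G.edgeSet) (B : Set G.edgeSet)
    (N : Finset G.edgeSet) :
    mass β u θ (loosePatternSet F e B N) ≤
      ENNReal.ofReal (1 + β * max θ θ⁻¹ / 2) ^ N.card * mass β u θ (loosePatternSet F e B ∅) := by
  classical
  induction N using Finset.induction_on with
  | empty => simp
  | insert f N hf ih =>
    rw [Finset.coe_insert, Finset.card_insert_of_notMem hf, pow_succ', mul_assoc]
    refine (mass_loosePatternSet_insert_le hβ hu hu1 hθ F e f B N).trans ?_
    gcongr

open Classical in
/-- The edges of `F` adjacent to `e`. -/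
noncomputable def adjacentIn (F : Finset G.edgeSet) (e : G.edgeSet) : Finset G.edgeSet :=
  F.filter fun f => f ≠ e ∧ Near f e

theorem mem_adjacentIn {F : Finset G.edgeSet} {e f : G.edgeSet} :
    f ∈ adjacentIn F e ↔ f ∈ F ∧ f ≠ e ∧ Near f e := by
  simp [adjacentIn]

/-- Each end point of `e` has at most K - 1 further edges. Written without subtraction, the bound
also yields 1 ≤ K as soon as there is an edge. -/
theorem card_adjacentIn_le [Fintype V] [DecidableRel G.Adj] {K : ℕ} (hK : G.maxDegree ≤ K)
    (F : Finset G.edgeSet) (e : G.edgeSet) : (adjacentIn F e).card + 2 ≤ 2 * K := by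
  classical
  obtain ⟨⟨x, y⟩, he⟩ := e
  have hxy : G.Adj x y := he
  have hI : ∀ v, v = x ∨ v = y → ((G.incidenceFinset v).erase s(x, y)).card + 1 ≤ K := by
    intro v hv
    have h1 : s(x, y) ∈ G.incidenceFinset v := by
      rw [SimpleGraph.mem_incidenceFinset]
      exact ⟨he, by rcases hv with rfl | rfl <;> simp⟩
    rw [Finset.card_erase_add_one h1, SimpleGraph.card_incidenceFinset_eq_degree]
    exact (G.degree_le_maxDegree v).trans hK
  have h1 : ((adjacentIn F ⟨s(x, y), he⟩).map (Function.Embedding.subtype _)) ⊆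
      (G.incidenceFinset x).erase s(x, y) ∪ (G.incidenceFinset y).erase s(x, y) := by
    intro g hg
    simp only [Finset.mem_map, mem_adjacentIn, Function.Embedding.subtype_apply] at hg
    obtain ⟨f, ⟨-, hfe, v, hv1, hv2⟩, rfl⟩ := hg
    have hne : (f : Sym2 V) ≠ s(x, y) := fun h => hfe (Subtype.ext h)
    simp only [Finset.mem_union, Finset.mem_erase, SimpleGraph.mem_incidenceFinset]
    rcases Sym2.mem_iff.1 hv2 with rfl | rfl
    · exact Or.inl ⟨hne, f.2, hv1⟩
    · exact Or.inr ⟨hne, f.2, hv1⟩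
  have h2 := (Finset.card_le_card h1).trans (Finset.card_union_le _ _)
  rw [Finset.card_map] at h2
  have h3 := hI x (Or.inl rfl)
  have h4 := hI y (Or.inr rfl)
  have h5 : (adjacentIn F ⟨s(x, y), he⟩).card + 2 ≤ 2 * K := by omega
  exact h5

/-- Erasing the links on `e` can create new blocking edges only among those adjacent to `e`; these
are tolerated first and then eliminated one by one. -/
theorem mass_patternSet_le [Fintype V] (hβ : 0 ≤ β) (hu : 0 ≤ u) (hu1 : u ≤ 1)
    (hθ : 0 < θ) {F : Finset G.edgeSet} {e : G.edgeSet} (he : e ∈ F) (B : Set G.edgeSet) :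
    mass β u θ (patternSet F e B) ≤
      ENNReal.ofReal (Real.exp (β * max θ θ⁻¹) - 1) *
        (ENNReal.ofReal (1 + β * max θ θ⁻¹ / 2) ^ (adjacentIn F e).card *
          mass β u θ (loosePatternSet F e B ∅)) := by
  have h1 : patternSet F e B ⊆
      {c | offEdge e c ∈ loosePatternSet F e B (adjacentIn F e) ∧ 0 < numOn e c} := by
    rintro c ⟨hc1, hc2⟩
    refine ⟨⟨fun f => ?_, fun f hf hfe => ⟨fun hB => ?_, fun hb => ?_⟩⟩,
      numOn_pos.2 ((hc1 e).2 he)⟩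
    · rw [← hc1 f]
      constructor
      · rintro ⟨l, hl, rfl⟩
        rw [mem_offEdge] at hl
        exact ⟨⟨l, hl.1, rfl⟩, hl.2⟩
      · rintro ⟨⟨l, hl, rfl⟩, hl2⟩
        exact ⟨l, mem_offEdge.2 ⟨hl, hl2⟩, rfl⟩
    · exact isBlocking_offEdge_of_isBlocking hfe ((hc2 f hf hfe).2 hB)
    · by_cases hn : Near f e
      · exact Or.inr (mem_adjacentIn.2 ⟨hf, hfe, hn⟩)
      · exact Or.inl ((hc2 f hf hfe).1 ((isBlocking_offEdge_of_not_near hn).1 hb))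
  refine (mass_mono h1).trans ((mass_offEdge_pos_le hβ hu hu1 hθ e _).trans ?_)
  gcongr
  exact mass_loosePatternSet_le hβ hu hu1 hθ F e B _

theorem IsCrossPair.unique {c : LinkConfig G} {f : G.edgeSet} {i j i' j' : ℕ}
    (h : IsCrossPair c f i j) (h' : IsCrossPair c f i' j') : i = i' ∧ j = j' := by
  have h1 := h.eq_or _ _ h'.left rfl
  have h2 := h.eq_or _ _ h'.right rfl
  have h3 := h.lt
  have h4 := h'.lt
  omega

/-- If `f` has at least four links, it is not blocking before or after a removal. A link on `f` then
fails to be removable only if it is the sole link separating the two crosses of some edge adjacent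
to `f`, and each such edge accounts for at most one link. -/
theorem numOn_le_card_removable [Fintype V] [DecidableRel G.Adj] {K : ℕ} (hK : G.maxDegree ≤ K)
    {F : Finset G.edgeSet} {e f : G.edgeSet} {B : Set G.edgeSet} (hf : f ∈ adjacentIn F e)
    {c : LinkConfig G} (hc : c ∈ loosePatternSet F e B ∅) :
    numOn f c ≤ 2 * K + (removable (loosePatternSet F e B ∅) f c).card := by
  classical
  have hcard := card_adjacentIn_le hK F e
  have hpos : 0 < (adjacentIn F e).card := Finset.card_pos.2 ⟨f, hf⟩
  -- An edge adjacent to `e` exists, so 3 ≤ 2K and hence 4 ≤ 2K: at most three links are covered by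
  -- the term 2K alone.
  rcases Nat.lt_or_ge (numOn f c) 4 with h4 | h4
  · omega
  have hkey : ∀ m ∈ positionsOn f c \ removable (loosePatternSet F e B ∅) f c,
      ∃ g ∈ adjacentIn F f, ∃ i j, IsCrossPair c g i j ∧ i < m ∧ m < j ∧
        ∀ k l', i < k → k < j → k ≠ m → getElem? c k = some l' → ¬ Near l'.1 g := by
    intro m hm
    rw [Finset.mem_sdiff, mem_positionsOn, mem_removable] at hm
    obtain ⟨⟨t, ht⟩, hm⟩ := hm
    have h3 := numOn_eraseIdx ht
    have : ∃ g ∈ F, g ≠ e ∧ ¬ ((g ∈ B → IsBlocking (c.eraseIdx m) g) ∧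
        (IsBlocking (c.eraseIdx m) g → g ∈ B ∨ g ∈ (∅ : Set G.edgeSet))) := by
      by_contra! hcon
      refine hm ⟨⟨t, ht⟩, fun g => ?_, fun g hg hge => ?_⟩
      · rw [open_eraseIdx ht (by omega), hc.1]
      · exact hcon g hg hge
    obtain ⟨g, hgF, hge, hg⟩ := this
    obtain ⟨hg1, hg2⟩ := hc.2 g hgF hge
    have hgf : f ≠ g := by
      rintro rfl
      refine hg ⟨fun hB => ?_, fun hb => ?_⟩
      · have := (hg1 hB).numOn_eq
        omega
      · have := hb.numOn_eq
        omega
    have hb : IsBlocking (c.eraseIdx m) g ∧ ¬ IsBlocking c g := by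
      by_contra hcon
      refine hg ⟨fun hB => (hg1 hB).eraseIdx ht hgf, fun hb => hg2 ?_⟩
      by_contra h
      exact hcon ⟨hb, h⟩
    obtain ⟨i, j, hp, h | ⟨h1, h2, h3⟩, h4⟩ := hb.1.of_eraseIdx ht hgf
    · exact absurd h hb.2
    · exact ⟨g, mem_adjacentIn.2 ⟨hgF, hgf.symm, h3.symm⟩, i, j, hp, h1, h2, h4⟩
  have : Nonempty G.edgeSet := ⟨f⟩
  choose! g hg i j hp hi hj hb using hkey
  have hle : (positionsOn f c \ removable (loosePatternSet F e B ∅) f c).card ≤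
      (adjacentIn F f).card := by
    refine Finset.card_le_card_of_injOn g hg ?_
    intro m hm m' hm' heq
    by_contra hne
    have hp1 := hp m hm
    have hp2 := hp m' hm'
    rw [← heq] at hp2
    obtain ⟨e1, e2⟩ := hp1.unique hp2
    have a1 := hi m' hm'
    have a2 := hj m' hm'
    rw [← e1] at a1
    rw [← e2] at a2
    have hm2 := hm'
    rw [Finset.mem_coe, Finset.mem_sdiff, mem_positionsOn] at hm2
    obtain ⟨⟨t, ht⟩, -⟩ := hm2
    exact hb m hm m' _ a1 a2 (Ne.symm hne) ht (mem_adjacentIn.1 (hg m hm)).2.2.symm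
  have h1 := card_adjacentIn_le hK F f
  have h2 := Finset.le_card_sdiff (removable (loosePatternSet F e B ∅) f c) (positionsOn f c)
  rw [card_positionsOn] at h2
  omega

/-- The number of links on the edges adjacent to `e`. -/
noncomputable def numAdjacent (F : Finset G.edgeSet) (e : G.edgeSet) (c : LinkConfig G) : ℕ :=
  ∑ f ∈ adjacentIn F e, numOn f c

/-- On each of the at most 2K - 2 adjacent edges, all links but 2K are removable, and removable
links have mean at most x by double counting. -/
theorem tsum_numAdjacent_le [Fintype V] [DecidableRel G.Adj] {K : ℕ} (hK : G.maxDegree ≤ K)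
    (hβ : 0 ≤ β) (hu : 0 ≤ u) (hu1 : u ≤ 1) (hθ : 0 < θ)
    (F : Finset G.edgeSet) (e : G.edgeSet) (B : Set G.edgeSet) :
    ∑' c, (loosePatternSet F e B ∅).indicator
      (fun c => wt β u θ c * ((numAdjacent F e c + 1 : ℕ) : ℝ≥0∞)) c ≤
      ENNReal.ofReal (1 + (2 * K - 2) * (2 * K + β * max θ θ⁻¹)) *
        mass β u θ (loosePatternSet F e B ∅) := by
  set T := loosePatternSet F e B ∅ with hT
  have hm : 0 ≤ max θ θ⁻¹ := le_max_of_le_left hθ.le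
  have hcard := card_adjacentIn_le hK F e
  have hN : ((adjacentIn F e).card : ℝ) ≤ 2 * K - 2 := by
    have : (((adjacentIn F e).card + 2 : ℕ) : ℝ) ≤ ((2 * K : ℕ) : ℝ) := by exact_mod_cast hcard
    push_cast at this
    linarith
  calc _ ≤ ∑' c, (T.indicator (wt β u θ) c +
        ∑ f ∈ adjacentIn F e, ((2 * K : ℕ) * T.indicator (wt β u θ) c +
          wt β u θ c * (removable T f c).card)) := by
        refine ENNReal.tsum_le_tsum fun c => ?_
        by_cases hc : c ∈ T
        · rw [Set.indicator_of_mem hc, Set.indicator_of_mem hc, Nat.cast_add, Nat.cast_one, mul_add,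
            mul_one, add_comm, numAdjacent, Nat.cast_sum, Finset.mul_sum]
          gcongr with f hf
          rw [mul_comm ((2 * K : ℕ) : ℝ≥0∞), ← mul_add, ← Nat.cast_add]
          gcongr
          exact numOn_le_card_removable hK hf hc
        · rw [Set.indicator_of_notMem hc]
          exact zero_le
    _ = mass β u θ T + ∑ f ∈ adjacentIn F e, ((2 * K : ℕ) * mass β u θ T +
          ∑' c, wt β u θ c * (removable T f c).card) := by
        rw [ENNReal.tsum_add, Summable.tsum_finsetSum fun _ _ => ENNReal.summable]
        congr 1
        refine Finset.sum_congr rfl fun f _ => ?_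
        rw [ENNReal.tsum_add, ENNReal.tsum_mul_left]
        rfl
    _ ≤ mass β u θ T + ∑ f ∈ adjacentIn F e, ((2 * K : ℕ) * mass β u θ T +
          ENNReal.ofReal (β * max θ θ⁻¹) * mass β u θ T) := by
        gcongr with f hf
        exact tsum_card_removable_le hβ hu hu1 hθ T f
    _ = ENNReal.ofReal (1 + (adjacentIn F e).card * (2 * K + β * max θ θ⁻¹)) * mass β u θ T := by
        rw [Finset.sum_const, nsmul_eq_mul, ← add_mul, ← ENNReal.ofReal_natCast,
          ← ENNReal.ofReal_natCast, ← ENNReal.ofReal_add (by positivity) (by positivity),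
          ← mul_assoc, ← ENNReal.ofReal_mul (by positivity),
          ENNReal.ofReal_add zero_le_one (by positivity), ENNReal.ofReal_one, add_mul, one_mul]
        push_cast
        rfl
    _ ≤ _ := by gcongr

end Comparison

/-! ### Swapping a cross on `e` out of the blocking pairs that enclose it -/

section Swap

variable {V : Type*} {G : SimpleGraph V} {β u θ : ℝ}

theorem tsum_indicator_mono {α : Type*} {S T : Set α} (w : α → ℝ≥0∞) (h : S ⊆ T) :
    ∑' a, S.indicator w a ≤ ∑' a, T.indicator w a :=
  ENNReal.tsum_le_tsum fun a => Set.indicator_le_indicator_of_subset h (fun _ => zero_le) a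

theorem tsum_indicator_union_le {α : Type*} (S T : Set α) (w : α → ℝ≥0∞) :
    ∑' a, (S ∪ T).indicator w a ≤ ∑' a, S.indicator w a + ∑' a, T.indicator w a := by
  rw [← ENNReal.tsum_add]
  refine ENNReal.tsum_le_tsum fun c => ?_
  by_cases h1 : c ∈ S <;> by_cases h2 : c ∈ T <;> simp [h1, h2]

/-- `c'` arises from `c` by swapping the only link on `e`, a cross at position `p`, with the second
link of an edge `f ∋ v` whose two links enclose it. -/
structure IsSwap (e : G.edgeSet) (v : V) (c c' : LinkConfig G) (f : G.edgeSet) (p i j : ℕ) :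
    Prop where
  mark : getElem? c p = some (e, LinkType.cross)
  mark_unique : ∀ k l, getElem? c k = some l → l.1 = e → k = p
  pair : IsCrossPair c f i j
  lt_mark : i < p
  mark_lt : p < j
  mem : v ∈ (f : Sym2 V)
  ne : f ≠ e
  near : Near f e
  between : ∀ k l, i < k → k < j → getElem? c k = some l → l.1 ≠ e → ¬ Near l.1 f
  get : ∀ k, getElem? c' k = if k = j then some (e, LinkType.cross) else
    if k = p then some (f, LinkType.cross) else getElem? c k
  weight : loopWeight β u θ (offEdge e c') = loopWeight β u θ (offEdge e c)
  perm : c'.Perm c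

/-- In both positions of the second cross the pair can be erased, with the same result. -/
theorem loopWeight_move_cross (a b b' d : LinkConfig G) (f : G.edgeSet)
    (hb : ∀ l ∈ b, ¬ Near l.1 f) (hb' : ∀ l ∈ b', ¬ Near l.1 f) :
    loopWeight β u θ (a ++ (f, LinkType.cross) :: b ++ (f, LinkType.cross) :: (b' ++ d)) =
      loopWeight β u θ (a ++ (f, LinkType.cross) :: (b ++ b') ++ (f, LinkType.cross) :: d) := by
  have hperm : (a ++ (f, LinkType.cross) :: b ++ (f, LinkType.cross) :: (b' ++ d)).Perm
      (a ++ (f, LinkType.cross) :: (b ++ b') ++ (f, LinkType.cross) :: d) := by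
    simp only [List.append_assoc, List.cons_append]
    refine List.Perm.append_left _ (List.Perm.cons _ (List.Perm.append_left _ ?_))
    exact List.perm_middle.symm
  have hloops : numLoops (a ++ (f, LinkType.cross) :: b ++ (f, LinkType.cross) :: (b' ++ d)) =
      numLoops (a ++ (f, LinkType.cross) :: (b ++ b') ++ (f, LinkType.cross) :: d) := by
    rw [numLoops_append_cross_pair, numLoops_append_cross_pair]
    · simp only [List.append_assoc]
    · intro l hl v h1 h2
      rcases List.mem_append.1 hl with hl | hl
      · exact hb l hl ⟨v, h1, h2⟩
      · exact hb' l hl ⟨v, h1, h2⟩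
    · exact fun l hl v h1 h2 => hb l hl ⟨v, h1, h2⟩
  rw [loopWeight, loopWeight, hperm.countP_eq, hperm.countP_eq, hperm.length_eq, hloops]

theorem getElem?_append_cons_congr {α : Type*} (a b : List α) (x y : α) {k : ℕ}
    (hk : k ≠ a.length) : getElem? (a ++ x :: b) k = getElem? (a ++ y :: b) k := by
  rw [List.getElem?_append, List.getElem?_append, List.getElem?_cons, List.getElem?_cons]
  split_ifs <;> first | rfl | omega

theorem getElem?_append_cons_self {α : Type*} (a b : List α) (x : α) :
    getElem? (a ++ x :: b) a.length = some x := by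
  rw [List.getElem?_append_right le_rfl, Nat.sub_self]
  rfl

theorem exists_isSwap (β u θ : ℝ) {e f : G.edgeSet} {v : V} {c : LinkConfig G} {p i j : ℕ}
    (mark : getElem? c p = some (e, LinkType.cross))
    (mark_unique : ∀ k l, getElem? c k = some l → l.1 = e → k = p)
    (pair : IsCrossPair c f i j) (lt_mark : i < p) (mark_lt : p < j) (mem : v ∈ (f : Sym2 V))
    (ne : f ≠ e) (near : Near f e)
    (between : ∀ k l, i < k → k < j → getElem? c k = some l → l.1 ≠ e → ¬ Near l.1 f) :
    ∃ c', IsSwap (β := β) (u := u) (θ := θ) e v c c' f p i j := by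
  set E : G.edgeSet × LinkType := (e, LinkType.cross)
  set X : G.edgeSet × LinkType := (f, LinkType.cross)
  obtain ⟨r, b', d, hc, hr, hj⟩ := exists_append_of_getElem? mark_lt mark pair.right
  obtain ⟨a, b, d', hc', ha, hp⟩ := exists_append_of_getElem? lt_mark pair.left mark
  have hr' : r = a ++ X :: b := by
    have h1 : c.take p = r := by
      rw [hc, List.append_assoc]
      exact List.take_left' hr
    have h2 : c.take p = a ++ X :: b := by
      rw [hc']
      exact List.take_left' (by simp; omega)
    rw [← h1, h2]
  subst hr'
  refine ⟨a ++ X :: b ++ X :: b' ++ E :: d, mark, mark_unique, pair, lt_mark, mark_lt, mem, ne,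
    near, between, ?_, ?_, ?_⟩
  · intro k
    have hj' : (a ++ X :: b ++ X :: b').length = j := by
      rw [← hj]; simp; omega
    split_ifs with h1 h2
    · rw [h1, ← hj']
      exact getElem?_append_cons_self _ _ _
    · rw [h2, ← hr]
      rw [List.append_assoc (a ++ X :: b)]
      exact getElem?_append_cons_self _ _ _
    · rw [hc, getElem?_append_cons_congr _ _ E X (by rw [hj']; exact h1),
        List.append_assoc (a ++ X :: b), List.append_assoc (a ++ X :: b), List.cons_append,
        List.cons_append]
      exact getElem?_append_cons_congr _ _ _ _ (by rw [hr]; exact h2)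
  · have hX : X.1 ≠ e := ne
    have hbb : ∀ l ∈ offEdge e b, ¬ Near l.1 f := by
      intro l hl
      rw [mem_offEdge] at hl
      obtain ⟨k, hk⟩ := List.mem_iff_getElem?.1 hl.1
      have hk' := (List.getElem?_eq_some_iff.1 hk).1
      refine between (a.length + 1 + k) l (by omega) (by omega) ?_ hl.2
      rw [hc', List.append_assoc, List.getElem?_append_right (by omega), List.cons_append,
        show a.length + 1 + k - a.length = k + 1 by omega, List.getElem?_cons_succ,
        List.getElem?_append_left hk', hk]
    have hbb' : ∀ l ∈ offEdge e b', ¬ Near l.1 f := by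
      intro l hl
      rw [mem_offEdge] at hl
      obtain ⟨k, hk⟩ := List.mem_iff_getElem?.1 hl.1
      have hk' := (List.getElem?_eq_some_iff.1 hk).1
      refine between ((a ++ X :: b).length + 1 + k) l (by omega) (by omega) ?_ hl.2
      rw [hc, List.append_assoc, List.getElem?_append_right (by omega), List.cons_append,
        show (a ++ X :: b).length + 1 + k - (a ++ X :: b).length = k + 1 by omega,
        List.getElem?_cons_succ, List.getElem?_append_left hk', hk]
    have e1 : offEdge e (a ++ X :: b ++ X :: b' ++ E :: d) =
        offEdge e a ++ X :: offEdge e b ++ X :: (offEdge e b' ++ offEdge e d) := by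
      simp only [offEdge_append, offEdge_cons_of_ne hX, List.append_assoc, List.cons_append]
      rw [offEdge_cons_self]
    have e2 : offEdge e c =
        offEdge e a ++ X :: (offEdge e b ++ offEdge e b') ++ X :: offEdge e d := by
      rw [hc]
      change offEdge e (a ++ X :: b ++ E :: b' ++ X :: d) = _
      simp only [offEdge_append, offEdge_cons_of_ne hX, List.append_assoc, List.cons_append]
      rw [offEdge_cons_self, offEdge_append, offEdge_cons_of_ne hX]
    rw [e1, e2]
    exact loopWeight_move_cross _ _ _ _ _ hbb hbb'
  · rw [hc, List.append_assoc (a ++ X :: b), List.append_assoc (a ++ X :: b)]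
    refine List.Perm.append_left _ ?_
    simp only [List.cons_append]
    refine (List.Perm.cons _ List.perm_middle).trans ((List.Perm.swap _ _ _).trans ?_)
    exact List.Perm.cons _ List.perm_middle.symm

/-- Shifting the second cross of `f` through a stretch free of adjacent links changes no status. A
cross of `f` could newly separate an adjacent edge `g` only if its first cross, which has not moved,
separated `g` already, or if a cross of `g` lay in that stretch. -/
theorem IsBlockingIgnoring.congr_pair {e f g : G.edgeSet} (hg : g ≠ e) {c c' : LinkConfig G}
    {i q q' : ℕ} (hcc : ∀ (k : ℕ) (l : G.edgeSet × LinkType), l.1 ≠ e → l.1 ≠ f → (getElem? c k = some l ↔ getElem? c' k = some l))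
    (hp : IsCrossPair c f i q) (hp' : IsCrossPair c' f i q')
    (hb : ∀ (k : ℕ) (l : G.edgeSet × LinkType), i < k → k < max q q' → getElem? c k = some l → l.1 ≠ e → l.1 ≠ f → ¬ Near l.1 f)
    (h : IsBlockingIgnoring {e} c g) : IsBlockingIgnoring {e} c' g := by
  by_cases hgf : g = f
  · subst hgf
    refine ⟨i, q', hp', fun k l h1 h2 hk hl => ?_⟩
    have hl1 : l.1 ≠ g := by
      intro hl1
      have := hp'.eq_or k l hk hl1
      omega
    exact hb k l h1 (lt_max_of_lt_right h2) ((hcc k l hl hl1).2 hk) hl hl1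
  · obtain ⟨a, b, hab, hbt⟩ := h
    have hab' : IsCrossPair c' g a b := by
      refine ⟨hab.lt, (hcc _ _ hg hgf).1 hab.left, (hcc _ _ hg hgf).1 hab.right, fun k l hk hl => ?_⟩
      exact hab.eq_or k l ((hcc _ _ (hl ▸ hg) (hl ▸ hgf)).2 hk) hl
    refine ⟨a, b, hab', fun k l h1 h2 hk hl hn => ?_⟩
    by_cases hlf : l.1 = f
    · have hfe : f ≠ e := by rw [← hlf]; exact hl
      rw [hlf] at hn
      have hi : ¬ (a < i ∧ i < b) := fun h => hbt i _ h.1 h.2 hp.left hfe hn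
      have hlt' := hp'.lt
      have hai : a ≠ i := by
        rintro rfl
        have := hp.left
        rw [hab.left] at this
        cases this
        exact hgf rfl
      rcases hp'.eq_or k l hk hlf with rfl | rfl
      · exact hi ⟨h1, h2⟩
      · exact hb a _ (by omega) (lt_max_of_lt_right h1) hab.left hg hgf hn.symm
    · exact hbt k l h1 h2 ((hcc k l hl hlf).2 hk) hl hn

section

variable {e f : G.edgeSet} {v : V} {c c' : LinkConfig G} {p i j : ℕ}

theorem IsSwap.get_iff (h : IsSwap (β := β) (u := u) (θ := θ) e v c c' f p i j) (k : ℕ)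
    (l : G.edgeSet × LinkType) (hle : l.1 ≠ e) (hlf : l.1 ≠ f) :
    getElem? c k = some l ↔ getElem? c' k = some l := by
  rw [h.get]
  split_ifs with h1 h2
  · rw [h1, h.pair.right]
    constructor
    · intro h; cases h; exact absurd rfl hlf
    · intro h; cases h; exact absurd rfl hle
  · rw [h2, h.mark]
    constructor
    · intro h; cases h; exact absurd rfl hle
    · intro h; cases h; exact absurd rfl hlf
  · rfl

theorem IsSwap.pair' (h : IsSwap (β := β) (u := u) (θ := θ) e v c c' f p i j) :
    IsCrossPair c' f i p := by
  have h1 := h.lt_mark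
  have h2 := h.mark_lt
  refine ⟨h1, ?_, ?_, fun k l hk hl => ?_⟩
  · rw [h.get, if_neg (by omega), if_neg (by omega), h.pair.left]
  · rw [h.get, if_neg (by omega), if_pos rfl]
  · rw [h.get] at hk
    split_ifs at hk with h3 h4
    · cases hk
      exact absurd hl.symm h.ne
    · exact Or.inr h4
    · rcases h.pair.eq_or k l hk hl with h5 | h5
      · exact Or.inl h5
      · exact absurd h5 h3

theorem IsSwap.mark' (h : IsSwap (β := β) (u := u) (θ := θ) e v c c' f p i j) :
    getElem? c' j = some (e, LinkType.cross) := by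
  rw [h.get, if_pos rfl]

theorem IsSwap.mark_unique' (h : IsSwap (β := β) (u := u) (θ := θ) e v c c' f p i j) (k : ℕ)
    (l : G.edgeSet × LinkType) (hk : getElem? c' k = some l) (hl : l.1 = e) : k = j := by
  rw [h.get] at hk
  split_ifs at hk with h3 h4
  · exact h3
  · cases hk
    exact absurd hl h.ne
  · exact absurd (h.mark_unique k l hk hl) h4

theorem IsSwap.isBlockingIgnoring_iff (h : IsSwap (β := β) (u := u) (θ := θ) e v c c' f p i j)
    {g : G.edgeSet} (hg : g ≠ e) :
    IsBlockingIgnoring {e} c' g ↔ IsBlockingIgnoring {e} c g := by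
  have h2 := h.mark_lt
  have hb : ∀ k l, i < k → k < j → getElem? c k = some l → l.1 ≠ e → l.1 ≠ f → ¬ Near l.1 f :=
    fun k l h1 h2 h3 h4 _ => h.between k l h1 h2 h3 h4
  constructor
  · refine IsBlockingIgnoring.congr_pair hg (fun k l h1 h2 => (h.get_iff k l h1 h2).symm) h.pair'
      h.pair fun k l h1 h2 h3 h4 h5 => ?_
    exact hb k l h1 (by omega) ((h.get_iff k l h4 h5).2 h3) h4 h5
  · refine IsBlockingIgnoring.congr_pair hg h.get_iff h.pair h.pair' fun k l h1 h2 h3 h4 h5 => ?_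
    exact hb k l h1 (by omega) h3 h4 h5

/-- The swap can be read off from `c'`: `j` is the position of the only link on `e`, and `p` is the
last position before `j` with a link at `v`. It is essential that `v` is fixed in advance, while `f`
is not. -/
theorem IsSwap.injective {c₁ c₂ : LinkConfig G} {f₁ f₂ : G.edgeSet} {p₁ p₂ i₁ i₂ j₁ j₂ : ℕ}
    (h₁ : IsSwap (β := β) (u := u) (θ := θ) e v c₁ c' f₁ p₁ i₁ j₁)
    (h₂ : IsSwap (β := β) (u := u) (θ := θ) e v c₂ c' f₂ p₂ i₂ j₂) : c₁ = c₂ := by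
  have hj : j₁ = j₂ := h₂.mark_unique' _ _ h₁.mark' rfl
  subst hj
  have key : ∀ {c₁ c₂ : LinkConfig G} {f₁ f₂ : G.edgeSet} {p₁ p₂ i₁ i₂ : ℕ},
      IsSwap (β := β) (u := u) (θ := θ) e v c₁ c' f₁ p₁ i₁ j₁ →
      IsSwap (β := β) (u := u) (θ := θ) e v c₂ c' f₂ p₂ i₂ j₁ → ¬ p₁ < p₂ := by
    intro c₁ c₂ f₁ f₂ p₁ p₂ i₁ i₂ h₁ h₂ hlt
    have h3 := h₂.pair'.right
    have h4 := h₂.mark_lt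
    have h5 := h₁.lt_mark
    rw [h₁.get, if_neg (by omega), if_neg (by omega)] at h3
    exact h₁.between _ _ (by omega) h4 h3 h₂.ne ⟨v, h₂.mem, h₁.mem⟩
  have hp : p₁ = p₂ := le_antisymm (not_lt.1 (key h₂ h₁)) (not_lt.1 (key h₁ h₂))
  subst hp
  have hf : f₁ = f₂ := by
    have h3 := h₁.pair'.right
    rw [h₂.pair'.right] at h3
    cases h3
    rfl
  subst hf
  refine List.ext_getElem? fun k => ?_
  by_cases hkp : k = p₁
  · rw [hkp, h₁.mark, h₂.mark]
  by_cases hkj : k = j₁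
  · rw [hkj, h₁.pair.right, h₂.pair.right]
  · have h3 := h₁.get k
    rw [h₂.get k, if_neg hkj, if_neg hkp, if_neg hkj, if_neg hkp] at h3
    exact h3.symm

end

/-- The configurations with exactly one link on `e`, a cross, and the given pattern once this link
is removed. -/
def markedSet (F : Finset G.edgeSet) (e : G.edgeSet) (B : Set G.edgeSet) : Set (LinkConfig G) :=
  {c | offEdge e c ∈ loosePatternSet F e B ∅ ∧ ∃ p : ℕ, getElem? c p = some (e, LinkType.cross) ∧
    ∀ (k : ℕ) (l : G.edgeSet × LinkType), getElem? c k = some l → l.1 = e → k = p}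

/-- The marked configurations whose link on `e` does not interfere with a blocking edge. -/
def uncoveredSet (F : Finset G.edgeSet) (e : G.edgeSet) (B : Set G.edgeSet) :
    Set (LinkConfig G) :=
  {c | c ∈ markedSet F e B ∧ ∀ f ∈ F, f ≠ e → f ∈ B → IsBlocking c f}

/-- The marked configurations whose link on `e` interferes with an otherwise blocking edge
at `v`. -/
def coveredSet (F : Finset G.edgeSet) (e : G.edgeSet) (B : Set G.edgeSet) (v : V) :
    Set (LinkConfig G) :=
  {c | c ∈ markedSet F e B ∧ ∃ f ∈ F, f ≠ e ∧ f ∈ B ∧ v ∈ (f : Sym2 V) ∧ ¬ IsBlocking c f}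

open Classical in
/-- The number of blocking edges adjacent to `e` with a link after the link on `e`. -/
noncomputable def coverRank (F : Finset G.edgeSet) (e : G.edgeSet) (B : Set G.edgeSet)
    (c : LinkConfig G) : ℕ :=
  ((adjacentIn F e).filter fun f => f ∈ B ∧ ∃ (p k : ℕ) (t t' : LinkType), p < k ∧ getElem? c p = some (e, t) ∧
    getElem? c k = some (f, t')).card

/-- The weight of a marked configuration. -/
noncomputable def markedWt (β u θ : ℝ) (e : G.edgeSet) (c : LinkConfig G) : ℝ≥0∞ :=
  wt β u θ (offEdge e c) / c.length

theorem isBlockingIgnoring_iff_of_mem_markedSet {F : Finset G.edgeSet} {e f : G.edgeSet}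
    {B : Set G.edgeSet} {c : LinkConfig G} (hc : c ∈ markedSet F e B) (hf : f ∈ F) (hfe : f ≠ e) :
    IsBlockingIgnoring {e} c f ↔ f ∈ B := by
  rw [← isBlocking_offEdge hfe]
  refine ⟨fun h => ?_, (hc.1.2 f hf hfe).1⟩
  rcases (hc.1.2 f hf hfe).2 h with h | h
  · exact h
  · exact absurd h (Set.notMem_empty f)

theorem exists_isSwap_of_mem_coveredSet (β u θ : ℝ) {F : Finset G.edgeSet} {e : G.edgeSet}
    {B : Set G.edgeSet} {v : V} {c : LinkConfig G} (hc : c ∈ coveredSet F e B v) :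
    ∃ c' f p i j, f ∈ F ∧ f ∈ B ∧ IsSwap (β := β) (u := u) (θ := θ) e v c c' f p i j := by
  obtain ⟨hm, f, hfF, hfe, hfB, hv, hnb⟩ := hc
  obtain ⟨p, hp, hpu⟩ := hm.2
  obtain ⟨i, j, hpair, hb⟩ := (isBlockingIgnoring_iff_of_mem_markedSet hm hfF hfe).2 hfB
  have : ∃ k l, i < k ∧ k < j ∧ getElem? c k = some l ∧ Near l.1 f := by
    by_contra! hcon
    exact hnb (isBlocking_iff.2 ⟨i, j, hpair, hcon⟩)
  obtain ⟨k, l, h1, h2, h3, h4⟩ := this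
  have hl : l.1 = e := by
    by_contra hl
    exact hb k l h1 h2 h3 hl h4
  obtain rfl := hpu k l h3 hl
  obtain ⟨c', hc'⟩ := exists_isSwap β u θ hp hpu hpair h1 h2 hv hfe (hl ▸ h4.symm) hb
  exact ⟨c', f, k, i, j, hfF, hfB, hc'⟩

theorem IsSwap.mem_markedSet {F : Finset G.edgeSet} {e f : G.edgeSet} {B : Set G.edgeSet} {v : V}
    {c c' : LinkConfig G} {p i j : ℕ} (h : IsSwap (β := β) (u := u) (θ := θ) e v c c' f p i j)
    (hc : c ∈ markedSet F e B) : c' ∈ markedSet F e B := by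
  refine ⟨⟨fun g => ?_, fun g hg hge => ?_⟩, j, h.mark', h.mark_unique'⟩
  · rw [← hc.1.1 g]
    simp only [mem_offEdge, h.perm.mem_iff]
  · rw [isBlocking_offEdge hge, h.isBlockingIgnoring_iff hge, ← isBlocking_offEdge hge]
    exact hc.1.2 g hg hge

/-- The edge `f` no longer encloses the mark. Another edge of `B` at `v` enclosing position `j`
would have enclosed the second cross of `f` before the swap, which is impossible since they share
`v`. So after a swap the mark can be covered only from the other end point. -/
theorem IsSwap.notMem_coveredSet {F : Finset G.edgeSet} {e f : G.edgeSet} {B : Set G.edgeSet}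
    {v : V} {c c' : LinkConfig G} {p i j : ℕ}
    (h : IsSwap (β := β) (u := u) (θ := θ) e v c c' f p i j) (hc : c ∈ markedSet F e B) :
    c' ∉ coveredSet F e B v := by
  intro hc'
  obtain ⟨_, g, p', a, b, hgF, hgB, h'⟩ := exists_isSwap_of_mem_coveredSet β u θ hc'
  obtain rfl : p' = j := h.mark_unique' _ _ h'.mark rfl
  have h1 := h'.lt_mark
  have h2 := h'.mark_lt
  by_cases hgf : g = f
  · subst hgf
    have := (h'.pair.unique h.pair').2
    have := h.mark_lt
    omega
  · obtain ⟨a', b', hp, hb⟩ := (isBlockingIgnoring_iff_of_mem_markedSet hc hgF h'.ne).2 hgB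
    have hp2 : IsCrossPair c' g a' b' := by
      refine ⟨hp.lt, (h.get_iff _ _ h'.ne hgf).1 hp.left, (h.get_iff _ _ h'.ne hgf).1 hp.right,
        fun k l hk hl => ?_⟩
      exact hp.eq_or k l ((h.get_iff k l (hl ▸ h'.ne) (hl ▸ hgf)).2 hk) hl
    obtain ⟨rfl, rfl⟩ := hp2.unique h'.pair
    exact hb _ _ h1 h2 h.pair.right h.ne ⟨v, h.mem, h'.mem⟩

/-- The mark moves to a later position, so no edge is gained, and both links on `f` are now before
it. -/
theorem IsSwap.coverRank_lt {F : Finset G.edgeSet} {e f : G.edgeSet} {B : Set G.edgeSet}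
    {v : V} {c c' : LinkConfig G} {p i j : ℕ}
    (h : IsSwap (β := β) (u := u) (θ := θ) e v c c' f p i j) (hf : f ∈ F) (hfB : f ∈ B) :
    coverRank F e B c' < coverRank F e B c := by
  classical
  unfold coverRank
  refine Finset.card_lt_card (Finset.ssubset_iff_of_subset ?_ |>.2 ⟨f, ?_, ?_⟩)
  · intro g hg
    rw [Finset.mem_filter] at hg ⊢
    obtain ⟨hg1, hgB, p', k, t, t', hpk, h1, h2⟩ := hg
    refine ⟨hg1, hgB, p, k, _, t', ?_, h.mark, ?_⟩
    · have := h.mark_unique' _ _ h1 rfl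
      have := h.mark_lt
      omega
    · have h3 := h.mark_unique' _ _ h1 rfl
      have h4 := h.mark_lt
      rwa [h.get, if_neg (by omega), if_neg (by omega)] at h2
  · rw [Finset.mem_filter]
    exact ⟨mem_adjacentIn.2 ⟨hf, h.ne, h.near⟩, hfB, p, j, _, _, h.mark_lt, h.mark, h.pair.right⟩
  · rw [Finset.mem_filter]
    rintro ⟨-, -, p', k, t, t', hpk, h1, h2⟩
    have h3 := h.mark_unique' _ _ h1 rfl
    have h4 := h.mark_lt
    have h5 := h.lt_mark
    have := h.pair'.eq_or _ _ h2 rfl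
    omega

/-- One swap maps the configurations covered at `x` injectively, with the same weight, to uncovered
ones or to ones covered at `y` of smaller rank. Hence the induction on the rank exchanges `x` and
`y`. -/
theorem sum_coveredSet_le (β u θ : ℝ) (F : Finset G.edgeSet) {e : G.edgeSet} (B : Set G.edgeSet)
    (r : ℕ) {x y : V} (he : (e : Sym2 V) = s(x, y)) :
    ∑' c, (coveredSet F e B x ∩ {c | coverRank F e B c ≤ r}).indicator (markedWt β u θ e) c ≤
      r * ∑' c, (uncoveredSet F e B).indicator (markedWt β u θ e) c := by
  induction r generalizing x y with
  | zero =>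
    have : coveredSet F e B x ∩ {c | coverRank F e B c ≤ 0} = ∅ := by
      refine Set.eq_empty_of_forall_notMem ?_
      rintro c ⟨hc, hr⟩
      obtain ⟨c', f, p, i, j, hf, hfB, h⟩ := exists_isSwap_of_mem_coveredSet β u θ hc
      have := h.coverRank_lt hf hfB
      have hr' : coverRank F e B c ≤ 0 := hr
      omega
    rw [this]
    simp
  | succ r ih =>
    have hex : ∀ c ∈ coveredSet F e B x ∩ {c | coverRank F e B c ≤ r + 1}, ∃ c' f p i j,
        f ∈ F ∧ f ∈ B ∧ IsSwap (β := β) (u := u) (θ := θ) e x c c' f p i j :=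
      fun c hc => exists_isSwap_of_mem_coveredSet β u θ hc.1
    have : Nonempty G.edgeSet := ⟨e⟩
    choose! φ f p i j hf hfB hsw using hex
    calc _ ≤ ∑' c, (uncoveredSet F e B ∪ (coveredSet F e B y ∩ {c | coverRank F e B c ≤ r})).indicator
          (markedWt β u θ e) c := by
          refine tsum_indicator_le_of_injOn φ ?_ ?_ ?_
          · intro c hc
            have h := hsw c hc
            have hm := h.mem_markedSet hc.1.1
            have hn := h.notMem_coveredSet hc.1.1
            have hr : coverRank F e B (φ c) ≤ r := by
              have h1 := h.coverRank_lt (hf c hc) (hfB c hc)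
              have h2 : coverRank F e B c ≤ r + 1 := hc.2
              omega
            by_cases hu : φ c ∈ uncoveredSet F e B
            · exact Or.inl hu
            refine Or.inr ⟨⟨hm, ?_⟩, hr⟩
            have : ∃ g ∈ F, g ≠ e ∧ g ∈ B ∧ ¬ IsBlocking (φ c) g := by
              by_contra! hcon
              exact hu ⟨hm, hcon⟩
            obtain ⟨g, hg, hge, hgB, hgb⟩ := this
            refine ⟨g, hg, hge, hgB, ?_, hgb⟩
            have hgn : Near g e := by
              by_contra hgn
              refine hgb ((isBlocking_offEdge_of_not_near hgn).1 ?_)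
              exact (hm.1.2 g hg hge).1 hgB
            obtain ⟨w, hw1, hw2⟩ := hgn
            rw [he, Sym2.mem_iff] at hw2
            rcases hw2 with rfl | rfl
            · exact absurd ⟨hm, g, hg, hge, hgB, hw1, hgb⟩ hn
            · exact hw1
          · intro c₁ h₁ c₂ h₂ heq
            have s1 := hsw c₁ h₁
            have s2 := hsw c₂ h₂
            rw [heq] at s1
            exact s1.injective s2
          · intro c hc
            have h := hsw c hc
            rw [markedWt, markedWt, wt, wt, h.weight, h.perm.length_eq]
      _ ≤ _ := by
          refine (tsum_indicator_union_le _ _ _).trans ?_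
          rw [Nat.cast_add, Nat.cast_one, add_mul, one_mul, add_comm]
          gcongr
          exact ih (x := y) (y := x) (by rw [he, Sym2.eq_swap])

/-- The constant is 1 + 2(2K - 2): the uncovered part, and for each end point of `e` a rank of at
most 2K - 2. -/
theorem sum_markedSet_le [Fintype V] [DecidableRel G.Adj] {K : ℕ} (hK : G.maxDegree ≤ K)
    (β u θ : ℝ) (F : Finset G.edgeSet) (e : G.edgeSet) (B : Set G.edgeSet) :
    ∑' c, (markedSet F e B).indicator (markedWt β u θ e) c ≤
      ((4 * K - 3 : ℕ) : ℝ≥0∞) * ∑' c, (uncoveredSet F e B).indicator (markedWt β u θ e) c := by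
  obtain ⟨x, y, he⟩ : ∃ x y, (e : Sym2 V) = s(x, y) := by
    induction h : (e : Sym2 V) using Sym2.ind with | _ x y => exact ⟨x, y, rfl⟩
  have hcard := card_adjacentIn_le hK F e
  set r := (adjacentIn F e).card
  have hr : ∀ c, coverRank F e B c ≤ r := fun c => by
    classical
    unfold coverRank
    exact Finset.card_filter_le _ _
  have hsub : markedSet F e B ⊆ uncoveredSet F e B ∪
      ((coveredSet F e B x ∩ {c | coverRank F e B c ≤ r}) ∪
        (coveredSet F e B y ∩ {c | coverRank F e B c ≤ r})) := by
    intro c hm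
    by_cases hu : c ∈ uncoveredSet F e B
    · exact Or.inl hu
    right
    have : ∃ g ∈ F, g ≠ e ∧ g ∈ B ∧ ¬ IsBlocking c g := by
      by_contra! hcon
      exact hu ⟨hm, hcon⟩
    obtain ⟨g, hg, hge, hgB, hgb⟩ := this
    have hgn : Near g e := by
      by_contra hgn
      exact hgb ((isBlocking_offEdge_of_not_near hgn).1 ((hm.1.2 g hg hge).1 hgB))
    obtain ⟨w, hw1, hw2⟩ := hgn
    rw [he, Sym2.mem_iff] at hw2
    rcases hw2 with rfl | rfl
    · exact Or.inl ⟨⟨hm, g, hg, hge, hgB, hw1, hgb⟩, hr c⟩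
    · exact Or.inr ⟨⟨hm, g, hg, hge, hgB, hw1, hgb⟩, hr c⟩
  refine (tsum_indicator_mono _ hsub).trans ((tsum_indicator_union_le _ _ _).trans ?_)
  have h1 := sum_coveredSet_le β u θ F B r he
  have h2 := sum_coveredSet_le β u θ F B r (x := y) (y := x) (by rw [he, Sym2.eq_swap])
  refine (add_le_add le_rfl ((tsum_indicator_union_le _ _ _).trans (add_le_add h1 h2))).trans ?_
  rw [← add_mul, ← one_add_mul]
  gcongr
  norm_cast
  omega

end Swap

/-! ### Inserting a blocking pair of crosses on `e` -/

section Insertion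

/-- Cauchy–Schwarz over the at most M + 1 fibres of γ bounds the ordered pairs with equal γ. The
linear term counts the diagonal, which is in both halves p ≤ q and q ≤ p. -/
theorem sq_card_add_le_card_pairs (s : Finset ℕ) (γ : ℕ → ℕ) (M : ℕ) (hγ : ∀ p ∈ s, γ p ≤ M) :
    s.card ^ 2 + (M + 1) * s.card ≤
      2 * (M + 1) * ((s ×ˢ s).filter fun a => a.1 ≤ a.2 ∧ γ a.1 = γ a.2).card := by
  set Q := (s ×ˢ s).filter fun a => γ a.1 = γ a.2 with hQ
  set P := (s ×ˢ s).filter fun a => a.1 ≤ a.2 ∧ γ a.1 = γ a.2 with hP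
  set P' := (s ×ˢ s).filter fun a => a.2 ≤ a.1 ∧ γ a.1 = γ a.2 with hP'
  have h1 : P'.card = P.card := by
    refine Finset.card_bij (fun a _ => a.swap) ?_ ?_ ?_
    · intro a ha
      simp only [hP, hP', Finset.mem_filter, Finset.mem_product, Prod.fst_swap,
        Prod.snd_swap] at ha ⊢
      exact ⟨⟨ha.1.2, ha.1.1⟩, ha.2.1, ha.2.2.symm⟩
    · intro a _ b _ h
      exact Prod.swap_injective h
    · intro a ha
      refine ⟨a.swap, ?_, Prod.swap_swap a⟩
      simp only [hP, hP', Finset.mem_filter, Finset.mem_product, Prod.fst_swap,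
        Prod.snd_swap] at ha ⊢
      exact ⟨⟨ha.1.2, ha.1.1⟩, ha.2.1, ha.2.2.symm⟩
  have h2 : P ∪ P' = Q := by
    ext a
    simp only [hP, hP', hQ, Finset.mem_union, Finset.mem_filter]
    have := le_total a.1 a.2
    tauto
  have h3 : (P ∩ P').card = s.card := by
    symm
    refine Finset.card_bij (fun p _ => (p, p)) ?_ ?_ ?_
    · intro p hp
      simp [hP, hP', hp]
    · intro p _ q _ h
      exact congrArg Prod.fst h
    · rintro ⟨p, q⟩ ha
      simp only [hP, hP', Finset.mem_inter, Finset.mem_filter, Finset.mem_product] at ha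
      exact ⟨p, ha.1.1.1, by rw [le_antisymm ha.1.2.1 ha.2.2.1]⟩
  have h4 := Finset.card_union_add_card_inter P P'
  rw [h2, h3, h1] at h4
  have h5 : Q.card = ∑ j ∈ Finset.range (M + 1), (s.filter fun p => γ p = j).card ^ 2 := by
    rw [Finset.card_eq_sum_card_fiberwise (f := fun a => γ a.1) (t := Finset.range (M + 1))]
    · refine Finset.sum_congr rfl fun j _ => ?_
      rw [sq, ← Finset.card_product]
      congr 1
      ext a
      simp only [hQ, Finset.mem_filter, Finset.mem_product]
      constructor
      · rintro ⟨⟨⟨h1, h2⟩, h3⟩, h4⟩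
        exact ⟨⟨h1, h4⟩, h2, h3 ▸ h4⟩
      · rintro ⟨⟨h1, h4⟩, h2, h3⟩
        exact ⟨⟨⟨h1, h2⟩, h4.trans h3.symm⟩, h4⟩
    · intro a ha
      simp only [hQ, Finset.coe_filter, Finset.mem_product] at ha
      have := hγ a.1 ha.1.1
      simp only [Finset.coe_range, Set.mem_Iio]
      omega
  have h6 : s.card = ∑ j ∈ Finset.range (M + 1), (s.filter fun p => γ p = j).card := by
    refine Finset.card_eq_sum_card_fiberwise fun p hp => ?_
    have := hγ p hp
    simp only [Finset.coe_range, Set.mem_Iio]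
    omega
  have h7 : s.card ^ 2 ≤ (M + 1) * Q.card := by
    have := sq_sum_le_card_mul_sum_sq (s := Finset.range (M + 1))
      (f := fun j => ((s.filter fun p => γ p = j).card : ℤ))
    rw [Finset.card_range, ← Nat.cast_sum, ← h6] at this
    rw [h5]
    exact_mod_cast this
  nlinarith

/-- Cauchy–Schwarz in the linearised form 2rA ≤ A²/g + r²g, with A = a/(n+1): it can be summed over
configurations, and `r` is optimised only afterwards. The diagonal term g·a makes up for n + 2 in
place of n + 1. -/
theorem two_mul_mul_div_le {a P n g : ℕ} {r : ℝ} (hg : 1 ≤ g) (ha : a ≤ n + 1)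
    (h : a ^ 2 + g * a ≤ 2 * g * P) :
    2 * r * (a / (n + 1 : ℝ)) ≤ 2 * (P / ((n + 1) * (n + 2) : ℝ)) + r ^ 2 * g := by
  have hg' : (0 : ℝ) < g := by exact_mod_cast hg
  have hg1 : (1 : ℝ) ≤ g := by exact_mod_cast hg
  have ha' : (a : ℝ) ≤ n + 1 := by exact_mod_cast ha
  have h' : (a : ℝ) ^ 2 + g * a ≤ 2 * g * P := by exact_mod_cast h
  have hn : (0 : ℝ) ≤ n := Nat.cast_nonneg n
  have ha0 : (0 : ℝ) ≤ a := Nat.cast_nonneg a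
  set A : ℝ := a / (n + 1) with hA
  have hAa : (a : ℝ) = A * (n + 1) := by rw [hA]; field_simp
  have hA0 : 0 ≤ A := by positivity
  have hA1 : A ≤ 1 := by rw [hA, div_le_one (by positivity)]; exact ha'
  have h1 : A ^ 2 / g ≤ 2 * (P / ((n + 1) * (n + 2) : ℝ)) := by
    rw [div_le_iff₀ hg', ← mul_div_assoc, div_mul_eq_mul_div, le_div_iff₀ (by positivity)]
    rw [hAa] at h'
    have h2 : A ^ 2 * ((n + 1) * (n + 2)) ≤ (A * (n + 1)) ^ 2 + g * (A * (n + 1)) := by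
      have : A * A * (n + 1) ≤ g * A * (n + 1) := by
        have := mul_le_mul (hA1.trans hg1) le_rfl hA0 hg'.le
        exact mul_le_mul_of_nonneg_right this (by positivity)
      nlinarith
    linarith
  have h2 : 2 * r * A ≤ A ^ 2 / g + r ^ 2 * g := by
    have h3 : A ^ 2 / g + r ^ 2 * g - 2 * r * A = (A - r * g) ^ 2 / g := by
      field_simp
      ring
    have : 0 ≤ (A - r * g) ^ 2 / g := by positivity
    linarith
  linarith

variable {V : Type*} {G : SimpleGraph V} {β u θ : ℝ}

/-- Emptying the edges one after the other costs a finite factor each time and ends at the empty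
configuration. -/
theorem mass_ne_top [Fintype V] (hβ : 0 ≤ β) (hu : 0 ≤ u) (hu1 : u ≤ 1) (hθ : 0 < θ)
    (S : Set (LinkConfig G)) : mass β u θ S ≠ ⊤ := by
  classical
  have key : ∀ D : Finset G.edgeSet, mass β u θ {c : LinkConfig G | ∀ l ∈ c, l.1 ∈ D} ≠ ⊤ := by
    intro D
    induction D using Finset.induction_on with
    | empty =>
      have : {c : LinkConfig G | ∀ l ∈ c, l.1 ∈ (∅ : Finset G.edgeSet)} = {[]} := by
        ext c
        simp only [Finset.notMem_empty, Set.mem_ofPred_eq, Set.mem_singleton_iff]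
        exact List.eq_nil_iff_forall_not_mem.symm
      rw [this, mass, tsum_eq_single []]
      · rw [Set.indicator_of_mem (Set.mem_singleton _)]
        exact ENNReal.ofReal_ne_top
      · intro c hc
        exact Set.indicator_of_notMem (by simpa using hc) _
    | insert e D he ih =>
      have h1 : {c : LinkConfig G | ∀ l ∈ c, l.1 ∈ insert e D} ⊆
          {c | offEdge e c ∈ {c : LinkConfig G | ∀ l ∈ c, l.1 ∈ D}} := by
        intro c hc l hl
        rw [mem_offEdge] at hl
        exact (Finset.mem_insert.1 (hc l hl.1)).resolve_left hl.2
      refine ne_top_of_le_ne_top ?_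
        ((mass_mono h1).trans (mass_offEdge_le hβ hu hu1 hθ e _))
      exact ENNReal.mul_ne_top ENNReal.ofReal_ne_top ih
  have : Finite G.edgeSet := Subtype.finite
  have : Fintype G.edgeSet := Fintype.ofFinite _
  exact ne_top_of_le_ne_top (key Finset.univ) (mass_mono fun c _ l _ => Finset.mem_univ _)

/-- The configuration with two crosses on `e` inserted at the positions `p ≤ q`. -/
def insertPair (e : G.edgeSet) (c : LinkConfig G) (p q : ℕ) : LinkConfig G :=
  c.take p ++ (e, LinkType.cross) :: (c.drop p).take (q - p) ++ (e, LinkType.cross) :: c.drop q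

theorem take_append_take_drop_append_drop {α : Type*} (c : List α) {p q : ℕ} (hpq : p ≤ q) :
    c.take p ++ (c.drop p).take (q - p) ++ c.drop q = c := by
  have h1 : c.take p ++ (c.drop p).take (q - p) = c.take q := by
    rw [← List.take_add]
    congr 1
    omega
  rw [h1, List.take_append_drop]

theorem insertIdx_eq_take_append {α : Type*} (c : List α) (p : ℕ) (hp : p ≤ c.length) (x : α) :
    c.insertIdx p x = c.take p ++ x :: c.drop p := by
  induction c generalizing p with
  | nil =>
    obtain rfl : p = 0 := by simpa using hp
    rfl
  | cons a c ih =>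
    cases p with
    | zero => rfl
    | succ p => simp [List.insertIdx_succ_cons, ih p (by simpa using hp)]

theorem eraseIdx_append_cons {α : Type*} (a b : List α) (x : α) :
    (a ++ x :: b).eraseIdx a.length = a ++ b := by
  rw [List.eraseIdx_append_of_length_le le_rfl, Nat.sub_self]
  rfl

theorem offEdge_insertIdx {e : G.edgeSet} {c : LinkConfig G} (hc : ∀ l ∈ c, l.1 ≠ e) {p : ℕ}
    (hp : p ≤ c.length) : offEdge e (c.insertIdx p (e, LinkType.cross)) = c := by
  rw [insertIdx_eq_take_append c p hp, offEdge_append, offEdge_cons_self, ← offEdge_append,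
    List.take_append_drop, offEdge_eq_self hc]

theorem getElem?_insertIdx_unique {e : G.edgeSet} {c : LinkConfig G} (hc : ∀ l ∈ c, l.1 ≠ e)
    {p : ℕ} (hp : p ≤ c.length) :
    getElem? (c.insertIdx p (e, LinkType.cross)) p = some (e, LinkType.cross) ∧
      ∀ (k : ℕ) (l : G.edgeSet × LinkType),
        getElem? (c.insertIdx p (e, LinkType.cross)) k = some l → l.1 = e → k = p := by
  constructor
  · rw [List.getElem?_insertIdx_self, if_pos hp]
  · intro k l hk hl
    rw [List.getElem?_insertIdx] at hk
    split_ifs at hk with h1 h2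
    · exact absurd hl (hc l (List.mem_of_getElem? hk))
    · exact h2
    · exact absurd hl (hc l (List.mem_of_getElem? hk))

theorem offEdge_insertPair {e : G.edgeSet} {c : LinkConfig G} (hc : ∀ l ∈ c, l.1 ≠ e) {p q : ℕ}
    (hpq : p ≤ q) : offEdge e (insertPair e c p q) = c := by
  rw [insertPair, offEdge_append, offEdge_append, offEdge_cons_self, offEdge_cons_self,
    ← offEdge_append, ← offEdge_append, take_append_take_drop_append_drop c hpq,
    offEdge_eq_self hc]

theorem eraseIdx_insertPair {e : G.edgeSet} {c : LinkConfig G} {p q : ℕ} (hpq : p ≤ q)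
    (hq : q ≤ c.length) :
    (insertPair e c p q).eraseIdx (q + 1) = c.insertIdx p (e, LinkType.cross) := by
  have h1 : q + 1 = (c.take p ++ (e, LinkType.cross) :: (c.drop p).take (q - p)).length := by
    simp; omega
  rw [insertPair, h1, eraseIdx_append_cons, insertIdx_eq_take_append c p (hpq.trans hq),
    List.append_assoc, List.cons_append]
  congr 2
  conv_rhs => rw [← List.take_append_drop (q - p) (c.drop p), List.drop_drop]
  congr 2
  omega

theorem isCrossPair_insertPair {e : G.edgeSet} {c : LinkConfig G} (hc : ∀ l ∈ c, l.1 ≠ e)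
    {p q : ℕ} (hpq : p ≤ q) (hq : q ≤ c.length) : IsCrossPair (insertPair e c p q) e p (q + 1) := by
  have h1 : (c.take p).length = p := by simp; omega
  have h2 : (c.take p).length + 1 + ((c.drop p).take (q - p)).length = q + 1 := by simp; omega
  refine ⟨by omega, ?_, ?_, fun k l hk hl => ?_⟩
  · have := getElem?_append_pair_left (c.take p) ((c.drop p).take (q - p)) (c.drop q)
      (e, LinkType.cross) (e, LinkType.cross)
    rwa [h1] at this
  · have := getElem?_append_pair_right (c.take p) ((c.drop p).take (q - p)) (c.drop q)
      (e, LinkType.cross) (e, LinkType.cross)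
    rwa [h2] at this
  · rcases getElem?_append_pair hk with h | h | h | h | h
    · exact absurd hl (hc l (List.mem_of_mem_take h.2))
    · exact Or.inl (h.1.trans h1)
    · exact absurd hl (hc l (List.mem_of_mem_drop (List.mem_of_mem_take h.2.2)))
    · exact Or.inr (h.1.trans h2)
    · exact absurd hl (hc l (List.mem_of_mem_drop h.2))

theorem isBlocking_insertPair {e : G.edgeSet} {c : LinkConfig G} (hc : ∀ l ∈ c, l.1 ≠ e)
    {p q : ℕ} (hb : ∀ l ∈ (c.drop p).take (q - p), ¬ Near l.1 e) :
    IsBlocking (insertPair e c p q) e := by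
  rw [← isBlockingIgnoring_empty, isBlockingIgnoring_iff_append]
  exact ⟨_, _, _, rfl, fun l hl => hc l (List.mem_of_mem_take hl),
    fun l hl => ⟨hc l (List.mem_of_mem_drop (List.mem_of_mem_take hl)), fun _ => hb l hl⟩,
    fun l hl => hc l (List.mem_of_mem_drop hl)⟩

/-- If `e` is blocking, one cross on `e` does not interfere more with another edge than both. -/
theorem IsBlocking.of_eraseIdx_isBlocking {c : LinkConfig G} {e f : G.edgeSet} {p q : ℕ}
    (he : IsBlocking c e) (hp : IsCrossPair c e p q) (hfe : f ≠ e)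
    (h : IsBlocking (c.eraseIdx q) f) : IsBlocking c f := by
  obtain ⟨i, j, hij, h' | ⟨h1, h2, h3⟩, hb⟩ := h.of_eraseIdx hp.right hfe.symm
  · exact h'
  obtain ⟨p', q', hp', hb'⟩ := isBlocking_iff.1 he
  obtain ⟨rfl, rfl⟩ := hp.unique hp'
  have hlt := hp.lt
  have hne : p ≠ i := by
    rintro rfl
    have := hp.left
    rw [hij.left] at this
    cases this
    exact hfe rfl
  rcases Nat.lt_or_ge i p with hi | hi
  · exact absurd h3 (hb p _ hi (by omega) (by omega) hp.left)
  · exact absurd h3.symm (hb' i _ (by omega) h1 hij.left)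

theorem loopWeight_insertPair {e : G.edgeSet} {c : LinkConfig G} {p q : ℕ} (hpq : p ≤ q)
    (hb : ∀ l ∈ (c.drop p).take (q - p), ¬ Near l.1 e) :
    loopWeight β u θ (insertPair e c p q) =
      loopWeight β u θ c * ((β * u) ^ 2 / ((c.length + 1) * (c.length + 2))) := by
  have hperm : (insertPair e c p q).Perm ((e, LinkType.cross) :: (e, LinkType.cross) :: c) := by
    conv_rhs => rw [← take_append_take_drop_append_drop c hpq]
    rw [insertPair]
    refine List.perm_middle.trans (List.Perm.cons _ ?_)
    rw [List.append_assoc, List.cons_append, List.append_assoc]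
    exact List.perm_middle
  have hloops : numLoops (insertPair e c p q) = numLoops c := by
    conv_rhs => rw [← take_append_take_drop_append_drop c hpq]
    rw [insertPair, numLoops_append_cross_pair]
    exact fun l hl v h1 h2 => hb l hl ⟨v, h1, h2⟩
  rw [loopWeight, loopWeight, hloops, hperm.countP_eq, hperm.countP_eq, hperm.length_eq]
  simp only [List.length_cons, Nat.factorial_succ, decide_true, List.countP_cons_of_pos,
    reduceCtorEq, decide_false, Bool.false_eq_true, not_false_eq_true, List.countP_cons_of_neg]
  push_cast
  have h1 : (0 : ℝ) < c.length + 1 := by positivity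
  have h2 : (0 : ℝ) < c.length + 2 := by positivity
  have h3 : (0 : ℝ) < c.length.factorial := by positivity
  field_simp
  ring

open Classical in
/-- The positions where a cross on `e` can be inserted without interfering with a blocking edge. -/
noncomputable def allowedPositions (F : Finset G.edgeSet) (e : G.edgeSet) (B : Set G.edgeSet)
    (c : LinkConfig G) : Finset ℕ :=
  (Finset.range (c.length + 1)).filter fun p =>
    c ∈ loosePatternSet F e B ∅ ∧ c.insertIdx p (e, LinkType.cross) ∈ uncoveredSet F e B

theorem mem_allowedPositions {F : Finset G.edgeSet} {e : G.edgeSet} {B : Set G.edgeSet}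
    {c : LinkConfig G} {p : ℕ} : p ∈ allowedPositions F e B c ↔ p ≤ c.length ∧
      c ∈ loosePatternSet F e B ∅ ∧ c.insertIdx p (e, LinkType.cross) ∈ uncoveredSet F e B := by
  simp only [allowedPositions, Finset.mem_filter, Finset.mem_range, Nat.lt_succ_iff]

theorem ne_of_mem_loosePatternSet {F : Finset G.edgeSet} {e : G.edgeSet} {B S : Set G.edgeSet}
    {c : LinkConfig G} (hc : c ∈ loosePatternSet F e B S) : ∀ l ∈ c, l.1 ≠ e :=
  fun l hl => ((hc.1 l.1).1 ⟨l, hl, rfl⟩).2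

/-- Spread the weight of a configuration of length n equally over its n + 1 insertions of a cross on
`e`; the marked configuration has length n + 1, whence the division in `markedWt`. -/
theorem mass_le_sum_markedSet (β u θ : ℝ) (F : Finset G.edgeSet) (e : G.edgeSet)
    (B : Set G.edgeSet) :
    mass β u θ (loosePatternSet F e B ∅) ≤
      ∑' c, (markedSet F e B).indicator (markedWt β u θ e) c := by
  classical
  let s : LinkConfig G → Finset ℕ := fun c =>
    if c ∈ loosePatternSet F e B ∅ then Finset.range (c.length + 1) else ∅
  have hs : ∀ a : LinkConfig G × ℕ, a.2 ∈ s a.1 → a.1 ∈ loosePatternSet F e B ∅ ∧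
      a.2 ≤ a.1.length := by
    rintro ⟨c, p⟩ h
    by_cases hc : c ∈ loosePatternSet F e B ∅
    · simp only [s, if_pos hc, Finset.mem_range] at h
      exact ⟨hc, Nat.lt_succ_iff.1 h⟩
    · simp only [s, if_neg hc, Finset.notMem_empty] at h
  calc _ = ∑' c, wt β u θ c / ((c.length + 1 : ℕ) : ℝ≥0∞) * (s c).card := by
        refine tsum_congr fun c => ?_
        by_cases hc : c ∈ loosePatternSet F e B ∅
        · rw [Set.indicator_of_mem hc]
          simp only [s, if_pos hc, Finset.card_range]
          rw [ENNReal.div_mul_cancel (by simp) (ENNReal.natCast_ne_top _)]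
        · rw [Set.indicator_of_notMem hc]
          simp [s, if_neg hc]
    _ = _ := (tsum_prod_indicator s fun c => wt β u θ c / ((c.length + 1 : ℕ) : ℝ≥0∞)).symm
    _ ≤ _ := by
        refine tsum_indicator_le_of_injOn (fun a => a.1.insertIdx a.2 (e, LinkType.cross)) ?_ ?_ ?_
        · intro a ha
          obtain ⟨h1, h2⟩ := hs a ha
          have h3 := ne_of_mem_loosePatternSet h1
          refine ⟨?_, a.2, getElem?_insertIdx_unique h3 h2⟩
          rwa [offEdge_insertIdx h3 h2]
        · intro a ha b hb hab
          beta_reduce at hab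
          obtain ⟨h1, h2⟩ := hs a ha
          obtain ⟨h1', h2'⟩ := hs b hb
          have h3 := ne_of_mem_loosePatternSet h1
          have h3' := ne_of_mem_loosePatternSet h1'
          refine Prod.ext ?_ ?_
          · rw [← offEdge_insertIdx h3 h2, hab, offEdge_insertIdx h3' h2']
          · have h4 := (getElem?_insertIdx_unique h3 h2).1
            rw [hab] at h4
            exact (getElem?_insertIdx_unique h3' h2').2 _ _ h4 rfl
        · intro a ha
          obtain ⟨h1, h2⟩ := hs a ha
          have h3 := ne_of_mem_loosePatternSet h1
          rw [markedWt, offEdge_insertIdx h3 h2, List.length_insertIdx_of_le_length h2]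

theorem sum_uncoveredSet_le (β u θ : ℝ) (F : Finset G.edgeSet) (e : G.edgeSet)
    (B : Set G.edgeSet) :
    ∑' c, (uncoveredSet F e B).indicator (markedWt β u θ e) c ≤
      ∑' c : LinkConfig G, wt β u θ c * ENNReal.ofReal
        ((allowedPositions F e B c).card / (c.length + 1 : ℝ)) := by
  classical
  calc _ ≤ ∑' a : LinkConfig G × ℕ, Set.indicator {a | a.2 ∈ allowedPositions F e B a.1}
        (fun a => wt β u θ a.1 / ((a.1.length + 1 : ℕ) : ℝ≥0∞)) a := by
        have key : ∀ c ∈ uncoveredSet F e B, ∃ p, p ≤ (offEdge e c).length ∧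
            (offEdge e c).insertIdx p (e, LinkType.cross) = c := by
          intro c hc
          obtain ⟨p, hp, hpu⟩ := hc.1.2
          have hlen := (List.getElem?_eq_some_iff.1 hp).1
          have h1 : c.eraseIdx p = offEdge e c := by
            rw [← offEdge_eraseIdx hp, offEdge_eq_self]
            intro l hl hle
            obtain ⟨k, hk⟩ := List.mem_iff_getElem?.1 hl
            rw [List.getElem?_eraseIdx] at hk
            split_ifs at hk with hkp
            · have := hpu _ _ hk hle
              omega
            · have := hpu _ _ hk hle
              omega
          refine ⟨p, ?_, ?_⟩
          · rw [← h1]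
            have := length_eraseIdx_of_getElem? hp
            omega
          · rw [← h1]
            exact insertIdx_eraseIdx_of_getElem? hp
        choose! p hp1 hp2 using key
        refine tsum_indicator_le_of_injOn (fun c => (offEdge e c, p c)) ?_ ?_ ?_
        · intro c hc
          refine mem_allowedPositions.2 ⟨hp1 c hc, hc.1.1, ?_⟩
          rw [hp2 c hc]
          exact hc
        · intro c hc c' hc' h
          rw [Prod.mk.injEq] at h
          rw [← hp2 c hc, h.1, h.2, hp2 c' hc']
        · intro c hc
          rw [markedWt]
          have := congrArg List.length (hp2 c hc)
          rw [List.length_insertIdx_of_le_length (hp1 c hc)] at this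
          rw [this]
    _ = ∑' c : LinkConfig G, wt β u θ c / ((c.length + 1 : ℕ) : ℝ≥0∞) *
          (allowedPositions F e B c).card :=
        tsum_prod_indicator (allowedPositions F e B) fun c =>
          wt β u θ c / ((c.length + 1 : ℕ) : ℝ≥0∞)
    _ = _ := by
        refine tsum_congr fun c => ?_
        rw [ENNReal.ofReal_div_of_pos (by positivity), ENNReal.ofReal_natCast,
          show ((c.length : ℝ) + 1) = ((c.length + 1 : ℕ) : ℝ) by push_cast; rfl,
          ENNReal.ofReal_natCast, div_eq_mul_inv, div_eq_mul_inv, mul_assoc]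
        congr 1
        rw [mul_comm]

open Classical in
/-- The number of links adjacent to `e` before the position `p`. -/
noncomputable def numNearBefore (e : G.edgeSet) (c : LinkConfig G) (p : ℕ) : ℕ :=
  (c.take p).countP fun l => Near l.1 e

theorem not_near_of_numNearBefore_eq {e : G.edgeSet} {c : LinkConfig G} {p q : ℕ} (hpq : p ≤ q)
    (h : numNearBefore e c p = numNearBefore e c q) :
    ∀ l ∈ (c.drop p).take (q - p), ¬ Near l.1 e := by
  classical
  have h1 : c.take q = c.take p ++ (c.drop p).take (q - p) := by
    rw [← List.take_add]
    congr 1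
    omega
  rw [numNearBefore, numNearBefore, h1, List.countP_append] at h
  have h2 : ((c.drop p).take (q - p)).countP (fun l => decide (Near l.1 e)) = 0 := by omega
  simpa using h2

theorem numNearBefore_le {F : Finset G.edgeSet} {e : G.edgeSet} {B S : Set G.edgeSet}
    {c : LinkConfig G} (hc : c ∈ loosePatternSet F e B S) (p : ℕ) :
    numNearBefore e c p ≤ numAdjacent F e c := by
  classical
  have h1 : ∀ d : LinkConfig G, (∀ l ∈ d, l.1 ∈ F ∧ l.1 ≠ e) →
      d.countP (fun l => decide (Near l.1 e)) ≤ numAdjacent F e d := by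
    intro d
    induction d with
    | nil => intro _; simp
    | cons l d ih =>
      intro hd
      have h2 := ih fun k hk => hd k (List.mem_cons_of_mem _ hk)
      have h3 : numAdjacent F e (l :: d) = numAdjacent F e d +
          ∑ f ∈ adjacentIn F e, if l.1 = f then 1 else 0 := by
        rw [numAdjacent, numAdjacent, ← Finset.sum_add_distrib]
        refine Finset.sum_congr rfl fun f _ => ?_
        rw [numOn, numOn, List.countP_cons]
        simp
      rw [h3, List.countP_cons, Finset.sum_ite_eq]
      gcongr ?_ + ?_
      by_cases hn : Near l.1 e
      · rw [if_pos (mem_adjacentIn.2 ⟨(hd l List.mem_cons_self).1, (hd l List.mem_cons_self).2, hn⟩)]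
        split_ifs <;> simp
      · simp [hn]
  refine le_trans ?_ (h1 c fun l hl => (hc.1 l.1).1 ⟨l, hl, rfl⟩)
  exact (List.take_sublist p c).countP_le

/-- Extra links on `e` create no other blocking edge. An edge of `B` stays blocking with the first
cross alone since `p` is allowed, and the second cross of a blocking pair does no further harm. -/
theorem insertPair_mem {F : Finset G.edgeSet} {e : G.edgeSet} (he : e ∈ F) {B : Set G.edgeSet}
    {c : LinkConfig G} {p q : ℕ} (hp : p ∈ allowedPositions F e B c) (hpq : p ≤ q)
    (hq : q ≤ c.length) (hn : numNearBefore e c p = numNearBefore e c q) :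
    insertPair e c p q ∈ patternSet F e B ∩ {c | IsBlocking c e} := by
  obtain ⟨hp1, hc, hp2⟩ := mem_allowedPositions.1 hp
  have hce := ne_of_mem_loosePatternSet hc
  have hb := isBlocking_insertPair hce (not_near_of_numNearBefore_eq hpq hn)
  have hoff := offEdge_insertPair hce hpq
  refine ⟨⟨fun f => ?_, fun f hf hfe => ⟨fun h => ?_, fun h => ?_⟩⟩, hb⟩
  · by_cases hfe : f = e
    · subst hfe
      refine ⟨fun _ => he, fun _ => ⟨(f, LinkType.cross), ?_, rfl⟩⟩
      simp [insertPair]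
    · have h1 := hc.1 f
      rw [← hoff] at h1
      constructor
      · rintro ⟨l, hl, rfl⟩
        exact (h1.1 ⟨l, mem_offEdge.2 ⟨hl, hfe⟩, rfl⟩).1
      · intro h
        obtain ⟨l, hl, rfl⟩ := h1.2 ⟨h, hfe⟩
        exact ⟨l, (mem_offEdge.1 hl).1, rfl⟩
  · have h1 := isBlocking_offEdge_of_isBlocking hfe h
    rw [hoff] at h1
    exact ((hc.2 f hf hfe).2 h1).resolve_right (Set.notMem_empty f)
  · refine hb.of_eraseIdx_isBlocking (isCrossPair_insertPair hce hpq hq) hfe ?_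
    rw [eraseIdx_insertPair hpq hq]
    exact hp2.2 f hf hfe h

open Classical in
/-- The pairs of positions where a blocking pair of crosses on `e` can be inserted. -/
noncomputable def allowedPairs (F : Finset G.edgeSet) (e : G.edgeSet) (B : Set G.edgeSet)
    (c : LinkConfig G) : Finset (ℕ × ℕ) :=
  (allowedPositions F e B c ×ˢ allowedPositions F e B c).filter fun a =>
    a.1 ≤ a.2 ∧ numNearBefore e c a.1 = numNearBefore e c a.2

/-- Insertion is injective, as the positions and the original are read off from the result, and the
weight changes by an explicit factor because the pair leaves the loops unchanged. -/
theorem sum_allowedPairs_le (hβ : 0 ≤ β) (hu : 0 ≤ u) (hu1 : u ≤ 1) (hθ : 0 < θ)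
    {F : Finset G.edgeSet} {e : G.edgeSet} (he : e ∈ F) (B : Set G.edgeSet) :
    ENNReal.ofReal ((β * u) ^ 2) * ∑' c : LinkConfig G, wt β u θ c * ENNReal.ofReal
        ((allowedPairs F e B c).card / ((c.length + 1) * (c.length + 2) : ℝ)) ≤
      mass β u θ (patternSet F e B ∩ {c | IsBlocking c e}) := by
  classical
  have hs : ∀ a : LinkConfig G × (ℕ × ℕ), a.2 ∈ allowedPairs F e B a.1 →
      a.2.1 ∈ allowedPositions F e B a.1 ∧ a.2.1 ≤ a.2.2 ∧ a.2.2 ≤ a.1.length ∧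
      numNearBefore e a.1 a.2.1 = numNearBefore e a.1 a.2.2 ∧ (∀ l ∈ a.1, l.1 ≠ e) := by
    intro a ha
    simp only [allowedPairs, Finset.mem_filter, Finset.mem_product] at ha
    obtain ⟨⟨h1, h2⟩, h3, h4⟩ := ha
    rw [mem_allowedPositions] at h2
    exact ⟨h1, h3, h2.1, h4, ne_of_mem_loosePatternSet h2.2.1⟩
  calc _ = ∑' c : LinkConfig G, wt β u θ c * ENNReal.ofReal
        ((β * u) ^ 2 / ((c.length + 1) * (c.length + 2) : ℝ)) * (allowedPairs F e B c).card := by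
        rw [← ENNReal.tsum_mul_left]
        refine tsum_congr fun c => ?_
        rw [mul_left_comm, ← ENNReal.ofReal_mul (by positivity), mul_assoc,
          ← ENNReal.ofReal_natCast, ← ENNReal.ofReal_mul (by positivity)]
        congr 2
        ring
    _ = _ := (tsum_prod_indicator (allowedPairs F e B) fun c => wt β u θ c * ENNReal.ofReal
        ((β * u) ^ 2 / ((c.length + 1) * (c.length + 2) : ℝ))).symm
    _ ≤ _ := by
        refine tsum_indicator_le_of_injOn (fun a => insertPair e a.1 a.2.1 a.2.2) ?_ ?_ ?_
        · intro a ha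
          obtain ⟨h1, h2, h3, h4, h5⟩ := hs a ha
          exact insertPair_mem he h1 h2 h3 h4
        · intro a ha b hb hab
          beta_reduce at hab
          obtain ⟨h1, h2, h3, h4, h5⟩ := hs a ha
          obtain ⟨h1', h2', h3', h4', h5'⟩ := hs b hb
          have e1 := isCrossPair_insertPair h5 h2 h3
          rw [hab] at e1
          obtain ⟨e2, e3⟩ := e1.unique (isCrossPair_insertPair h5' h2' h3')
          refine Prod.ext ?_ (Prod.ext e2 (by omega))
          rw [← offEdge_insertPair h5 h2, hab, offEdge_insertPair h5' h2']
        · intro a ha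
          obtain ⟨h1, h2, h3, h4, h5⟩ := hs a ha
          rw [wt, wt, loopWeight_insertPair h2 (not_near_of_numNearBefore_eq h2 h4),
            ENNReal.ofReal_mul (loopWeight_nonneg hβ hu hu1 hθ.le _)]

theorem sum_allowedPositions_le {r : ℝ} (hr : 0 ≤ r) (F : Finset G.edgeSet) (e : G.edgeSet)
    (B : Set G.edgeSet) :
    ENNReal.ofReal (2 * r) * ∑' c : LinkConfig G, wt β u θ c * ENNReal.ofReal
        ((allowedPositions F e B c).card / (c.length + 1 : ℝ)) ≤
      2 * ∑' c : LinkConfig G, wt β u θ c * ENNReal.ofReal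
        ((allowedPairs F e B c).card / ((c.length + 1) * (c.length + 2) : ℝ)) +
      ENNReal.ofReal (r ^ 2) * ∑' c, (loosePatternSet F e B ∅).indicator
        (fun c => wt β u θ c * ((numAdjacent F e c + 1 : ℕ) : ℝ≥0∞)) c := by
  classical
  rw [← ENNReal.tsum_mul_left, ← ENNReal.tsum_mul_left, ← ENNReal.tsum_mul_left, ← ENNReal.tsum_add]
  refine ENNReal.tsum_le_tsum fun c => ?_
  by_cases hc : c ∈ loosePatternSet F e B ∅
  · rw [Set.indicator_of_mem hc, mul_left_comm, mul_left_comm 2, mul_left_comm _ (wt β u θ c),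
      ← mul_add, ← ENNReal.ofReal_mul (by positivity), ← ENNReal.ofReal_natCast,
      ← ENNReal.ofReal_mul (by positivity), show (2 : ℝ≥0∞) = ENNReal.ofReal 2 by simp,
      ← ENNReal.ofReal_mul (by positivity), ← ENNReal.ofReal_add (by positivity) (by positivity)]
    gcongr
    refine two_mul_mul_div_le (by omega) ?_ ?_
    · refine (Finset.card_filter_le _ _).trans_eq (Finset.card_range _)
    · exact sq_card_add_le_card_pairs _ _ _ fun p _ => numNearBefore_le hc p
  · have : allowedPositions F e B c = ∅ := by
      refine Finset.eq_empty_of_forall_notMem fun p hp => hc ?_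
      exact (mem_allowedPositions.1 hp).2.1
    simp [this]

end Insertion

/-! ### Explicit constants and the bound for a single edge -/

section Bound

theorem sq_le_twelve_mul_four_pow {k : ℕ} (hk : 1 ≤ k) : (4 * k + 1) ^ 2 ≤ 12 * 4 ^ k := by
  induction k, hk using Nat.le_induction with
  | base => norm_num
  | succ k hk ih =>
    rw [pow_succ 4 k]
    nlinarith

/-- The left side is 1 + x/2 + x²/6, the Taylor polynomial of (e^x - 1)/x, with the factor 1 + x/2
split off. -/
theorem one_add_le_exp_sub_one_div {x : ℝ} (hx : 0 < x) :
    (1 + x / 2) * (1 + x ^ 2 / (6 + 3 * x)) ≤ (Real.exp x - 1) / x := by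
  have h := Real.sum_le_exp_of_nonneg hx.le 4
  simp only [Finset.sum_range_succ, Finset.range_zero, Finset.sum_empty, Nat.factorial] at h
  norm_num at h
  rw [le_div_iff₀ hx]
  have : (1 + x / 2) * (1 + x ^ 2 / (6 + 3 * x)) = 1 + x / 2 + x ^ 2 / 6 := by
    field_simp
    ring
  rw [this]
  linarith

/-- The surplus factor (1 + s)^(2k) ≥ 1 + 2s of the previous bound absorbs the linear growth in x,
because x ≤ 2 + 6s; the factor 4^k absorbs (4k + 1)². -/
theorem growth_bound (k : ℕ) {x : ℝ} (hx : 0 < x) :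
    (4 * k + 1 : ℝ) ^ 2 * (1 + 2 * k * (2 * k + 2 + x)) * (1 + x / 2) ^ (2 * k) ≤
      (k + 1) ^ 2 * (3 * 4 ^ (k + 2)) * ((Real.exp x - 1) / x) ^ (2 * k) := by
  rcases Nat.eq_zero_or_pos k with rfl | hk
  · norm_num
  set s := x ^ 2 / (6 + 3 * x) with hs
  have hs0 : 0 ≤ s := by positivity
  have hk1 : (1 : ℝ) ≤ k := by exact_mod_cast hk
  have h1 := pow_le_pow_left₀ (by positivity) (one_add_le_exp_sub_one_div hx) (2 * k)
  rw [mul_pow] at h1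
  have h2 : 1 + 2 * s ≤ (1 + s) ^ (2 * k) := by
    calc 1 + 2 * s ≤ (1 + s) ^ 2 := by nlinarith
      _ ≤ _ := pow_le_pow_right₀ (by linarith) (by omega)
  have h3 : x ≤ 2 + 6 * s := by
    have : 2 + 6 * s - x = (x ^ 2 + 4) / (2 + x) := by
      rw [hs]
      field_simp
      ring
    have h4 : 0 ≤ (x ^ 2 + 4) / (2 + x) := by positivity
    linarith
  have h4 : 1 + 2 * k * (2 * k + 2 + x) ≤ 4 * (k + 1) ^ 2 * (1 + 2 * s) := by
    have : 2 * (k : ℝ) * x ≤ 2 * k * (2 + 6 * s) := by gcongr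
    nlinarith [mul_nonneg hs0 (sub_nonneg.2 hk1), mul_nonneg hs0 (sq_nonneg (k : ℝ))]
  have h5 : (4 * k + 1 : ℝ) ^ 2 ≤ 12 * 4 ^ k := by exact_mod_cast sq_le_twelve_mul_four_pow hk
  calc _ ≤ (12 * 4 ^ k) * (4 * (k + 1) ^ 2 * (1 + 2 * s)) * (1 + x / 2) ^ (2 * k) := by gcongr
    _ = (k + 1) ^ 2 * (3 * 4 ^ (k + 2)) * ((1 + x / 2) ^ (2 * k) * (1 + 2 * s)) := by ring
    _ ≤ (k + 1) ^ 2 * (3 * 4 ^ (k + 2)) * ((1 + x / 2) ^ (2 * k) * (1 + s) ^ (2 * k)) := by gcongr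
    _ ≤ _ := by gcongr

theorem blockingDelta_mul_le (k : ℕ) {β u θ : ℝ} (hβ : 0 < β) (hu : 0 < u) (hθ : 0 < θ) :
    blockingDelta (k + 1) β u θ *
      ((Real.exp (β * max θ θ⁻¹) - 1) * (1 + β * max θ θ⁻¹ / 2) ^ (2 * k)) ≤
      (β * u) ^ 2 / (2 * (4 * k + 1) ^ 2 * (1 + 2 * k * (2 * k + 2 + β * max θ θ⁻¹))) := by
  have hθ' : 0 < θ⁻¹ := inv_pos.2 hθ
  have hM : 0 < max θ θ⁻¹ := lt_max_of_lt_left hθ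
  have ht : 0 < min θ θ⁻¹ := lt_min hθ hθ'
  have htM : min θ θ⁻¹ * max θ θ⁻¹ = 1 := by rw [min_mul_max, mul_inv_cancel₀ hθ.ne']
  have ht1 : min θ θ⁻¹ ≤ 1 := by
    rcases le_total θ 1 with h | h
    · exact (min_le_left _ _).trans h
    · exact (min_le_right _ _).trans (inv_le_one_of_one_le₀ h)
  simp only [blockingDelta]
  set t := min θ θ⁻¹
  set x := β * max θ θ⁻¹ with hx
  have hx0 : 0 < x := by positivity
  have hxt : x * t = β := by rw [hx, mul_assoc, mul_comm (max _ _), htM, mul_one]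
  have hE : 0 < Real.exp x - 1 := by
    have := Real.add_one_lt_exp hx0.ne'
    linarith
  set E := Real.exp x - 1 with hEdef
  have hg := growth_bound k hx0
  rw [← hEdef] at hg
  set D : ℝ := 3 * 4 ^ (k + 1 + 1) with hD
  have hD0 : 0 < D := by positivity
  set k2 : ℝ := 1 + 2 * k * (2 * k + 2 + x)
  have hk2 : 0 < k2 := by positivity
  have h1 : β * t ^ 3 / (β * t ^ 3 + D) ≤ β * t ^ 3 / D := by
    gcongr
    have : 0 ≤ β * t ^ 3 := by positivity
    linarith
  have h2 : 2 * (k + 1) - 1 = 2 * k + 1 := by omega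
  rw [h2]
  calc _ ≤ 1 / 2 * (u * t / ((k + 1 : ℕ) : ℝ)) ^ 2 * (β * t ^ 3 / D) * (x / E) ^ (2 * k + 1) *
        (E * (1 + x / 2) ^ (2 * k)) := by gcongr
    _ = u ^ 2 * β * t ^ 4 * (x * t) / (2 * (k + 1) ^ 2 * D) *
        ((1 + x / 2) ^ (2 * k) / (E / x) ^ (2 * k)) := by
        have h3 : (E / x) ^ (2 * k) * (x / E) ^ (2 * k) = 1 := by
          rw [← mul_pow, div_mul_div_comm, mul_comm E x, div_self (by positivity), one_pow]
        have h4 : ((E / x) ^ (2 * k))⁻¹ = (x / E) ^ (2 * k) := inv_eq_of_mul_eq_one_right h3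
        have h5 : E * (x / E) ^ (2 * k + 1) = x * (x / E) ^ (2 * k) := by
          rw [pow_succ, mul_left_comm, mul_div_cancel₀ _ hE.ne', mul_comm]
        have h6 : ∀ a b c : ℝ, a * b * (E * c) = a * (E * b) * c := fun a b c => by ring
        rw [div_eq_mul_inv _ ((E / x) ^ (2 * k)), h4, h6, h5]
        generalize (x / E) ^ (2 * k) = w
        push_cast
        field_simp
    -- Of the five powers of t = min(θ, 1/θ), one turns x into β; the other four are bounded by 1.
    _ ≤ u ^ 2 * β * 1 * (x * t) / (2 * (k + 1) ^ 2 * D) *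
        ((1 + x / 2) ^ (2 * k) / (E / x) ^ (2 * k)) := by
        gcongr
        exact pow_le_one₀ ht.le ht1
    _ = (β * u) ^ 2 / 2 * ((1 + x / 2) ^ (2 * k) / ((k + 1) ^ 2 * D * (E / x) ^ (2 * k))) := by
        rw [hxt]
        field_simp
    _ ≤ (β * u) ^ 2 / 2 * (1 / ((4 * k + 1) ^ 2 * k2)) := by
        refine mul_le_mul_of_nonneg_left ?_ (by positivity)
        rw [div_le_div_iff₀ (by positivity) (by positivity), one_mul, mul_comm]
        exact hg
    _ = _ := by field_simp

variable {V : Type*} {G : SimpleGraph V} {β u θ : ℝ}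

theorem blockingDelta_mul_mass_le [Fintype V] [DecidableRel G.Adj] {K : ℕ}
    (hK : G.maxDegree ≤ K) (hβ : 0 < β) (hu : 0 < u) (hu1 : u ≤ 1) (hθ : 0 < θ)
    {F : Finset G.edgeSet} {e : G.edgeSet} (he : e ∈ F) (B : Set G.edgeSet) :
    ENNReal.ofReal (blockingDelta K β u θ) * mass β u θ (patternSet F e B) ≤
      mass β u θ (patternSet F e B ∩ {c | IsBlocking c e}) := by
  have hcard := card_adjacentIn_le hK F e
  -- The edge `e` forces K ≥ 1.
  obtain ⟨k, rfl⟩ : ∃ k, K = k + 1 := ⟨K - 1, by omega⟩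
  have hM : 0 < max θ θ⁻¹ := lt_max_of_lt_left hθ
  have hδ := (blockingDelta_mem (k + 1) hβ hu hu1 hθ).1
  have hreal := blockingDelta_mul_le k hβ hu hθ
  set x := β * max θ θ⁻¹ with hx
  have hx0 : 0 < x := by positivity
  set T := loosePatternSet F e B ∅ with hT
  have hY := mass_ne_top hβ.le hu.le hu1 hθ T
  have hm := mass_ne_top hβ.le hu.le hu1 hθ (patternSet F e B ∩ {c | IsBlocking c e})
  have h1 := (mass_le_sum_markedSet β u θ F e B).trans
    ((sum_markedSet_le hK β u θ F e B).trans (mul_le_mul_right (sum_uncoveredSet_le β u θ F e B) _))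
  have h2 := tsum_numAdjacent_le hK hβ.le hu.le hu1 hθ F e B
  have h3 := sum_allowedPairs_le hβ.le hu.le hu1 hθ he B
  have h5 := mass_patternSet_le hβ.le hu.le hu1 hθ he B
  have hk1 : (4 * (k + 1) - 3 : ℕ) = 4 * k + 1 := by omega
  rw [hk1] at h1
  set k2 : ℝ := 1 + 2 * k * (2 * k + 2 + x) with hk2
  have hk20 : 0 < k2 := by positivity
  have hk2' : (1 + (2 * ((k + 1 : ℕ) : ℝ) - 2) * (2 * ((k + 1 : ℕ) : ℝ) + β * max θ θ⁻¹)) = k2 := by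
    rw [hk2, hx]
    push_cast
    ring
  rw [hk2'] at h2
  set k1 : ℝ := 4 * k + 1 with hk1'
  have hk10 : 0 < k1 := by positivity
  have hk1c : ((4 * k + 1 : ℕ) : ℝ≥0∞) = ENNReal.ofReal k1 := by
    rw [← ENNReal.ofReal_natCast, hk1']
    push_cast
    rfl
  rw [hk1c] at h1
  -- The optimal `r`: the main term is of order 2r and the error k1 k2 r² then equals r, so half of
  -- the main term survives.
  have h4 := sum_allowedPositions_le (β := β) (u := u) (θ := θ) (r := 1 / (k1 * k2))
    (by positivity) F e B
  set r := 1 / (k1 * k2) with hr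
  have hr0 : 0 < r := by positivity
  set Sa := ∑' c : LinkConfig G, wt β u θ c * ENNReal.ofReal
        ((allowedPositions F e B c).card / (c.length + 1 : ℝ))
  set Sp := ∑' c : LinkConfig G, wt β u θ c * ENNReal.ofReal
        ((allowedPairs F e B c).card / ((c.length + 1) * (c.length + 2) : ℝ))
  set m := mass β u θ (patternSet F e B ∩ {c | IsBlocking c e})
  set Y := mass β u θ T
  have h6 : ENNReal.ofReal ((β * u) ^ 2 * (2 * r)) * Y ≤
      ENNReal.ofReal (2 * k1) * m + ENNReal.ofReal ((β * u) ^ 2 * k1 * r ^ 2 * k2) * Y := by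
    have hb : 0 ≤ (β * u) ^ 2 := by positivity
    calc _ = ENNReal.ofReal ((β * u) ^ 2) * ENNReal.ofReal (2 * r) * Y := by
          rw [ENNReal.ofReal_mul hb]
      _ ≤ ENNReal.ofReal ((β * u) ^ 2) * ENNReal.ofReal (2 * r) * (ENNReal.ofReal k1 * Sa) := by
          gcongr
      _ = ENNReal.ofReal ((β * u) ^ 2) * ENNReal.ofReal k1 * (ENNReal.ofReal (2 * r) * Sa) := by
          ring
      _ ≤ ENNReal.ofReal ((β * u) ^ 2) * ENNReal.ofReal k1 * (2 * Sp + ENNReal.ofReal (r ^ 2) *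
            (ENNReal.ofReal k2 * Y)) := by
          gcongr
          exact h4.trans (by gcongr)
      _ = ENNReal.ofReal k1 * 2 * (ENNReal.ofReal ((β * u) ^ 2) * Sp) +
            ENNReal.ofReal ((β * u) ^ 2) * ENNReal.ofReal k1 * ENNReal.ofReal (r ^ 2) *
              ENNReal.ofReal k2 * Y := by ring
      _ ≤ ENNReal.ofReal k1 * 2 * m +
            ENNReal.ofReal ((β * u) ^ 2) * ENNReal.ofReal k1 * ENNReal.ofReal (r ^ 2) *
              ENNReal.ofReal k2 * Y := by gcongr
      _ = _ := by
          rw [← ENNReal.ofReal_mul hb, ← ENNReal.ofReal_mul (by positivity),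
            ← ENNReal.ofReal_mul (by positivity), mul_comm 2 k1, ENNReal.ofReal_mul hk10.le]
          simp
  obtain ⟨y, hy0, hyY⟩ : ∃ y : ℝ, 0 ≤ y ∧ Y = ENNReal.ofReal y :=
    ⟨Y.toReal, ENNReal.toReal_nonneg, (ENNReal.ofReal_toReal hY).symm⟩
  obtain ⟨m', hm0, hmm⟩ : ∃ y : ℝ, 0 ≤ y ∧ m = ENNReal.ofReal y :=
    ⟨m.toReal, ENNReal.toReal_nonneg, (ENNReal.ofReal_toReal hm).symm⟩
  rw [hyY, hmm, ← ENNReal.ofReal_mul (by positivity), ← ENNReal.ofReal_mul (by positivity),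
    ← ENNReal.ofReal_mul (by positivity), ← ENNReal.ofReal_add (by positivity) (by positivity),
    ENNReal.ofReal_le_ofReal_iff (by positivity)] at h6
  have h7 : (β * u) ^ 2 / (2 * k1 ^ 2 * k2) * y ≤ m' := by
    have e1 : (β * u) ^ 2 * k1 * r ^ 2 * k2 = (β * u) ^ 2 * r := by
      rw [hr]
      field_simp
    rw [e1] at h6
    have e2 : (β * u) ^ 2 / (2 * k1 ^ 2 * k2) * y = (β * u) ^ 2 * r * y / (2 * k1) := by
      rw [hr]
      field_simp
    rw [e2, div_le_iff₀ (by positivity)]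
    linarith
  have hE : 0 ≤ Real.exp x - 1 := by
    have := Real.add_one_le_exp x
    linarith
  have hpow : ENNReal.ofReal (1 + x / 2) ^ (adjacentIn F e).card ≤
      ENNReal.ofReal ((1 + x / 2) ^ (2 * k)) := by
    rw [← ENNReal.ofReal_pow (by positivity)]
    refine ENNReal.ofReal_le_ofReal (pow_le_pow_right₀ ?_ (by omega))
    linarith
  calc _ ≤ ENNReal.ofReal (blockingDelta (k + 1) β u θ) * (ENNReal.ofReal (Real.exp x - 1) *
        (ENNReal.ofReal ((1 + x / 2) ^ (2 * k)) * Y)) := by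
        gcongr
        exact h5.trans (by gcongr)
    _ = ENNReal.ofReal (blockingDelta (k + 1) β u θ * ((Real.exp x - 1) *
        (1 + x / 2) ^ (2 * k)) * y) := by
        rw [hyY, ← ENNReal.ofReal_mul (by positivity), ← ENNReal.ofReal_mul hE,
          ← ENNReal.ofReal_mul hδ]
        congr 1
        ring
    _ ≤ ENNReal.ofReal m' := by
        refine ENNReal.ofReal_le_ofReal (le_trans ?_ h7)
        gcongr
    _ = m := hmm.symm

end Bound

/-! ### From single-edge bounds to stochastic domination -/

section Domination

variable {ι : Type*} [Fintype ι]

theorem sum_update_add_sum_update [DecidableEq ι] (e : ι) (f : (ι → Bool) → ℝ) :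
    ∑ ω, (f (Function.update ω e true) + f (Function.update ω e false)) = 2 * ∑ ω, f ω := by
  have h1 : ∀ ω : ι → Bool, f (Function.update ω e true) + f (Function.update ω e false) =
      f ω + f (Function.update ω e (!ω e)) := by
    intro ω
    cases h : ω e
    · rw [add_comm]
      congr 2
      rw [← h, Function.update_eq_self]
    · congr 2
      rw [← h, Function.update_eq_self]
  have h2 : Function.Involutive fun ω : ι → Bool => Function.update ω e (!ω e) := by
    intro ω
    simp
  rw [Finset.sum_congr rfl fun ω _ => h1 ω, Finset.sum_add_distrib, two_mul]
  congr 1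
  exact Equiv.sum_comp (h2.toPerm _) f

/-- Resampling of one coordinate. -/
noncomputable def resample [DecidableEq ι] (p : ℝ) (e : ι) (h : (ι → Bool) → ℝ) (ω : ι → Bool) : ℝ :=
  p * h (Function.update ω e true) + (1 - p) * h (Function.update ω e false)

/-- For increasing `h`, a weight that gives the value `true` at least its share `p` loses under
resampling, and a product weight with parameter `p` is invariant. -/
theorem two_mul_sum_mul_sub_resample [DecidableEq ι] (p : ℝ) (e : ι) (m h : (ι → Bool) → ℝ) :
    2 * (∑ ω, m ω * h ω - ∑ ω, m ω * resample p e h ω) =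
      ∑ ω, (m (Function.update ω e true) -
        p * (m (Function.update ω e true) + m (Function.update ω e false))) *
        (h (Function.update ω e true) - h (Function.update ω e false)) := by
  rw [mul_sub, ← sum_update_add_sum_update e, ← sum_update_add_sum_update e,
    ← Finset.sum_sub_distrib]
  refine Finset.sum_congr rfl fun ω _ => ?_
  simp only [resample, Function.update_idem]
  ring

theorem exists_resampled [DecidableEq ι] {p : ℝ} (hp0 : 0 ≤ p) (hp1 : p ≤ 1) {m b : (ι → Bool) → ℝ}
    (hm : ∀ e ω, p * (m (Function.update ω e true) + m (Function.update ω e false)) ≤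
      m (Function.update ω e true))
    (hb : ∀ e ω, p * (b (Function.update ω e true) + b (Function.update ω e false)) =
      b (Function.update ω e true))
    {h : (ι → Bool) → ℝ} (hmono : Monotone h) (S : Finset ι) :
    ∃ h' : (ι → Bool) → ℝ, Monotone h' ∧ (∑ ω, m ω * h' ω ≤ ∑ ω, m ω * h ω) ∧
      (∑ ω, b ω * h' ω = ∑ ω, b ω * h ω) ∧
      ∀ e ∈ S, ∀ ω v, h' (Function.update ω e v) = h' ω := by
  induction S using Finset.induction_on with
  | empty => exact ⟨h, hmono, le_rfl, rfl, by simp⟩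
  | insert e S he ih =>
    obtain ⟨h', h1, h2, h3, h4⟩ := ih
    have hle : ∀ ω : ι → Bool, Function.update ω e false ≤ Function.update ω e true := fun ω =>
      update_le_update_iff.2 ⟨by simp, fun _ _ => le_rfl⟩
    have hup : ∀ {ω ω' : ι → Bool} (v : Bool), ω ≤ ω' →
        Function.update ω e v ≤ Function.update ω' e v := fun v hω =>
      update_le_update_iff.2 ⟨le_rfl, fun i _ => hω i⟩
    refine ⟨resample p e h', ?_, ?_, ?_, ?_⟩
    · intro ω ω' hω
      have e1 := h1 (hup true hω)
      have e2 := h1 (hup false hω)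
      simp only [resample]
      have : 0 ≤ 1 - p := by linarith
      gcongr
    · refine le_trans ?_ h2
      have := two_mul_sum_mul_sub_resample p e m h'
      have h5 : 0 ≤ ∑ ω, (m (Function.update ω e true) -
        p * (m (Function.update ω e true) + m (Function.update ω e false))) *
        (h' (Function.update ω e true) - h' (Function.update ω e false)) :=
        Finset.sum_nonneg fun ω _ =>
          mul_nonneg (sub_nonneg.2 (hm e ω)) (sub_nonneg.2 (h1 (hle ω)))
      linarith
    · rw [← h3]
      have := two_mul_sum_mul_sub_resample p e b h'
      simp only [hb, sub_self, zero_mul, Finset.sum_const_zero] at this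
      linarith
    · intro f hf ω v
      rcases Finset.mem_insert.1 hf with rfl | hf
      · simp [resample]
      · have hfe : f ≠ e := fun h => he (h ▸ hf)
        simp only [resample]
        rw [Function.update_comm hfe, Function.update_comm hfe, h4 f hf, h4 f hf]

theorem bernoulliPercolation_real_singleton (p : unitInterval) (ω : ι → Bool) :
    (bernoulliPercolation ι p).real {ω} = ∏ i, if ω i then (p : ℝ) else 1 - p := by
  rw [bernoulliPercolation, Measure.real, Measure.pi_singleton, ENNReal.toReal_prod]
  refine Finset.prod_congr rfl fun i _ => ?_
  rw [← Measure.real]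
  cases h : ω i <;> simp

/-- Resample the indicator of an increasing event at every coordinate. The outcome is a constant,
which equals the Bernoulli probability and is at most the μ-probability. The hypothesis is
multiplied out, so null conditioning events cause no trouble. -/
theorem stochasticallyDominates_bernoulliPercolation (μ : Measure (ι → Bool))
    [IsProbabilityMeasure μ] (p : unitInterval)
    (h : ∀ (e : ι) (η : ι → Bool), ENNReal.ofReal p * μ {ω | ∀ f, f ≠ e → ω f = η f} ≤
      μ {ω | (∀ f, f ≠ e → ω f = η f) ∧ ω e = true}) :
    StochasticallyDominates μ (bernoulliPercolation ι p) := by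
  classical
  intro A hA _
  have hprob : IsProbabilityMeasure (bernoulliPercolation ι p) := by
    unfold bernoulliPercolation
    infer_instance
  have hsum : ∀ (ν : Measure (ι → Bool)) [IsProbabilityMeasure ν],
      ∑ ω, ν.real {ω} * A.indicator 1 ω = ν.real A := by
    intro ν _
    have h1 : A = ((Finset.univ.filter fun ω => ω ∈ A : Finset (ι → Bool)) : Set (ι → Bool)) := by
      ext ω
      simp
    conv_rhs => rw [h1, ← sum_measureReal_singleton]
    rw [Finset.sum_filter]
    refine Finset.sum_congr rfl fun ω _ => ?_
    by_cases hω : ω ∈ A <;> simp [hω]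
  have hone : ∀ (ν : Measure (ι → Bool)) [IsProbabilityMeasure ν], ∑ ω, ν.real {ω} = 1 := by
    intro ν _
    rw [sum_measureReal_singleton]
    simp
  have hm : ∀ e (ω : ι → Bool), (p : ℝ) * (μ.real {Function.update ω e true} +
      μ.real {Function.update ω e false}) ≤ μ.real {Function.update ω e true} := by
    intro e ω
    have h1 : {ω' : ι → Bool | ∀ f, f ≠ e → ω' f = ω f} =
        {Function.update ω e true} ∪ {Function.update ω e false} := by
      ext ω'
      simp only [Set.mem_ofPred_eq, Set.mem_union, Set.mem_singleton_iff, Function.eq_update_iff]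
      cases ω' e <;> simp
    have h2 : {ω' : ι → Bool | (∀ f, f ≠ e → ω' f = ω f) ∧ ω' e = true} =
        {Function.update ω e true} := by
      ext ω'
      simp only [Set.mem_ofPred_eq, Set.mem_singleton_iff, Function.eq_update_iff]
      tauto
    have h3 := h e ω
    rw [h1, h2] at h3
    have h4 := ENNReal.toReal_mono (measure_ne_top _ _) h3
    rw [ENNReal.toReal_mul, ENNReal.toReal_ofReal p.2.1] at h4
    rw [← measureReal_union _ (measurableSet_singleton _)]
    · exact h4
    · rw [Set.disjoint_singleton]
      intro h5
      have := congrFun h5 e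
      simp at this
  have hb : ∀ e (ω : ι → Bool), (p : ℝ) * ((bernoulliPercolation ι p).real {Function.update ω e true} +
      (bernoulliPercolation ι p).real {Function.update ω e false}) =
      (bernoulliPercolation ι p).real {Function.update ω e true} := by
    intro e ω
    simp only [bernoulliPercolation_real_singleton]
    have key : ∀ v : Bool, ∏ i, (if Function.update ω e v i then (p : ℝ) else 1 - p) =
        (if v then (p : ℝ) else 1 - p) * ∏ i ∈ Finset.univ.erase e, if ω i then (p : ℝ) else 1 - p := by
      intro v
      rw [← Finset.mul_prod_erase _ _ (Finset.mem_univ e), Function.update_self]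
      congr 1
      refine Finset.prod_congr rfl fun i hi => ?_
      rw [Function.update_of_ne (Finset.ne_of_mem_erase hi)]
    rw [key, key]
    simp only [if_true, Bool.false_eq_true, if_false]
    ring
  have hmono : Monotone (A.indicator (1 : (ι → Bool) → ℝ)) := by
    intro ω ω' hω
    by_cases h1 : ω ∈ A
    · rw [Set.indicator_of_mem h1, Set.indicator_of_mem (hA hω h1)]
      exact le_rfl
    · rw [Set.indicator_of_notMem h1]
      exact Set.indicator_nonneg (fun _ _ => zero_le_one) _
  obtain ⟨h', -, h2, h3, h4⟩ := exists_resampled (m := fun ω => μ.real {ω})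
    (b := fun ω => (bernoulliPercolation ι p).real {ω}) p.2.1 p.2.2 hm hb hmono Finset.univ
  have hconst : ∀ ω, h' ω = h' fun _ => true := by
    have : ∀ (S : Finset ι) (ω : ι → Bool), (∀ i ∉ S, ω i = true) → h' ω = h' fun _ => true := by
      intro S
      induction S using Finset.induction_on with
      | empty =>
        intro ω hω
        congr 1
        ext i
        simp [hω i]
      | insert e S _ ih =>
        intro ω hω
        rw [← h4 e (Finset.mem_univ _) ω true]
        refine ih _ fun i hi => ?_
        by_cases hie : i = e
        · simp [hie]
        · rw [Function.update_of_ne hie]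
          exact hω i (by simp [hie, hi])
    exact fun ω => this Finset.univ ω (by simp)
  have hc : ∀ (ν : Measure (ι → Bool)) [IsProbabilityMeasure ν],
      ∑ ω, ν.real {ω} * h' ω = h' fun _ => true := by
    intro ν _
    rw [Finset.sum_congr rfl fun ω _ => by rw [hconst ω], ← Finset.sum_mul, hone ν, one_mul]
  rw [hsum μ, hc μ] at h2
  rw [hsum (bernoulliPercolation ι p), hc (bernoulliPercolation ι p)] at h3
  rw [h3] at h2
  exact (ENNReal.toReal_le_toReal (measure_ne_top _ _) (measure_ne_top _ _)).1 h2

end Domination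

/-! ### The conditioned loop measure and the theorem -/

section Main

variable {V : Type*} {G : SimpleGraph V} {β u θ : ℝ}

theorem sum_dirac_apply (S : Set (LinkConfig G)) :
    (Measure.sum fun c : LinkConfig G => ENNReal.ofReal (loopWeight β u θ c) • Measure.dirac c) S =
      mass β u θ S := by
  have hS : MeasurableSet S := trivial
  rw [Measure.sum_apply _ hS, mass]
  refine tsum_congr fun c => ?_
  rw [Measure.smul_apply, Measure.dirac_apply' _ hS, smul_eq_mul]
  by_cases hc : c ∈ S <;> simp [hc, wt]

theorem loopMeasure_apply (S : Set (LinkConfig G)) :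
    loopMeasure G β u θ S = (mass β u θ (Set.univ : Set (LinkConfig G)))⁻¹ * mass β u θ S := by
  rw [loopMeasure, Measure.smul_apply, sum_dirac_apply, smul_eq_mul]
  congr 2
  simp [mass, wt]

theorem mass_openEdgesEq_ne_zero (hβ : 0 < β) (hu : 0 < u) (hθ : 0 < θ) (F : Finset G.edgeSet) :
    mass β u θ (openEdgesEq F) ≠ 0 := by
  classical
  -- One cross on each edge of `F`: only crosses, because 1 - u may vanish.
  set c : LinkConfig G := F.toList.map fun f => (f, LinkType.cross) with hc
  have hmem : c ∈ openEdgesEq F := by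
    intro e
    have : (∃ l ∈ c, l.1 = e) ↔ e ∈ F := by
      simp only [hc, List.mem_map, Finset.mem_toList]
      constructor
      · rintro ⟨_, ⟨f, hf, rfl⟩, rfl⟩
        exact hf
      · exact fun he => ⟨_, ⟨e, he, rfl⟩, rfl⟩
    exact this
  have hcount : c.countP (fun l => l.2 = LinkType.doubleBar) = 0 := by
    simp [hc]
  have hpos : 0 < wt β u θ c := by
    rw [wt, ENNReal.ofReal_pos, loopWeight, hcount]
    positivity
  refine (hpos.trans_le ?_).ne'
  rw [← Set.indicator_of_mem hmem (wt β u θ)]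
  exact ENNReal.le_tsum c

theorem cond_loopMeasure_apply [Fintype V] (hβ : 0 < β) (hu : 0 < u) (hu1 : u ≤ 1) (hθ : 0 < θ)
    (F : Finset G.edgeSet) (S : Set (LinkConfig G)) :
    ProbabilityTheory.cond (loopMeasure G β u θ) (openEdgesEq F) S =
      (mass β u θ (openEdgesEq F))⁻¹ * mass β u θ (openEdgesEq F ∩ S) := by
  have h0 := mass_openEdgesEq_ne_zero hβ hu hθ F
  have hz0 : mass β u θ (Set.univ : Set (LinkConfig G)) ≠ 0 := fun h =>
    h0 (le_antisymm ((mass_mono (Set.subset_univ _)).trans_eq h) zero_le)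
  have hz := mass_ne_top hβ.le hu.le hu1 hθ (Set.univ : Set (LinkConfig G))
  have hF : MeasurableSet (openEdgesEq F) := trivial
  rw [ProbabilityTheory.cond_apply hF, loopMeasure_apply, loopMeasure_apply,
    ENNReal.mul_inv (Or.inl (ENNReal.inv_ne_zero.2 hz)) (Or.inl (ENNReal.inv_ne_top.2 hz0)), inv_inv]
  rw [mul_mul_mul_comm, ENNReal.mul_inv_cancel hz0 hz, one_mul]

end Main

theorem theorem1 {V : Type*} [Fintype V] (G : SimpleGraph V) [DecidableRel G.Adj]
    (K : ℕ) (hK : G.maxDegree ≤ K)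
    (β u θ : ℝ) (hβ : 0 < β) (hu : 0 < u) (hu1 : u ≤ 1) (hθ : 0 < θ)
    (F : Finset G.edgeSet) :
    StochasticallyDominates
      ((ProbabilityTheory.cond (loopMeasure G β u θ) (openEdgesEq F)).map (blockingField F))
      (bernoulliPercolation F
        ⟨blockingDelta K β u θ, blockingDelta_mem K hβ hu hu1 hθ⟩) := by
  classical
  have h0 := mass_openEdgesEq_ne_zero hβ hu hθ F
  have htop := mass_ne_top hβ.le hu.le hu1 hθ (openEdgesEq F)
  have hmeas : Measurable (blockingField F) := fun _ _ => trivial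
  have hprob : IsProbabilityMeasure
      (ProbabilityTheory.cond (loopMeasure G β u θ) (openEdgesEq F)) := by
    refine ⟨?_⟩
    rw [cond_loopMeasure_apply hβ hu hu1 hθ, Set.inter_univ, ENNReal.inv_mul_cancel h0 htop]
  have hprob' := Measure.isProbabilityMeasure_map
    (μ := ProbabilityTheory.cond (loopMeasure G β u θ) (openEdgesEq F)) hmeas.aemeasurable
  refine stochasticallyDominates_bernoulliPercolation _ _ fun e η => ?_
  have hfin : ∀ S : Set (F → Bool), MeasurableSet S := fun S => S.toFinite.measurableSet
  rw [Measure.map_apply hmeas (hfin _), Measure.map_apply hmeas (hfin _),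
    cond_loopMeasure_apply hβ hu hu1 hθ, cond_loopMeasure_apply hβ hu hu1 hθ, mul_left_comm]
  -- The prescribed field `η` as a set of blocking edges, so that the conditioning event becomes
  -- `patternSet F e B`.
  set B : Set G.edgeSet := {f | ∃ h : f ∈ F, η ⟨f, h⟩ = true} with hB
  have hiff : ∀ (c : LinkConfig G) (f : F), blockingField F c f = η f ↔
      (IsBlocking c (f : G.edgeSet) ↔ (f : G.edgeSet) ∈ B) := by
    intro c f
    have : (f : G.edgeSet) ∈ B ↔ η f = true := ⟨fun ⟨_, h⟩ => h, fun h => ⟨f.2, h⟩⟩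
    rw [this]
    by_cases hb : IsBlocking c (f : G.edgeSet) <;> cases η f <;> simp [blockingField, hb]
  have hset : openEdgesEq F ∩ blockingField F ⁻¹' {ω | ∀ f, f ≠ e → ω f = η f} =
      patternSet F (e : G.edgeSet) B := by
    ext c
    simp only [Set.mem_inter_iff, Set.mem_preimage, Set.mem_ofPred_eq, patternSet, hiff]
    refine and_congr_right fun _ => ⟨fun h f hf hfe => ?_, fun h f hfe => ?_⟩
    · exact h ⟨f, hf⟩ fun h' => hfe (congrArg Subtype.val h')
    · exact h f f.2 fun h' => hfe (Subtype.ext h')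
  have hset' : openEdgesEq F ∩
      blockingField F ⁻¹' {ω | (∀ f, f ≠ e → ω f = η f) ∧ ω e = true} =
      patternSet F (e : G.edgeSet) B ∩ {c | IsBlocking c (e : G.edgeSet)} := by
    rw [← hset]
    ext c
    simp only [Set.mem_inter_iff, Set.mem_preimage, Set.mem_ofPred_eq, and_assoc]
    simp [blockingField]
  rw [hset, hset']
  gcongr
  exact blockingDelta_mul_mass_le hK hβ hu hu1 hθ e.2 B
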